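/- For $m\ge 1$ let $\omega_m$ be the volume of the unit ball of $\mathbb{R}^m$, let $P(E)$ denote the (De Giorgi) perimeter of a set $E\subset\mathbb{R}^n$, $|E|$ its Lebesgue measure, and $\mathcal{H}^{n-1}$ the $(n-1)$-dimensional Hausdorff measure. **Lens energy.** Let $L_n=\{(x',x_n)\in\mathbb{R}^{n-1}\times\mathbb{R} : |x'|^2+(|x_n|+\tfrac12)^2<1\}$ be the lens bounded by two unit spherical caps that are mirror images across $\{x_n=0\}$ and meet this hyperplane with interior contact angle $\pi/3$. Let $\mathcal{X}_{\mathrm{lens}}(1)=|L_n|^{-1/n}L_n$ be its dilate of volume one, let $\rho_n=\tfrac{\sqrt3}{2}|L_n|^{-1/n}$ be the radius of the disc $\mathcal{X}_{\mathrm{lens}}(1)\cap\{x_n=0\}$, and set $$\Lambda_{\mathrm{plane}}(n)=P(\mathcal{X}_{\mathrm{lens}}(1))-\omega_{n-1}\rho_n^{\,n-1}.$$ **Lawson cone competitor energy.** Let $k,l$ be positive integers, $n=k+l+2$, $\lambda=\sqrt{k/l}$, $\theta=\arctan\lambda$, and let $C_{k,l}=\{(x,y)\in\mathbb{R}^{k+1}\times\mathbb{R}^{l+1}:|x|^2=\tfrac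 kl|y|^2\}$ be the Lawson cone. Put $$h=\lambda\tan(\tfrac{2\pi}{3}-\theta)-1,\quad r=\lambda\sec(\tfrac{2\pi}{3}-\theta),\quad d=\tan(\tfrac{\pi}{6}+\theta)-\lambda,\quad \rho=\sec(\tfrac{\pi}{6}+\theta),$$ and let $E\subset\mathbb{R}^{k+1}\times\mathbb{R}^{l+1}=\mathbb{R}^n$ be the set of all $(x,y)$ such that $u=|x|$ and $v=|y|$ satisfy $u^2+(v+h)^2<r^2$ if $u\le\lambda v$, and $(u+d)^2+v^2<\rho^2$ if $u\ge\lambda v$. Let $\mathcal{X}(1)=|E|^{-1/n}E$, a set of volume one when $0<|E|<\infty$, and set $$M(k,l)=P(\mathcal{X}(1))-\mathcal{H}^{n-1}(C_{k,l}\cap\mathcal{X}(1)).$$ **Proposition.** 1. Let $n$ be an even integer with $4\le n\le 2700$ and let $k=\frac n2-1$. Then $M(k,k)<\Lambda_{\mathrm{plane}}(n)$. If $n\ge 8$, then also $M(k-1,k+1)<\Lambda_{\mathrm{plane}}(n)$. 2. Let $n$ be an odd integer with $5\le n\le 2700$ and let $k=\frac{n-1}2$. Then $M(k-1,k)<\Lambda_{\mathrm{plane}}(n)$.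 -/

import Mathlib

open MeasureTheory Set
open scoped ENNReal Pointwise

noncomputable section

namespace LensLawson

/-- The divergence of a vector field `T` at `x`, i.e. the trace of its derivative. -/
def divergence {V : Type*} [NormedAddCommGroup V] [InnerProductSpace ℝ V]
    (T : V → V) (x : V) : ℝ :=
  LinearMap.trace ℝ V (fderiv ℝ T x : V →ₗ[ℝ] V)

/-- The (De Giorgi) perimeter of a measurable subset `E` of a finite-dimensional Euclidean space,
`P(E) = sup { ∫_E div T : T ∈ C¹_c(V; V), |T| ≤ 1 }`, with values in `[0, ∞]`. -/
def perimeter {V : Type*} [NormedAddCommGroup V] [InnerProductSpace ℝ V]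
    [FiniteDimensional ℝ V] [MeasurableSpace V] [BorelSpace V] (E : Set V) : ℝ≥0∞ :=
  ⨆ (T : V → V) (_ : ContDiff ℝ 1 T) (_ : HasCompactSupport T) (_ : ∀ x, ‖T x‖ ≤ 1),
    ENNReal.ofReal (∫ x in E, divergence T x)

/-! ### The standard lens and its renormalized energy -/

/-- The volume `ω_m` of the unit ball of `ℝ^m`. -/
def unitBallVolume (m : ℕ) : ℝ :=
  (volume (Metric.ball (0 : EuclideanSpace ℝ (Fin m)) 1)).toReal

/-- `ℝ^n` written as `ℝ^(n-1) × ℝ`, with the Euclidean (not the sup) norm;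
`p.snd` is the last coordinate `x_n`. -/
abbrev HyperplaneSplit (n : ℕ) : Type :=
  WithLp 2 (EuclideanSpace ℝ (Fin (n - 1)) × ℝ)

/-- The open lens bounded by two unit spherical caps that are mirror images across `{x_n = 0}`
and meet this hyperplane with interior contact angle `π/3`: the upper cap has centre `(0, -1/2)`,
the lower one has centre `(0, 1/2)`. -/
def unitLens (n : ℕ) : Set (HyperplaneSplit n) :=
  {p | ‖p.fst‖ ^ 2 + (|p.snd| + 1 / 2) ^ 2 < 1}

/-- The factor by which `unitLens n` is dilated to obtain volume one. -/
def lensScale (n : ℕ) : ℝ :=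
  (volume (unitLens n)).toReal ^ (-(1 : ℝ) / n)

/-- The bounded chamber of the standard lens cluster: the lens of volume one. -/
def lensChamber (n : ℕ) : Set (HyperplaneSplit n) :=
  lensScale n • unitLens n

/-- The radius `ρ_n` of the disc cut out of the volume-one lens by `{x_n = 0}`
(see `mem_lensChamber_hyperplane_iff`). -/
def lensRadius (n : ℕ) : ℝ :=
  Real.sqrt 3 / 2 * lensScale n

/-- The renormalized lens energy `Λ_plane(n) = P(lens) - ω_{n-1} ρ_n^{n-1}`. -/
def planeEnergy (n : ℕ) : ℝ :=
  (perimeter (lensChamber n)).toReal - unitBallVolume (n - 1) * lensRadius n ^ (n - 1)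

/-! ### The competitor modelled on a Lawson cone -/

/-- `ℝ^(k+l+2)` written as `ℝ^(k+1) × ℝ^(l+1)`, with the Euclidean norm. -/
abbrev LawsonSplit (k l : ℕ) : Type :=
  WithLp 2 (EuclideanSpace ℝ (Fin (k + 1)) × EuclideanSpace ℝ (Fin (l + 1)))

/-- The Lawson cone `C_{k,l} = {(x, y) : |x|² = (k/l) |y|²}`. -/
def lawsonCone (k l : ℕ) : Set (LawsonSplit k l) :=
  {p | ‖p.fst‖ ^ 2 = (k : ℝ) / l * ‖p.snd‖ ^ 2}

/-- `λ = √(k/l)`: in the variables `u = |x|`, `v = |y|` the cone is the line `u = λ v`. -/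
def slope (k l : ℕ) : ℝ := Real.sqrt ((k : ℝ) / l)

/-- `θ = arctan λ`, the angle between the line `u = λ v` and the `v`-axis. -/
def coneAngle (k l : ℕ) : ℝ := Real.arctan (slope k l)

/-- The first arc, in `{u < λ v}`, lies on the circle of centre `(0, -h)` and radius `r`. It starts
at `(λ, 1)`, making the angle `π/3` with the line `u = λ v`, and meets the `v`-axis at a right
angle. This is `h = λ tan(2π/3 - θ) - 1`. -/
def arcH (k l : ℕ) : ℝ :=
  slope k l * Real.tan (2 * Real.pi / 3 - coneAngle k l) - 1

/-- The radius `r = λ sec(2π/3 - θ)` of the first arc. -/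
def arcR (k l : ℕ) : ℝ :=
  slope k l / Real.cos (2 * Real.pi / 3 - coneAngle k l)

/-- The second arc, in `{u > λ v}`, lies on the circle of centre `(-d, 0)` and radius `ρ`. It starts
at `(λ, 1)`, making the angle `π/3` with the line `u = λ v`, and meets the `u`-axis at a right
angle. This is `d = tan(π/6 + θ) - λ`. -/
def arcD (k l : ℕ) : ℝ :=
  Real.tan (Real.pi / 6 + coneAngle k l) - slope k l

/-- The radius `ρ = sec(π/6 + θ)` of the second arc. -/
def arcRho (k l : ℕ) : ℝ :=
  1 / Real.cos (Real.pi / 6 + coneAngle k l)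

/-- The slice in the closed quadrant `u, v ≥ 0`: the region between the axes and the two arcs.
On the line `u = λ v` itself the two conditions coincide (they say `v < 1`). -/
def slice (k l : ℕ) : Set (ℝ × ℝ) :=
  {q | 0 ≤ q.1 ∧ 0 ≤ q.2 ∧
    (q.1 ≤ slope k l * q.2 → q.1 ^ 2 + (q.2 + arcH k l) ^ 2 < arcR k l ^ 2) ∧
    (slope k l * q.2 ≤ q.1 → (q.1 + arcD k l) ^ 2 + q.2 ^ 2 < arcRho k l ^ 2)}

/-- The `SO(k+1) × SO(l+1)`-invariant set `E` with the given slice. -/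
def lawsonSet (k l : ℕ) : Set (LawsonSplit k l) :=
  {p | (‖p.fst‖, ‖p.snd‖) ∈ slice k l}

/-- The bounded chamber of the competitor: `E / |E|^{1/n}` with `n = k + l + 2`, of volume one. -/
def lawsonChamber (k l : ℕ) : Set (LawsonSplit k l) :=
  ((volume (lawsonSet k l)).toReal ^ (-(1 : ℝ) / ((k : ℝ) + l + 2))) • lawsonSet k l

open scoped MeasureTheory in
/-- The competitor energy `M(k,l) = P(X) - H^{n-1}(C_{k,l} ∩ X)`, where `n = k + l + 2` and `X` is
the bounded chamber. `μHE[d]` is the `d`-dimensional Hausdorff measure normalized to agree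
with Lebesgue measure on `ℝ^d`. The value lies in `(-∞, +∞]`: an infinite perimeter would give
`M(k,l) = ⊤`, so that an upper bound on `M(k,l)` contains the finiteness of the perimeter. -/
def lawsonEnergy (k l : ℕ) : EReal :=
  (perimeter (lawsonChamber k l) : EReal) -
    ((μHE[k + l + 1] (lawsonCone k l ∩ lawsonChamber k l)).toReal : EReal)

/-! ### Facts about the normalizations -/

theorem isOpen_unitLens (n : ℕ) : IsOpen (unitLens n) :=
  isOpen_lt (by fun_prop) continuous_const

theorem zero_mem_unitLens (n : ℕ) : (0 : HyperplaneSplit n) ∈ unitLens n := by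
  simp only [unitLens, mem_ofPred_eq, WithLp.zero_fst, WithLp.zero_snd, norm_zero, abs_zero]
  norm_num

theorem unitLens_subset_ball (n : ℕ) : unitLens n ⊆ Metric.ball 0 1 := by
  intro p hp
  simp only [unitLens, mem_ofPred_eq] at hp
  have h := WithLp.prod_norm_sq_eq_of_L2 p
  rw [Real.norm_eq_abs] at h
  rw [mem_ball_zero_iff]
  nlinarith [abs_nonneg p.snd, norm_nonneg p]

theorem lensScale_pos (n : ℕ) : 0 < lensScale n := by
  refine Real.rpow_pos_of_pos (ENNReal.toReal_pos ?_ ?_) _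
  · exact ((isOpen_unitLens n).measure_pos volume ⟨0, zero_mem_unitLens n⟩).ne'
  · exact ((measure_mono (unitLens_subset_ball n)).trans_lt Metric.isBounded_ball.measure_lt_top).ne

/-- The volume-one lens meets `{x_n = 0}` in the open disc of radius `ρ_n` about the origin. -/
theorem mem_lensChamber_hyperplane_iff (n : ℕ) (x : EuclideanSpace ℝ (Fin (n - 1))) :
    WithLp.toLp 2 (x, (0 : ℝ)) ∈ lensChamber n ↔ ‖x‖ < lensRadius n := by
  have hs := lensScale_pos n
  rw [lensChamber, mem_smul_set_iff_inv_smul_mem₀ hs.ne']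
  have h1 : (lensScale n)⁻¹ • WithLp.toLp 2 (x, (0 : ℝ)) ∈ unitLens n ↔
      ((lensScale n)⁻¹ * ‖x‖) ^ 2 + (1 / 2 : ℝ) ^ 2 < 1 := by
    simp [unitLens, norm_smul, abs_of_pos hs]
  rw [h1, lensRadius, ← div_lt_iff₀ hs, div_eq_inv_mul ‖x‖]
  have h0 : 0 ≤ (lensScale n)⁻¹ * ‖x‖ := by positivity
  have h3 : 0 ≤ Real.sqrt 3 / 2 := by positivity
  rw [← sq_lt_sq₀ h0 h3, div_pow (Real.sqrt 3), Real.sq_sqrt (by norm_num)]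
  constructor <;> intro h <;> linarith

/-- The lens chamber has volume one. -/
theorem volume_lensChamber (n : ℕ) (hn : 1 ≤ n) : volume (lensChamber n) = 1 := by
  have hs := lensScale_pos n
  have hfin : volume (unitLens n) ≠ ⊤ :=
    ((measure_mono (unitLens_subset_ball n)).trans_lt Metric.isBounded_ball.measure_lt_top).ne
  have hpos : 0 < (volume (unitLens n)).toReal :=
    ENNReal.toReal_pos ((isOpen_unitLens n).measure_pos volume ⟨0, zero_mem_unitLens n⟩).ne' hfin
  have hdim : Module.finrank ℝ (HyperplaneSplit n) = n := by
    rw [(WithLp.linearEquiv 2 ℝ (EuclideanSpace ℝ (Fin (n - 1)) × ℝ)).finrank_eq]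
    simp; omega
  have hn0 : (n : ℝ) ≠ 0 := by positivity
  rw [lensChamber, Measure.addHaar_smul, hdim, abs_of_pos (by positivity), lensScale,
    ← Real.rpow_natCast, ← Real.rpow_mul hpos.le, div_mul_cancel₀ _ hn0, Real.rpow_neg_one,
    ENNReal.ofReal_inv_of_pos hpos, ENNReal.ofReal_toReal hfin]
  exact ENNReal.inv_mul_cancel (by rintro h; simp [h] at hpos) hfin

end LensLawson

end

/-!
Both energies are compared through a scale-invariant quantity. By the divergence theorem for the
position vector, the lens satisfies `Λ_plane(n) ≥ n |L|^{1/n}` (`le_planeEnergy`), and `|L|` is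
bounded below by an explicit antiderivative (`le_volume_unitLens`). In polar coordinates in both
factors the volume of the competitor is `c V` and its perimeter at most `c A`, where `c` is the
product of the areas of the two unit spheres and `V`, `A` are weighted area and length integrals
over the two arcs; its cone part has measure at least `c λ^k σ / (n - 1)` with `σ = √(1 + λ²)`. So
it is enough to find a `q` with `A - λ^k σ / (n - 1) ≤ n q V` and `q^n c V < |L|`
(`lawsonEnergy_lt_planeEnergy`). The choice is `q = √3 / (2σ) · (1 - 2 / (3n))`.

The perimeter is bounded above by the one-sided Minkowski content, as the competitor is a sublevel
set of a `1`-Lipschitz function (`perimeter_sublevel_le`). The measure of the cone is bounded below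
by writing each half of it as a graph and using one half of the area formula
(`lintegral_sqrt_one_add_sq_le`); that this measure is finite, so that its real value is not the
junk value `0`, follows from a finite cover by Lipschitz graphs over hyperplanes
(`euclideanHausdorffMeasure_cone_lt_top`).

For one arc, integration by parts expresses `n` times its share of `V` by its length integral and
the integral of `u^k v^l` (`IsArc.mul_arcVolume_eq`). A parabola above the arc turns these into the
integrals `∫₀¹ t^k (1 + α (1 - t²))^l dt`, whose integrand is dominated by the derivative of an
explicit function (`two_mul_capIntegral_le`). What remains for the first inequality is a statement
about `k`, `l` and the slope only (`IsBalanced.sum_bound`). As `l - k` takes few values, eliminating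
the dimension leaves finitely many polynomials in one variable, whose signs are read off from their
coefficients in the Bernstein basis. The second inequality is a bound for a quotient of Gamma values
(`orbitRatio`), which follows from the duplication formula and log-convexity
(`orbitRatio_self_sq_le`, `orbitRatio_succ_sq_le`, `orbitRatio_add_two_sq_le`), and
`(1 - 2 / (3n))^n ≤ exp (-2/3)`.
-/

namespace LensLawson

open Filter Topology

/-! ### The perimeter -/

section Perimeter

variable {V : Type*} [NormedAddCommGroup V] [InnerProductSpace ℝ V]

theorem divergence_eq_sum {ι : Type*} [Fintype ι] (b : OrthonormalBasis ι ℝ V) {T : V → V} {x : V}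
    (hT : DifferentiableAt ℝ T x) :
    divergence T x = ∑ i, lineDeriv ℝ (fun y => inner ℝ (b i) (T y)) x (b i) := by
  rw [divergence, LinearMap.trace_eq_sum_inner _ b]
  refine Finset.sum_congr rfl fun i _ => ?_
  have h : HasFDerivAt (fun y => inner ℝ (b i) (T y))
      ((innerSL ℝ (b i)).comp (fderiv ℝ T x)) x :=
    (innerSL ℝ (b i)).hasFDerivAt.comp x hT.hasFDerivAt
  rw [h.differentiableAt.lineDeriv_eq_fderiv, h.fderiv]
  rfl

theorem hasCompactSupport_divergence {T : V → V} (hT : HasCompactSupport T) :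
    HasCompactSupport (divergence T) := by
  refine (hT.fderiv (𝕜 := ℝ)).mono' ?_
  intro x hx
  apply subset_tsupport
  intro h0
  apply hx
  simp [divergence, h0]

variable [FiniteDimensional ℝ V]

theorem continuous_divergence {T : V → V} (hT : ContDiff ℝ 1 T) :
    Continuous (divergence T) := by
  have h1 : Continuous fun x => fderiv ℝ T x := hT.continuous_fderiv (by simp)
  let b := stdOrthonormalBasis ℝ V
  have h2 : divergence T = fun x => ∑ i, inner ℝ (b i) (fderiv ℝ T x (b i)) := by
    ext x
    rw [divergence, LinearMap.trace_eq_sum_inner _ b]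
    rfl
  rw [h2]
  fun_prop

variable [MeasurableSpace V] [BorelSpace V]

theorem integrable_divergence {T : V → V} (hT : ContDiff ℝ 1 T) (hs : HasCompactSupport T) :
    Integrable (divergence T) :=
  (continuous_divergence hT).integrable_of_hasCompactSupport (hasCompactSupport_divergence hs)

/-- Integration by parts against a Lipschitz cutoff `f` whose derivative vanishes off `S`. -/
theorem integral_mul_divergence_le {f : V → ℝ} {C : NNReal} (hf : LipschitzWith C f) {S : Set V}
    (hS : MeasurableSet S) (hSfin : volume S ≠ ∞) (hder : ∀ x ∉ S, fderiv ℝ f x = 0)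
    {T : V → V} (hT : ContDiff ℝ 1 T) (hs : HasCompactSupport T) (hb : ∀ x, ‖T x‖ ≤ 1) :
    ∫ x, f x * divergence T x ≤ C * volume.real S := by
  let b := stdOrthonormalBasis ℝ V
  have hTi (i) : ContDiff ℝ 1 fun y => inner ℝ (b i) (T y) := contDiff_const.inner ℝ hT
  have hsi (i) : HasCompactSupport fun y => inner ℝ (b i) (T y) :=
    hs.comp_left (g := fun z => inner ℝ (b i) z) (by simp)
  have hLip (i) : ∃ D, LipschitzWith D fun y => inner ℝ (b i) (T y) :=
    ContDiff.lipschitzWith_of_hasCompactSupport (hsi i) (hTi i) (by simp)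
  have hint (i) : Integrable fun x => lineDeriv ℝ f x (-b i) * inner ℝ (b i) (T x) := by
    have h1 : Integrable fun x => inner ℝ (b i) (T x) :=
      (hTi i).continuous.integrable_of_hasCompactSupport (hsi i)
    exact h1.bdd_mul (hf.memLp_lineDeriv (μ := volume) (-b i)).aestronglyMeasurable
      (Eventually.of_forall fun x => norm_lineDeriv_le_of_lipschitz ℝ hf)
  have hintd (i) : Integrable fun x => lineDeriv ℝ (fun y => inner ℝ (b i) (T y)) x (b i) * f x := by
    have hc : Continuous fun x => lineDeriv ℝ (fun y => inner ℝ (b i) (T y)) x (b i) := by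
      have : (fun x => lineDeriv ℝ (fun y => inner ℝ (b i) (T y)) x (b i)) =
          fun x => fderiv ℝ (fun y => inner ℝ (b i) (T y)) x (b i) := by
        ext x
        exact ((hTi i).differentiable (by simp) x).lineDeriv_eq_fderiv
      rw [this]
      exact ((hTi i).continuous_fderiv (by simp)).clm_apply continuous_const
    refine (hc.mul hf.continuous).integrable_of_hasCompactSupport ?_
    refine HasCompactSupport.mul_right ?_
    refine ((hsi i).fderiv (𝕜 := ℝ)).mono' ?_
    intro x hx
    apply subset_tsupport
    intro h0
    apply hx
    show lineDeriv ℝ _ _ _ = 0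
    rw [((hTi i).differentiable (by simp) x).lineDeriv_eq_fderiv, h0]
    simp
  have key : ∫ x, f x * divergence T x =
      ∫ x, ∑ i, lineDeriv ℝ f x (-b i) * inner ℝ (b i) (T x) := by
    rw [integral_finsetSum _ fun i _ => hint i]
    have h1 (i) : ∫ x, lineDeriv ℝ f x (-b i) * inner ℝ (b i) (T x) =
        ∫ x, lineDeriv ℝ (fun y => inner ℝ (b i) (T y)) x (b i) * f x := by
      obtain ⟨D, hD⟩ := hLip i
      simpa using hf.integral_lineDeriv_mul_eq (μ := volume) hD (hsi i) (-b i)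
    simp_rw [h1]
    rw [← integral_finsetSum _ fun i _ => hintd i]
    congr 1
    ext x
    rw [divergence_eq_sum b (hT.differentiable (by simp) x), Finset.mul_sum]
    exact Finset.sum_congr rfl fun i _ => mul_comm _ _
  rw [key]
  -- By Rademacher's theorem the sum is `-Df(x) (T x)` almost everywhere.
  have hbound : ∀ᵐ x, (∑ i, lineDeriv ℝ f x (-b i) * inner ℝ (b i) (T x)) ≤
      S.indicator (fun _ => (C : ℝ)) x := by
    filter_upwards [hf.ae_differentiableAt (μ := volume)] with x hx
    have h1 : (∑ i, lineDeriv ℝ f x (-b i) * inner ℝ (b i) (T x)) = -fderiv ℝ f x (T x) := by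
      simp_rw [hx.lineDeriv_eq_fderiv]
      conv_rhs => rw [← b.sum_repr' (T x)]
      simp [map_sum, mul_comm]
    rw [h1]
    by_cases hxS : x ∈ S
    · rw [indicator_of_mem hxS]
      have h2 : ‖fderiv ℝ f x‖ ≤ C := norm_fderiv_le_of_lipschitz ℝ hf
      calc -fderiv ℝ f x (T x) ≤ ‖fderiv ℝ f x (T x)‖ := by
            rw [Real.norm_eq_abs]; exact neg_le_abs _
        _ ≤ ‖fderiv ℝ f x‖ * ‖T x‖ := ContinuousLinearMap.le_opNorm _ _
        _ ≤ C * 1 := mul_le_mul h2 (hb x) (norm_nonneg _) C.2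
        _ = C := mul_one _
    · simp [indicator_of_notMem hxS, hder x hxS]
  have hfin : Integrable (S.indicator fun _ : V => (C : ℝ)) :=
    (integrable_indicator_iff hS).2 (integrableOn_const hSfin)
  refine (integral_mono_ae (integrable_finsetSum _ fun i _ => hint i) hfin hbound).trans ?_
  rw [integral_indicator hS, setIntegral_const, smul_eq_mul, mul_comm]

/-- The perimeter of a sublevel set of a `1`-Lipschitz function is at most its one-sided Minkowski
content. -/
theorem perimeter_sublevel_le {g : V → ℝ} (hg : LipschitzWith 1 g) {K : ℝ} (hK : 0 ≤ K)
    (h : ∀ η > 0, ∀ᶠ ε in 𝓝[>] (0 : ℝ),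
      volume {x | -ε < g x ∧ g x < 0} ≤ ENNReal.ofReal (ε * (K + η))) :
    perimeter {x | g x < 0} ≤ ENNReal.ofReal K := by
  refine iSup_le fun T => iSup_le fun hT => iSup_le fun hs => iSup_le fun hb => ?_
  apply ENNReal.ofReal_le_ofReal
  have hmeas : MeasurableSet {x | g x < 0} := measurableSet_lt hg.continuous.measurable measurable_const
  -- The cutoff `F ε` tends to the indicator of `{g < 0}`; its derivative lives on `{-ε < g < 0}`.
  let F : ℝ → V → ℝ := fun ε x => max 0 (min 1 (-ε⁻¹ * g x))
  have hF01 (ε x) : 0 ≤ F ε x ∧ F ε x ≤ 1 :=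
    ⟨le_max_left _ _, max_le zero_le_one (min_le_left _ _)⟩
  have hF1 {ε x} (hε : 0 < ε) (hx : g x ≤ -ε) : F ε x = 1 := by
    have : 1 ≤ -ε⁻¹ * g x := by
      rw [neg_mul, ← mul_neg, inv_mul_eq_div, le_div_iff₀ hε]
      linarith
    show max 0 (min 1 (-ε⁻¹ * g x)) = 1
    rw [min_eq_left this, max_eq_right zero_le_one]
  have hF0 {ε x} (hε : 0 < ε) (hx : 0 ≤ g x) : F ε x = 0 := by
    have : -ε⁻¹ * g x ≤ 0 := by
      have := mul_nonneg (inv_nonneg.2 hε.le) hx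
      linarith
    exact max_eq_left ((min_le_right _ _).trans this)
  have hlim : Tendsto (fun ε => ∫ x, F ε x * divergence T x) (𝓝[>] 0)
      (𝓝 (∫ x in {x | g x < 0}, divergence T x)) := by
    rw [← integral_indicator hmeas]
    refine tendsto_integral_filter_of_dominated_convergence (fun x => ‖divergence T x‖) ?_ ?_ ?_ ?_
    · refine Eventually.of_forall fun ε => ?_
      refine Continuous.aestronglyMeasurable ?_
      have := hg.continuous
      have := continuous_divergence hT
      fun_prop
    · refine Eventually.of_forall fun ε => Eventually.of_forall fun x => ?_
      rw [norm_mul]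
      refine mul_le_of_le_one_left (norm_nonneg _) ?_
      rw [Real.norm_eq_abs, abs_of_nonneg (hF01 ε x).1]
      exact (hF01 ε x).2
    · exact (integrable_divergence hT hs).norm
    · refine Eventually.of_forall fun x => ?_
      by_cases hx : g x < 0
      · rw [indicator_of_mem (by exact hx)]
        refine tendsto_const_nhds.congr' ?_
        filter_upwards [Ioo_mem_nhdsGT (neg_pos.2 hx)] with ε hε
        rw [hF1 hε.1 (by linarith [hε.2]), one_mul]
      · rw [indicator_of_notMem (by exact hx)]
        refine tendsto_const_nhds.congr' ?_
        filter_upwards [self_mem_nhdsWithin] with ε hε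
        rw [hF0 hε (not_lt.1 hx), zero_mul]
  refine le_of_forall_pos_le_add fun η hη => ?_
  refine le_of_tendsto hlim ?_
  filter_upwards [h η hη, self_mem_nhdsWithin] with ε hε hε0
  have hε0 : 0 < ε := hε0
  set S := {x | -ε < g x ∧ g x < 0} with hSdef
  have hS : MeasurableSet S :=
    (measurableSet_lt measurable_const hg.continuous.measurable).inter hmeas
  have hSfin : volume S ≠ ∞ := (hε.trans_lt ENNReal.ofReal_lt_top).ne
  have hLip : LipschitzWith (Real.toNNReal ε⁻¹) (F ε) := by
    have h1 : LipschitzWith (Real.toNNReal ε⁻¹) fun x => -ε⁻¹ * g x := by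
      refine LipschitzWith.of_dist_le_mul fun x y => ?_
      rw [Real.dist_eq, ← mul_sub, abs_mul, abs_neg, abs_of_pos (inv_pos.2 hε0),
        Real.coe_toNNReal _ (inv_pos.2 hε0).le, ← Real.dist_eq]
      have := hg.dist_le_mul x y
      simp only [NNReal.coe_one, one_mul] at this
      gcongr
    exact (h1.const_min 1).const_max 0
  -- Off `S` the function `F ε` is extremal, so no regularity of `g` is needed.
  have hder : ∀ x ∉ S, fderiv ℝ (F ε) x = 0 := by
    intro x hx
    by_cases hx0 : g x < 0
    · have hx1 : g x ≤ -ε := by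
        by_contra hcon
        exact hx ⟨not_le.1 hcon, hx0⟩
      refine IsLocalMax.fderiv_eq_zero (Eventually.of_forall fun y => ?_)
      rw [hF1 hε0 hx1]
      exact (hF01 ε y).2
    · refine IsLocalMin.fderiv_eq_zero (Eventually.of_forall fun y => ?_)
      rw [hF0 hε0 (not_lt.1 hx0)]
      exact (hF01 ε y).1
  refine (integral_mul_divergence_le hLip hS hSfin hder hT hs hb).trans ?_
  rw [Real.coe_toNNReal _ (inv_pos.2 hε0).le, inv_mul_le_iff₀ hε0]
  exact ENNReal.toReal_le_of_le_ofReal (by positivity) hε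

theorem perimeter_smul_le (hn : 0 < Module.finrank ℝ V) {E : Set V} {s : ℝ} (hs : 0 < s) :
    perimeter (s • E) ≤ ENNReal.ofReal (s ^ (Module.finrank ℝ V - 1)) * perimeter E := by
  refine iSup_le fun T => iSup_le fun hT => iSup_le fun hc => iSup_le fun hb => ?_
  have hdiv (x : V) : divergence (fun y => T (s • y)) x = s * divergence T (s • x) := by
    have h1 : HasFDerivAt (fun y => T (s • y))
        ((fderiv ℝ T (s • x)).comp (s • ContinuousLinearMap.id ℝ V)) x :=
      (hT.differentiable (by simp) (s • x)).hasFDerivAt.comp x ((hasFDerivAt_id x).const_smul s)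
    rw [divergence, h1.fderiv, divergence]
    simp
  have h1 : ∫ x in s • E, divergence T x =
      s ^ (Module.finrank ℝ V - 1) * ∫ x in E, divergence (fun y => T (s • y)) x := by
    simp_rw [hdiv]
    rw [integral_const_mul, Measure.setIntegral_comp_smul_of_pos volume _ E hs, smul_eq_mul,
      ← mul_assoc, ← mul_assoc, ← pow_succ, Nat.sub_add_cancel hn, mul_inv_cancel₀ (by positivity),
      one_mul]
  rw [h1, ENNReal.ofReal_mul (by positivity)]
  gcongr
  refine le_iSup_of_le (fun y => T (s • y)) (le_iSup_of_le ?_ (le_iSup_of_le ?_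
    (le_iSup_of_le (fun x => hb _) le_rfl)))
  · exact hT.comp (contDiff_const_smul s)
  · exact hc.comp_homeomorph (Homeomorph.smulOfNeZero s hs.ne')

theorem perimeter_smul (hn : 0 < Module.finrank ℝ V) {E : Set V} {s : ℝ} (hs : 0 < s) :
    perimeter (s • E) = ENNReal.ofReal (s ^ (Module.finrank ℝ V - 1)) * perimeter E := by
  refine le_antisymm (perimeter_smul_le hn hs) ?_
  have h := perimeter_smul_le hn (E := s • E) (inv_pos.2 hs)
  rw [inv_smul_smul₀ hs.ne'] at h
  calc _ ≤ ENNReal.ofReal (s ^ (Module.finrank ℝ V - 1)) *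
        (ENNReal.ofReal (s⁻¹ ^ (Module.finrank ℝ V - 1)) * perimeter (s • E)) := by gcongr
    _ = perimeter (s • E) := by
      rw [← mul_assoc, ← ENNReal.ofReal_mul (by positivity), ← mul_pow, mul_inv_cancel₀ hs.ne',
        one_pow, ENNReal.ofReal_one, one_mul]

end Perimeter
end LensLawson

namespace LensLawson

open Filter Topology

/-! ### The lens -/

section Gauge

variable {X Y : Type*} [NormedAddCommGroup X] [NormedAddCommGroup Y]

/-- The distance, in the half-plane of the variables `(‖x‖, ‖y‖)`, to the point `(-a, -b)`. -/
noncomputable def quadrantDist (a b : ℝ) (p : WithLp 2 (X × Y)) : ℝ :=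
  Real.sqrt ((‖p.fst‖ + a) ^ 2 + (‖p.snd‖ + b) ^ 2)

theorem abs_sqrt_add_sq_sub_le (a b a' b' : ℝ) :
    |Real.sqrt (a ^ 2 + b ^ 2) - Real.sqrt (a' ^ 2 + b' ^ 2)| ≤
      Real.sqrt ((a - a') ^ 2 + (b - b') ^ 2) := by
  have h (u v : ℝ) : Real.sqrt (u ^ 2 + v ^ 2) = ‖WithLp.toLp 2 (u, v)‖ := by
    rw [WithLp.prod_norm_eq_of_L2]
    simp
  rw [h, h, h, ← Real.norm_eq_abs]
  exact abs_norm_sub_norm_le (WithLp.toLp 2 (a, b)) (WithLp.toLp 2 (a', b'))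

theorem lipschitzWith_quadrantDist (a b : ℝ) :
    LipschitzWith 1 (quadrantDist a b : WithLp 2 (X × Y) → ℝ) := by
  refine LipschitzWith.of_dist_le_mul fun p q => ?_
  rw [NNReal.coe_one, one_mul, Real.dist_eq, dist_eq_norm, WithLp.prod_norm_eq_of_L2]
  refine (abs_sqrt_add_sq_sub_le _ _ _ _).trans (Real.sqrt_le_sqrt ?_)
  have h1 := abs_norm_sub_norm_le p.fst q.fst
  have h2 := abs_norm_sub_norm_le p.snd q.snd
  have h3 : (‖p.fst‖ + a - (‖q.fst‖ + a)) ^ 2 ≤ ‖p.fst - q.fst‖ ^ 2 := by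
    rw [add_sub_add_right_eq_sub, ← sq_abs]; gcongr
  have h4 : (‖p.snd‖ + b - (‖q.snd‖ + b)) ^ 2 ≤ ‖p.snd - q.snd‖ ^ 2 := by
    rw [add_sub_add_right_eq_sub, ← sq_abs]; gcongr
  exact add_le_add h3 h4

end Gauge

theorem unitLens_eq (n : ℕ) : unitLens n = {p | quadrantDist 0 (1 / 2) p - 1 < 0} := by
  ext p
  simp only [unitLens, mem_ofPred_eq, quadrantDist, add_zero, sub_neg, Real.norm_eq_abs]
  rw [Real.sqrt_lt' one_pos, one_pow]

theorem finrank_hyperplaneSplit {n : ℕ} (hn : 1 ≤ n) :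
    Module.finrank ℝ (HyperplaneSplit n) = n := by
  rw [(WithLp.linearEquiv 2 ℝ (EuclideanSpace ℝ (Fin (n - 1)) × ℝ)).finrank_eq]
  simp; omega

theorem volume_unitLens_ne_top (n : ℕ) : volume (unitLens n) ≠ ∞ :=
  ((measure_mono (unitLens_subset_ball n)).trans_lt Metric.isBounded_ball.measure_lt_top).ne

theorem volume_unitLens_pos (n : ℕ) : 0 < volume.real (unitLens n) :=
  ENNReal.toReal_pos ((isOpen_unitLens n).measure_pos volume ⟨0, zero_mem_unitLens n⟩).ne'
    (volume_unitLens_ne_top n)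

/-- Dilating the lens by `1 - 2ε` moves it away from its boundary by at least `ε`. -/
theorem smul_unitLens_subset {n : ℕ} {ε : ℝ} (h0 : 0 < ε) (h1 : ε < 1 / 2) :
    (1 - 2 * ε) • unitLens n ⊆ {p ∈ unitLens n | quadrantDist 0 (1 / 2) p - 1 ≤ -ε} := by
  have hs : 0 < 1 - 2 * ε := by linarith
  rintro _ ⟨p, hp, rfl⟩
  have hp' : ‖p.fst‖ ^ 2 + (|p.snd| + 1 / 2) ^ 2 < 1 := hp
  have key : quadrantDist 0 (1 / 2) ((1 - 2 * ε) • p) ≤ 1 - ε := by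
    rw [quadrantDist, Real.sqrt_le_left (by linarith)]
    simp only [WithLp.smul_fst, WithLp.smul_snd, norm_smul, Real.norm_eq_abs, abs_of_pos hs, add_zero]
    have := abs_nonneg p.snd
    have h2 : |p.snd| + 1 / 2 ≤ 1 := by nlinarith [sq_nonneg ‖p.fst‖]
    nlinarith [mul_nonneg hs.le hs.le, mul_nonneg hs.le h0.le]
  have key' : quadrantDist 0 (1 / 2) ((1 - 2 * ε) • p) - 1 ≤ -ε := by linarith
  refine ⟨?_, key'⟩
  rw [unitLens_eq]
  exact key'.trans_lt (neg_lt_zero.2 h0)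

/-- The layer of width `ε` along the boundary lies in `L \ (1 - 2ε) L`, so it has volume `O(ε)`. -/
theorem perimeter_unitLens_ne_top {n : ℕ} (hn : 1 ≤ n) : perimeter (unitLens n) ≠ ∞ := by
  have hfin := volume_unitLens_ne_top n
  have hL : LipschitzWith 1 fun p : HyperplaneSplit n => quadrantDist 0 (1 / 2) p - 1 :=
    LipschitzWith.of_dist_le_mul fun p q => by
      simpa [Real.dist_eq] using (lipschitzWith_quadrantDist 0 (1 / 2)).dist_le_mul p q
  rw [unitLens_eq]
  refine ((perimeter_sublevel_le hL (K := 2 * n * volume.real (unitLens n)) (by positivity)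
    fun η hη => ?_).trans_lt ENNReal.ofReal_lt_top).ne
  filter_upwards [Ioo_mem_nhdsGT (show (0 : ℝ) < 1 / 2 by norm_num)] with ε hε
  have hs : 0 < 1 - 2 * ε := by linarith [hε.2]
  have hsub := smul_unitLens_subset (n := n) hε.1 hε.2
  have hle : {p : HyperplaneSplit n | -ε < quadrantDist 0 (1 / 2) p - 1 ∧
      quadrantDist 0 (1 / 2) p - 1 < 0} ⊆ unitLens n \ (1 - 2 * ε) • unitLens n := by
    rintro p ⟨h1, h2⟩
    refine ⟨by rw [unitLens_eq]; exact h2, fun h3 => ?_⟩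
    exact absurd (hsub h3).2 (not_le.2 h1)
  refine (measure_mono hle).trans ?_
  have hm : MeasurableSet ((1 - 2 * ε) • unitLens n) :=
    ((isOpen_unitLens n).smul₀ hs.ne').measurableSet
  have hv : volume ((1 - 2 * ε) • unitLens n) =
      ENNReal.ofReal ((1 - 2 * ε) ^ n) * volume (unitLens n) := by
    rw [Measure.addHaar_smul, finrank_hyperplaneSplit hn, abs_of_pos (by positivity)]
  rw [measure_sdiff (hsub.trans fun p hp => hp.1) hm.nullMeasurableSet
    ((measure_mono (hsub.trans fun p hp => hp.1)).trans_lt hfin.lt_top).ne, hv,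
    ← ENNReal.ofReal_toReal hfin, ← ENNReal.ofReal_mul (by positivity),
    ← ENNReal.ofReal_sub _ (by positivity)]
  apply ENNReal.ofReal_le_ofReal
  have hB : 1 - n * (2 * ε) ≤ (1 - 2 * ε) ^ n := by
    have := one_add_mul_le_pow (a := -(2 * ε)) (by linarith) n
    rw [← sub_eq_add_neg] at this
    linarith
  change volume.real (unitLens n) - (1 - 2 * ε) ^ n * volume.real (unitLens n) ≤ _
  have := hε.1
  nlinarith [volume_unitLens_pos n, mul_pos this hη]

/-- A smooth approximation of the sign function. -/
noncomputable def smoothSign (δ t : ℝ) : ℝ := t / Real.sqrt (t ^ 2 + δ ^ 2)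

theorem contDiff_smoothSign {δ : ℝ} (hδ : 0 < δ) : ContDiff ℝ 1 (smoothSign δ) := by
  unfold smoothSign
  have (t : ℝ) : t ^ 2 + δ ^ 2 ≠ 0 := by positivity
  have h2 (t : ℝ) : Real.sqrt (t ^ 2 + δ ^ 2) ≠ 0 := by positivity
  refine contDiff_id.div (ContDiff.sqrt (by fun_prop) this) h2

theorem abs_smoothSign_le {δ : ℝ} (hδ : 0 < δ) (t : ℝ) : |smoothSign δ t| ≤ 1 := by
  rw [smoothSign, abs_div, abs_of_pos (show 0 < Real.sqrt (t ^ 2 + δ ^ 2) by positivity),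
    div_le_one (by positivity), ← Real.sqrt_sq_eq_abs]
  exact Real.sqrt_le_sqrt (by nlinarith [sq_nonneg δ])

theorem deriv_smoothSign_nonneg {δ : ℝ} (hδ : 0 < δ) (t : ℝ) : 0 ≤ deriv (smoothSign δ) t := by
  have h0 : 0 < t ^ 2 + δ ^ 2 := by positivity
  have h1 : HasDerivAt (fun t : ℝ => t ^ 2 + δ ^ 2) (2 * t) t := by
    simpa using (hasDerivAt_pow 2 t).add_const (δ ^ 2)
  have h2 := (hasDerivAt_id t).div (h1.sqrt h0.ne') (by positivity)
  have h3 : smoothSign δ = id / fun t => Real.sqrt (t ^ 2 + δ ^ 2) := rfl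
  rw [h3, h2.deriv]
  refine div_nonneg ?_ (by positivity)
  have h4 : 0 < Real.sqrt (t ^ 2 + δ ^ 2) := by positivity
  have h5 := Real.sq_sqrt h0.le
  rw [id, one_mul, sub_nonneg, mul_div_assoc', div_le_iff₀ (by positivity)]
  nlinarith [sq_nonneg δ]

/-- The field `p ↦ p + ½ sign(p_n) e_n`, with the sign smoothed. Without the smoothing it is the
outer normal field on the boundary of the lens. -/
noncomputable def lensField (n : ℕ) (δ : ℝ) (p : HyperplaneSplit n) : HyperplaneSplit n :=
  p + (smoothSign δ p.snd / 2) • WithLp.toLp 2 (0, 1)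

theorem contDiff_snd (n : ℕ) : ContDiff ℝ 1 fun p : HyperplaneSplit n => p.snd :=
  (WithLp.sndL 2 ℝ (EuclideanSpace ℝ (Fin (n - 1))) ℝ).contDiff

theorem contDiff_lensField (n : ℕ) {δ : ℝ} (hδ : 0 < δ) : ContDiff ℝ 1 (lensField n δ) := by
  unfold lensField
  have h := (contDiff_smoothSign hδ).comp (contDiff_snd n)
  exact contDiff_id.add ((h.div_const 2).smul contDiff_const)

theorem divergence_id_add_smul {V : Type*} [NormedAddCommGroup V] [InnerProductSpace ℝ V]
    [FiniteDimensional ℝ V] (π : V →L[ℝ] ℝ) {e : V} (he : π e = 1) {η : ℝ → ℝ} {p : V}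
    (hη : DifferentiableAt ℝ η (π p)) :
    divergence (fun y => y + (η (π y) / 2) • e) p = Module.finrank ℝ V + deriv η (π p) / 2 := by
  have h2 : HasFDerivAt (fun y => y + (η (π y) / 2) • e)
      (ContinuousLinearMap.id ℝ V + ((deriv η (π p) / 2) • π).smulRight e) p := by
    refine (hasFDerivAt_id p).add (HasFDerivAt.smul_const ?_ e)
    have h := (hη.hasDerivAt.comp_hasFDerivAt p π.hasFDerivAt).mul_const (1 / 2)
    convert! h using 1
    · ext y; simp [div_eq_mul_inv]
    · rw [smul_smul]; congr 1; ring
  rw [divergence, h2.fderiv]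
  simp only [ContinuousLinearMap.toLinearMap_add, map_add, ContinuousLinearMap.coe_id,
    LinearMap.trace_id]
  congr 1
  rw [ContinuousLinearMap.coe_smulRight, LinearMap.trace_smulRight]
  simp [he]

theorem divergence_lensField {n : ℕ} (hn : 1 ≤ n) {δ : ℝ} (hδ : 0 < δ) (p : HyperplaneSplit n) :
    divergence (lensField n δ) p = n + deriv (smoothSign δ) p.snd / 2 := by
  have h := divergence_id_add_smul (WithLp.sndL 2 ℝ (EuclideanSpace ℝ (Fin (n - 1))) ℝ)
    (e := WithLp.toLp 2 (0, 1)) (by simp) (p := p)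
    ((contDiff_smoothSign hδ).differentiable (by simp) _)
  rw [finrank_hyperplaneSplit hn] at h
  exact h

theorem norm_lensField_lt {n : ℕ} {δ : ℝ} (hδ : 0 < δ) {p : HyperplaneSplit n}
    (hp : p ∈ unitLens n) : ‖lensField n δ p‖ < 1 := by
  have hp' : ‖p.fst‖ ^ 2 + (|p.snd| + 1 / 2) ^ 2 < 1 := hp
  have h1 := WithLp.prod_norm_sq_eq_of_L2 (lensField n δ p)
  have h2 : (lensField n δ p).fst = p.fst := by simp [lensField]
  have h3 : (lensField n δ p).snd = p.snd + smoothSign δ p.snd / 2 := by simp [lensField]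
  have h4 : |p.snd + smoothSign δ p.snd / 2| ≤ |p.snd| + 1 / 2 := by
    refine (abs_add_le _ _).trans ?_
    have := abs_smoothSign_le hδ p.snd
    rw [abs_div, abs_two]
    linarith
  have h5 : (p.snd + smoothSign δ p.snd / 2) ^ 2 ≤ (|p.snd| + 1 / 2) ^ 2 := by
    rw [← sq_abs]; gcongr
  rw [h2, h3, Real.norm_eq_abs, sq_abs] at h1
  nlinarith [norm_nonneg (lensField n δ p)]

/-- The perimeter tested with the field `lensField`, cut off where its norm exceeds one. On
the lens the field has norm less than one, so that the cutoff is not felt there. -/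
theorem le_perimeter_unitLens_aux {n : ℕ} (hn : 1 ≤ n) {δ : ℝ} (hδ : 0 < δ) :
    ENNReal.ofReal ((1 + δ)⁻¹ * ∫ p in unitLens n, (n + deriv (smoothSign δ) p.snd / 2)) ≤
      perimeter (unitLens n) := by
  let χ : ContDiffBump (0 : HyperplaneSplit n) := ⟨1, 1 + δ, one_pos, by linarith⟩
  let F := lensField n δ
  let T : HyperplaneSplit n → HyperplaneSplit n := fun p => ((1 + δ)⁻¹ * χ (F p)) • F p
  have hF : ContDiff ℝ 1 F := contDiff_lensField n hδ
  have hT : ContDiff ℝ 1 T := (contDiff_const.mul (χ.contDiff.comp hF)).smul hF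
  have hFn (p) : ‖p‖ ≤ ‖F p‖ + 1 / 2 := by
    have h1 : p = F p - (smoothSign δ p.snd / 2) •
        WithLp.toLp 2 ((0 : EuclideanSpace ℝ (Fin (n - 1))), (1 : ℝ)) := by
      simp [F, lensField]
    have h2 : ‖(smoothSign δ p.snd / 2) •
        WithLp.toLp 2 ((0 : EuclideanSpace ℝ (Fin (n - 1))), (1 : ℝ))‖ ≤ 1 / 2 := by
      rw [norm_smul, WithLp.norm_toLp_snd, norm_one, mul_one, norm_div, Real.norm_eq_abs,
        Real.norm_two]
      have := abs_smoothSign_le hδ p.snd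
      linarith
    calc ‖p‖ = ‖F p - _‖ := congrArg norm h1
      _ ≤ _ := (norm_sub_le _ _).trans (by gcongr)
  have hc : HasCompactSupport T := by
    refine HasCompactSupport.of_support_subset_isCompact
      (isCompact_closedBall (0 : HyperplaneSplit n) (1 + δ + 1 / 2)) fun p hp => ?_
    rw [mem_closedBall_zero_iff]
    by_contra hcon
    apply hp
    have h2 : χ (F p) = 0 := by
      apply χ.zero_of_le_dist
      rw [dist_zero_right]
      show 1 + δ ≤ _
      linarith [hFn p, not_le.1 hcon]
    simp [T, h2]
  have hb (p) : ‖T p‖ ≤ 1 := by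
    by_cases h : ‖F p‖ ≤ 1 + δ
    · have h1 := χ.nonneg (x := F p)
      have h2 := χ.le_one (x := F p)
      rw [norm_smul, Real.norm_eq_abs, abs_of_nonneg (by positivity), mul_assoc,
        inv_mul_le_iff₀ (by positivity), mul_one]
      exact (mul_le_of_le_one_left (norm_nonneg _) h2).trans h
    · have h2 : χ (F p) = 0 := by
        apply χ.zero_of_le_dist
        rw [dist_zero_right]
        exact (not_le.1 h).le
      simp [T, h2]
  refine le_trans (ENNReal.ofReal_le_ofReal (le_of_eq ?_)) (le_iSup_of_le T (le_iSup_of_le hT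
    (le_iSup_of_le hc (le_iSup_of_le hb le_rfl))))
  rw [← integral_const_mul]
  refine setIntegral_congr_fun (isOpen_unitLens n).measurableSet fun p hp => ?_
  have hev : T =ᶠ[𝓝 p] (1 + δ)⁻¹ • F := by
    filter_upwards [(isOpen_unitLens n).mem_nhds hp] with q hq
    have : χ (F q) = 1 := by
      apply χ.one_of_mem_closedBall
      rw [mem_closedBall_zero_iff]
      exact (norm_lensField_lt hδ hq).le
    simp [T, this]
  have hd := divergence_lensField hn hδ p
  show (1 + δ)⁻¹ * _ = _
  rw [← hd, divergence, divergence, hev.fderiv_eq, fderiv_const_smul (hF.differentiable (by simp) p)]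
  simp [F]

theorem volume_real_ball_euclidean {m : ℕ} (hm : m ≠ 0) {R : ℝ} (hR : 0 ≤ R) :
    volume.real (Metric.ball (0 : EuclideanSpace ℝ (Fin m)) R) = unitBallVolume m * R ^ m := by
  have hnt : Nontrivial (EuclideanSpace ℝ (Fin m)) := by
    have : NeZero m := ⟨hm⟩
    infer_instance
  rw [Measure.real, Measure.addHaar_ball _ _ hR, ENNReal.toReal_mul,
    ENNReal.toReal_ofReal (by positivity), unitBallVolume]
  simp [mul_comm]

theorem setIntegral_snd_prod {X : Type*} [NormedAddCommGroup X] [InnerProductSpace ℝ X]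
    [FiniteDimensional ℝ X] [MeasurableSpace X] [BorelSpace X] (φ : ℝ → ℝ) (B : Set X)
    (I : Set ℝ) :
    ∫ p in {p : WithLp 2 (X × ℝ) | p.fst ∈ B ∧ p.snd ∈ I}, φ p.snd =
      volume.real B * ∫ t in I, φ t := by
  have h := (WithLp.volume_preserving_ofLp X ℝ).setIntegral_preimage_emb
    (MeasurableEquiv.toLp 2 (X × ℝ)).symm.measurableEmbedding (fun q => φ q.2) (B ×ˢ I)
  have h2 := setIntegral_prod_mul (μ := (volume : Measure X)) (ν := (volume : Measure ℝ))
    (fun _ => (1 : ℝ)) φ B I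
  simp only [one_mul, setIntegral_const, smul_eq_mul, mul_one] at h2
  rw [← h2]
  exact h

/-- As `δ → 0` the derivative of the smoothed sign concentrates, with total mass `2`, on the central
disc; its integral over a cylinder of height `2τ` inside the lens bounds the one over the lens. -/
theorem le_integral_deriv_smoothSign {n : ℕ} (hn : 2 ≤ n) {δ τ : ℝ} (hδ : 0 < δ) (hτ : 0 < τ)
    (hτ2 : τ < 1 / 2) :
    n * volume.real (unitLens n) +
        unitBallVolume (n - 1) * Real.sqrt (1 - (τ + 1 / 2) ^ 2) ^ (n - 1) * smoothSign δ τ ≤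
      ∫ p in unitLens n, (n + deriv (smoothSign δ) p.snd / 2) := by
  have hcd : Continuous (deriv (smoothSign δ)) := (contDiff_smoothSign hδ).continuous_deriv_one
  have hcont : Continuous fun p : HyperplaneSplit n => deriv (smoothSign δ) p.snd :=
    hcd.comp (contDiff_snd n).continuous
  have hint : IntegrableOn (fun p : HyperplaneSplit n => deriv (smoothSign δ) p.snd)
      (unitLens n) :=
    (hcont.locallyIntegrable.integrableOn_isCompact (isCompact_closedBall 0 1)).mono_set
      ((unitLens_subset_ball n).trans Metric.ball_subset_closedBall)
  have hconst : Integrable (fun _ : HyperplaneSplit n => (n : ℝ))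
      (volume.restrict (unitLens n)) := integrableOn_const (volume_unitLens_ne_top n)
  rw [integral_add hconst (hint.div_const 2), setIntegral_const, smul_eq_mul, mul_comm (n : ℝ)]
  gcongr
  rw [integral_div, le_div_iff₀ two_pos]
  set R := Real.sqrt (1 - (τ + 1 / 2) ^ 2) with hR
  have hR2 : R ^ 2 = 1 - (τ + 1 / 2) ^ 2 := Real.sq_sqrt (by nlinarith)
  have hsub : {p : HyperplaneSplit n | p.fst ∈ Metric.ball 0 R ∧ p.snd ∈ Ioo (-τ) τ} ⊆
      unitLens n := by
    rintro p ⟨h1, h2⟩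
    rw [mem_ball_zero_iff] at h1
    have h3 : |p.snd| < τ := abs_lt.2 h2
    show ‖p.fst‖ ^ 2 + (|p.snd| + 1 / 2) ^ 2 < 1
    have h4 : ‖p.fst‖ ^ 2 < R ^ 2 := by gcongr
    have h5 : (|p.snd| + 1 / 2) ^ 2 ≤ (τ + 1 / 2) ^ 2 := by gcongr
    linarith
  have hmono := setIntegral_mono_set hint
    (Eventually.of_forall fun p => deriv_smoothSign_nonneg hδ _) hsub.eventuallyLE
  refine le_trans (le_of_eq ?_) hmono
  rw [setIntegral_snd_prod (deriv (smoothSign δ)) (Metric.ball 0 R) (Ioo (-τ) τ)]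
  have hball := volume_real_ball_euclidean (m := n - 1) (by omega) (Real.sqrt_nonneg _ : 0 ≤ R)
  have hI : ∫ t in Ioo (-τ) τ, deriv (smoothSign δ) t = 2 * smoothSign δ τ := by
    rw [← integral_Ioc_eq_integral_Ioo, ← intervalIntegral.integral_of_le (by linarith),
      intervalIntegral.integral_deriv_eq_sub
        (fun x _ => (contDiff_smoothSign hδ).differentiable (by simp) x)
        (hcd.intervalIntegrable _ _)]
    simp only [smoothSign, neg_sq, neg_div]
    ring
  rw [hball, hI]
  ring

/-- The lens energy before normalization: by the divergence theorem for the position vector,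
perimeter minus area of the central disc equals `n` times the volume. Only this inequality is
needed. -/
theorem le_perimeter_unitLens {n : ℕ} (hn : 2 ≤ n) :
    n * volume.real (unitLens n) + unitBallVolume (n - 1) * (Real.sqrt 3 / 2) ^ (n - 1) ≤
      (perimeter (unitLens n)).toReal := by
  have hP := perimeter_unitLens_ne_top (n := n) (by omega)
  -- The parameters are coupled by `δ = τ²`, so that both `τ` and `δ / τ` tend to zero.
  let f : ℝ → ℝ := fun τ => (1 + τ ^ 2)⁻¹ * (n * volume.real (unitLens n) +
    unitBallVolume (n - 1) * Real.sqrt (1 - (τ + 1 / 2) ^ 2) ^ (n - 1) * (Real.sqrt (1 + τ ^ 2))⁻¹)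
  have hf : ContinuousAt f 0 := by
    have h1 : (1 + (0 : ℝ) ^ 2) ≠ 0 := by norm_num
    have h2 : Real.sqrt (1 + (0 : ℝ) ^ 2) ≠ 0 := by positivity
    fun_prop (disch := assumption)
  have hf0 : f 0 = n * volume.real (unitLens n) +
      unitBallVolume (n - 1) * (Real.sqrt 3 / 2) ^ (n - 1) := by
    have h3 : Real.sqrt (1 - (0 + 1 / 2) ^ 2) = Real.sqrt 3 / 2 := by
      rw [show (1 - (0 + 1 / 2) ^ 2 : ℝ) = 3 / 2 ^ 2 by norm_num, Real.sqrt_div (by norm_num),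
        Real.sqrt_sq (by norm_num)]
    simp only [f, h3]
    norm_num
  rw [← hf0]
  refine le_of_tendsto (hf.tendsto.mono_left (nhdsWithin_le_nhds (s := Ioi 0))) ?_
  filter_upwards [Ioo_mem_nhdsGT (show (0 : ℝ) < 1 / 2 by norm_num)] with τ hτ
  have hτ0 := hτ.1
  have h1 := le_integral_deriv_smoothSign hn (pow_pos hτ0 2) hτ0 hτ.2
  have h2 : smoothSign (τ ^ 2) τ = (Real.sqrt (1 + τ ^ 2))⁻¹ := by
    rw [smoothSign, show τ ^ 2 + (τ ^ 2) ^ 2 = τ ^ 2 * (1 + τ ^ 2) by ring,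
      Real.sqrt_mul (by positivity), Real.sqrt_sq hτ0.le]
    field_simp
  rw [h2] at h1
  have h3 := le_perimeter_unitLens_aux (n := n) (by omega) (pow_pos hτ0 2)
  rw [ENNReal.ofReal_le_iff_le_toReal hP] at h3
  refine le_trans ?_ h3
  exact mul_le_mul_of_nonneg_left h1 (by positivity)

theorem lensScale_pow_mul {n : ℕ} (hn : 1 ≤ n) :
    lensScale n ^ n * volume.real (unitLens n) = 1 := by
  have hpos := volume_unitLens_pos n
  have hn0 : (n : ℝ) ≠ 0 := by positivity
  rw [lensScale, ← Real.rpow_natCast, ← Real.rpow_mul ENNReal.toReal_nonneg, div_mul_cancel₀ _ hn0,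
    Real.rpow_neg_one]
  exact inv_mul_cancel₀ hpos.ne'

/-- `Λ_plane(n) ≥ n |L|^{1/n}`. -/
theorem le_planeEnergy {n : ℕ} (hn : 2 ≤ n) : n / lensScale n ≤ planeEnergy n := by
  have hs := lensScale_pos n
  have h := le_perimeter_unitLens hn
  have h1 := lensScale_pow_mul (n := n) (by omega)
  have h2 : (perimeter (lensChamber n)).toReal =
      lensScale n ^ (n - 1) * (perimeter (unitLens n)).toReal := by
    rw [lensChamber, perimeter_smul (by rw [finrank_hyperplaneSplit (by omega)]; omega) hs,
      finrank_hyperplaneSplit (by omega), ENNReal.toReal_mul, ENNReal.toReal_ofReal (by positivity)]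
  have h3 : (n : ℝ) / lensScale n = lensScale n ^ (n - 1) * (n * volume.real (unitLens n)) := by
    rw [div_eq_iff hs.ne']
    have : lensScale n ^ n = lensScale n ^ (n - 1) * lensScale n := by
      rw [← pow_succ, Nat.sub_add_cancel (by omega)]
    rw [this] at h1
    linear_combination (-(n : ℝ)) * h1
  rw [planeEnergy, h2, lensRadius, h3, mul_pow]
  have h4 : 0 < lensScale n ^ (n - 1) := by positivity
  nlinarith [mul_le_mul_of_nonneg_left h h4.le]

/-- The function `-(1 - z²)^{(m+2)/2} (A - B z)` has a derivative below `(1 - z²)^{m/2}`, with equality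
at `z = 1/2`, where the integral concentrates for large `m`. -/
theorem le_integral_sqrt_pow (m : ℕ) :
    (Real.sqrt 3 / 2) ^ (m + 2) * (2 * (m + 4) / ((m + 2) * (m + 7))) ≤
      ∫ z in (1 / 2 : ℝ)..1, Real.sqrt (1 - z ^ 2) ^ m := by
  set B : ℝ := 4 / (m + 7) with hB
  set A : ℝ := (m + 3) * B / (m + 2) with hA
  have hB0 : 0 < B := by positivity
  have hcont : Continuous fun z : ℝ => Real.sqrt (1 - z ^ 2) ^ m := by fun_prop
  have h := intervalIntegral.sub_le_integral_of_hasDeriv_right_of_le (a := (1 / 2 : ℝ)) (b := 1)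
    (g := fun z => -(Real.sqrt (1 - z ^ 2) ^ (m + 2) * (A - B * z)))
    (g' := fun z => Real.sqrt (1 - z ^ 2) ^ m * ((m + 2) * z * (A - B * z) + (1 - z ^ 2) * B))
    (φ := fun z => Real.sqrt (1 - z ^ 2) ^ m) (by norm_num) (by fun_prop) ?_
    (hcont.integrableOn_Icc) ?_
  · refine le_trans (le_of_eq ?_) h
    have h1 : Real.sqrt (1 - (1 / 2 : ℝ) ^ 2) = Real.sqrt 3 / 2 := by
      rw [show (1 - (1 / 2 : ℝ) ^ 2 : ℝ) = 3 / 2 ^ 2 by norm_num, Real.sqrt_div (by norm_num),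
        Real.sqrt_sq (by norm_num)]
    have h2 : Real.sqrt (1 - (1 : ℝ) ^ 2) = 0 := by norm_num
    simp only [h1, h2]
    rw [zero_pow (by omega), zero_mul, neg_zero, zero_sub, neg_neg, hA, hB]
    congr 1
    field_simp
    ring
  · intro z hz
    have hz1 : 0 < 1 - z ^ 2 := by nlinarith [hz.1, hz.2]
    have hs : 0 < Real.sqrt (1 - z ^ 2) := Real.sqrt_pos.2 hz1
    have hd1 : HasDerivAt (fun z : ℝ => 1 - z ^ 2) (-(2 * z)) z := by
      simpa using (hasDerivAt_pow 2 z).const_sub 1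
    have hd2 := ((hd1.sqrt hz1.ne').pow (m + 2)).mul
      (((hasDerivAt_id z).const_mul B).const_sub A)
    refine HasDerivAt.hasDerivWithinAt ?_
    convert! hd2.neg using 1
    have hsq := Real.sq_sqrt hz1.le
    push_cast
    simp only [Pi.pow_apply, id]
    rw [pow_add _ m 2, hsq, pow_succ]
    field_simp
    ring
  · intro z hz
    refine mul_le_of_le_one_right (by positivity) ?_
    have h1 : (m + 2) * A = (m + 3) * B := by rw [hA]; field_simp
    have h2 : (m + 2) * z * (A - B * z) + (1 - z ^ 2) * B =
        B * ((m + 3) * (z * (1 - z)) + 1) := by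
      linear_combination z * h1
    have h3 : z * (1 - z) ≤ 1 / 4 := by nlinarith [sq_nonneg (z - 1 / 2)]
    have h4 : ((m : ℝ) + 3) * (z * (1 - z)) ≤ (m + 3) * (1 / 4) := by gcongr
    rw [h2, hB, div_mul_eq_mul_div, div_le_one (by positivity)]
    linarith

theorem integral_le_volume_unitLens {n : ℕ} (hn : 2 ≤ n) :
    unitBallVolume (n - 1) * (2 * ∫ z in (1 / 2 : ℝ)..1, Real.sqrt (1 - z ^ 2) ^ (n - 1)) ≤
      volume.real (unitLens n) := by
  let φ : ℝ → ℝ := fun t => unitBallVolume (n - 1) * Real.sqrt (1 - (|t| + 1 / 2) ^ 2) ^ (n - 1)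
  have hω : 0 ≤ unitBallVolume (n - 1) := ENNReal.toReal_nonneg
  have hφ : Continuous φ := by fun_prop
  have hφ0 (t) : 0 ≤ φ t := by positivity
  have hint : ∫ t in (-(1 / 2) : ℝ)..(1 / 2), φ t =
      unitBallVolume (n - 1) * (2 * ∫ z in (1 / 2 : ℝ)..1, Real.sqrt (1 - z ^ 2) ^ (n - 1)) := by
    rw [← intervalIntegral.integral_add_adjacent_intervals (b := -0) (hφ.intervalIntegrable _ _)
      (hφ.intervalIntegrable _ _)]
    have h1 : ∫ t in (-(1 / 2) : ℝ)..(-0), φ t = ∫ t in (0 : ℝ)..(1 / 2), φ t := by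
      rw [← intervalIntegral.integral_comp_neg]
      simp only [φ, abs_neg]
    have h2 : ∫ t in (0 : ℝ)..(1 / 2), φ t =
        unitBallVolume (n - 1) * ∫ z in (1 / 2 : ℝ)..1, Real.sqrt (1 - z ^ 2) ^ (n - 1) := by
      rw [← intervalIntegral.integral_const_mul]
      have h3 := intervalIntegral.integral_comp_add_right (a := 0) (b := 1 / 2)
        (fun z => unitBallVolume (n - 1) * Real.sqrt (1 - z ^ 2) ^ (n - 1)) (1 / 2)
      rw [zero_add, add_halves] at h3
      rw [← h3]
      refine intervalIntegral.integral_congr fun t ht => ?_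
      rw [uIcc_of_le (by norm_num)] at ht
      simp only [φ, abs_of_nonneg ht.1]
    rw [h1, neg_zero, h2]
    ring
  rw [← hint, intervalIntegral.integral_of_le (by norm_num), Measure.real,
    ← ENNReal.ofReal_le_iff_le_toReal (volume_unitLens_ne_top n),
    ofReal_integral_eq_lintegral_ofReal (hφ.integrableOn_Ioc) (Eventually.of_forall hφ0)]
  let S : Set (EuclideanSpace ℝ (Fin (n - 1)) × ℝ) :=
    {q | ‖q.1‖ ^ 2 + (|q.2| + 1 / 2) ^ 2 < 1}
  have hS : MeasurableSet S := (isOpen_lt (by fun_prop) continuous_const).measurableSet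
  have hvol : volume (unitLens n) = volume S :=
    (WithLp.volume_preserving_ofLp (EuclideanSpace ℝ (Fin (n - 1))) ℝ).measure_preimage
      hS.nullMeasurableSet
  rw [hvol, Measure.volume_eq_prod, Measure.prod_apply_symm hS]
  refine le_trans (lintegral_mono fun t => ?_) (setLIntegral_le_lintegral (Ioc (-(1 / 2)) (1 / 2)) _)
  have hball : Metric.ball (0 : EuclideanSpace ℝ (Fin (n - 1))) (Real.sqrt (1 - (|t| + 1 / 2) ^ 2)) ⊆
      (fun x => (x, t)) ⁻¹' S := by
    intro x hx
    rw [mem_ball_zero_iff, Real.lt_sqrt (norm_nonneg _)] at hx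
    show ‖x‖ ^ 2 + (|t| + 1 / 2) ^ 2 < 1
    linarith
  refine le_trans (le_of_eq ?_) (measure_mono hball)
  rw [← ENNReal.ofReal_toReal (Metric.isBounded_ball.measure_lt_top (μ := volume)).ne]
  exact congrArg _ (volume_real_ball_euclidean (by omega) (Real.sqrt_nonneg _)).symm

theorem le_volume_unitLens {n : ℕ} (hn : 2 ≤ n) :
    4 * unitBallVolume (n - 1) * (Real.sqrt 3 / 2) ^ (n + 1) * ((n + 3) / ((n + 1) * (n + 6))) ≤
      volume.real (unitLens n) := by
  refine le_trans ?_ (integral_le_volume_unitLens hn)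
  have h := le_integral_sqrt_pow (n - 1)
  have hω : 0 ≤ unitBallVolume (n - 1) := ENNReal.toReal_nonneg
  rw [show n - 1 + 2 = n + 1 by omega, Nat.cast_sub (by omega), Nat.cast_one] at h
  refine le_trans (le_of_eq ?_) (mul_le_mul_of_nonneg_left (mul_le_mul_of_nonneg_left h
    zero_le_two) hω)
  rw [show (n : ℝ) - 1 + 4 = n + 3 by ring, show (n : ℝ) - 1 + 2 = n + 1 by ring,
    show (n : ℝ) - 1 + 7 = n + 6 by ring]
  ring

end LensLawson

namespace LensLawson

open Filter Topology

/-! ### Polar coordinates in both factors -/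

/-- The measure `u^k du` on the positive half-line. -/
noncomputable def radialMeasure (k : ℕ) : Measure ℝ :=
  (volume.restrict (Ioi 0)).withDensity fun u => ENNReal.ofReal (u ^ k)

instance (k : ℕ) : SFinite (radialMeasure k) := by
  unfold radialMeasure
  infer_instance

/-- The area of the unit sphere of `ℝ^(k+1)`. -/
noncomputable def sphereArea (k : ℕ) : ℝ := (k + 1) * unitBallVolume (k + 1)

theorem unitBallVolume_pos (m : ℕ) : 0 < unitBallVolume m :=
  ENNReal.toReal_pos (Metric.measure_ball_pos _ _ one_pos).ne' Metric.isBounded_ball.measure_lt_top.ne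

theorem sphereArea_pos (k : ℕ) : 0 < sphereArea k :=
  mul_pos (by positivity) (unitBallVolume_pos _)

theorem map_norm_volume (k : ℕ) :
    Measure.map (fun x : EuclideanSpace ℝ (Fin (k + 1)) => ‖x‖) volume =
      ENNReal.ofReal (sphereArea k) • radialMeasure k := by
  let E := EuclideanSpace ℝ (Fin (k + 1))
  ext A hA
  rw [Measure.map_apply measurable_norm hA]
  have hdim : Module.finrank ℝ E = k + 1 := by simp [E]
  have h1 : volume ((fun x : E => ‖x‖) ⁻¹' A) =
      (volume.comap ((↑) : ({0}ᶜ : Set E) → E)) {x | ‖(x : E)‖ ∈ A} := by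
    rw [comap_subtype_coe_apply (measurableSet_singleton _).compl]
    have : ((↑) : ({0}ᶜ : Set E) → E) '' {x | ‖(x : E)‖ ∈ A} =
        ((fun x : E => ‖x‖) ⁻¹' A) \ {0} := by
      ext x
      simp [and_comm]
    rw [this, measure_sdiff_null (measure_singleton _)]
  have h2 : {x : ({0}ᶜ : Set E) | ‖(x : E)‖ ∈ A} =
      (homeomorphUnitSphereProd E) ⁻¹' (univ ×ˢ ((↑) ⁻¹' A)) := by
    ext x
    simp
  rw [h1, h2, (volume : Measure E).measurePreserving_homeomorphUnitSphereProd.measure_preimage_emb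
    (Homeomorph.measurableEmbedding _), Measure.prod_prod, Measure.toSphere_apply_univ, hdim]
  simp only [Nat.add_sub_cancel, Measure.smul_apply, smul_eq_mul]
  congr 1
  · rw [sphereArea, ENNReal.ofReal_mul (by positivity), unitBallVolume, ENNReal.ofReal_toReal
      Metric.isBounded_ball.measure_lt_top.ne]
    congr 1
    rw [← Nat.cast_succ, ENNReal.ofReal_natCast]
  · rw [Measure.volumeIoiPow, withDensity_apply _ (measurable_subtype_coe hA),
      setLIntegral_subtype measurableSet_Ioi _ fun a : ℝ => ENNReal.ofReal (a ^ k),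
      radialMeasure, withDensity_apply _ hA, Measure.restrict_restrict hA]
    simp [inter_comm]

/-- The product of the areas of the unit spheres of `ℝ^(k+1)` and `ℝ^(l+1)`. -/
noncomputable def orbitArea (k l : ℕ) : ℝ := sphereArea k * sphereArea l

theorem orbitArea_pos (k l : ℕ) : 0 < orbitArea k l := mul_pos (sphereArea_pos k) (sphereArea_pos l)

theorem volume_norm_preimage (k l : ℕ) {S : Set (ℝ × ℝ)} (hS : MeasurableSet S) :
    volume {p : LawsonSplit k l | (‖p.fst‖, ‖p.snd‖) ∈ S} =
      ENNReal.ofReal (orbitArea k l) * ((radialMeasure k).prod (radialMeasure l)) S := by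
  let X := EuclideanSpace ℝ (Fin (k + 1))
  let Y := EuclideanSpace ℝ (Fin (l + 1))
  have hm : Measurable (Prod.map (fun x : X => ‖x‖) (fun y : Y => ‖y‖)) :=
    measurable_norm.prodMap measurable_norm
  have h1 : volume {p : LawsonSplit k l | (‖p.fst‖, ‖p.snd‖) ∈ S} =
      (volume : Measure (X × Y)) (Prod.map (fun x : X => ‖x‖) (fun y : Y => ‖y‖) ⁻¹' S) :=
    (WithLp.volume_preserving_ofLp X Y).measure_preimage (hm hS).nullMeasurableSet
  rw [h1, ← Measure.map_apply hm hS, Measure.volume_eq_prod,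
    ← Measure.map_prod_map _ _ measurable_norm measurable_norm, map_norm_volume, map_norm_volume,
    Measure.prod_smul_left, Measure.prod_smul_right, smul_smul, Measure.smul_apply, smul_eq_mul,
    ← ENNReal.ofReal_mul (sphereArea_pos k).le, orbitArea]

theorem radialMeasure_prod_swap (k l : ℕ) {S : Set (ℝ × ℝ)} (hS : MeasurableSet S) :
    ((radialMeasure k).prod (radialMeasure l)) S =
      ((radialMeasure l).prod (radialMeasure k)) (Prod.swap ⁻¹' S) := by
  rw [← Measure.map_apply measurable_swap hS, Measure.prod_swap]

theorem radialMeasure_Ioo {l : ℕ} {a b : ℝ} (ha : 0 ≤ a) (hab : a ≤ b) :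
    radialMeasure l (Ioo a b) = ENNReal.ofReal ((b ^ (l + 1) - a ^ (l + 1)) / (l + 1)) := by
  rw [radialMeasure, withDensity_apply _ measurableSet_Ioo, Measure.restrict_restrict
    measurableSet_Ioo, inter_eq_self_of_subset_left (show Ioo a b ⊆ Ioi 0 from fun x hx => ha.trans_lt hx.1),
    Measure.restrict_congr_set Ioo_ae_eq_Ioc,
    ← ofReal_integral_eq_lintegral_ofReal (intervalIntegral.intervalIntegrable_pow l).1,
    ← intervalIntegral.integral_of_le hab, integral_pow]
  filter_upwards [ae_restrict_mem measurableSet_Ioc] with y hy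
  exact pow_nonneg (ha.trans hy.1.le) _

instance (l : ℕ) : NullSingletonClass (radialMeasure l) := by
  unfold radialMeasure
  infer_instance

theorem radialMeasure_Ico {l : ℕ} {a b : ℝ} (ha : 0 ≤ a) (hab : a ≤ b) :
    radialMeasure l (Ico a b) = ENNReal.ofReal ((b ^ (l + 1) - a ^ (l + 1)) / (l + 1)) := by
  rw [← radialMeasure_Ioo ha hab]
  exact measure_congr Ioo_ae_eq_Ico.symm

theorem radialMeasure_Ioo_le {l : ℕ} {a b : ℝ} (hb : 0 ≤ b) :
    radialMeasure l (Ioo a b) ≤ ENNReal.ofReal (b ^ l * (b - a)) := by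
  rw [radialMeasure, withDensity_apply _ measurableSet_Ioo, Measure.restrict_restrict
    measurableSet_Ioo]
  calc ∫⁻ u in Ioo a b ∩ Ioi 0, ENNReal.ofReal (u ^ l)
      ≤ ∫⁻ u in Ioo a b ∩ Ioi 0, ENNReal.ofReal (b ^ l) := by
        refine setLIntegral_mono measurable_const fun u hu => ?_
        have : 0 ≤ u := le_of_lt hu.2
        exact ENNReal.ofReal_le_ofReal (pow_le_pow_left₀ this hu.1.2.le l)
    _ ≤ ENNReal.ofReal (b ^ l) * volume (Ioo a b) := by
        rw [setLIntegral_const]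
        gcongr
        exact inter_subset_left
    _ = _ := by rw [Real.volume_Ioo, ENNReal.ofReal_mul (by positivity)]

theorem radialMeasure_prod_apply (k l : ℕ) {S : Set (ℝ × ℝ)} (hS : MeasurableSet S) :
    ((radialMeasure k).prod (radialMeasure l)) S =
      ∫⁻ u in Ioi 0, ENNReal.ofReal (u ^ k) * radialMeasure l (Prod.mk u ⁻¹' S) := by
  rw [Measure.prod_apply hS, radialMeasure, lintegral_withDensity_eq_lintegral_mul _ (by fun_prop)
    (measurable_measure_prodMk_left hS)]
  rfl

end LensLawson

namespace LensLawson

open Filter Topology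

/-! ### One arc of the competitor -/

/-- The graph `v = √(r² - u²) - h` of the arc with centre `(0, -h)` and radius `r`. -/
noncomputable def arcHeight (h r u : ℝ) : ℝ := Real.sqrt (r ^ 2 - u ^ 2) - h

/-- The weighted length `∫ u^k v^l ds` of the arc over `[0, a]`. -/
noncomputable def arcArea (k l : ℕ) (a h r : ℝ) : ℝ :=
  ∫ u in (0 : ℝ)..a, u ^ k * arcHeight h r u ^ l * (r / Real.sqrt (r ^ 2 - u ^ 2))

/-- The weighted area `∬ u^k v^l` of the region between the arc over `[0, a]` and the segment
from the origin to `(a, b)`. -/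
noncomputable def arcVolume (k l : ℕ) (a b h r : ℝ) : ℝ :=
  ∫ u in (0 : ℝ)..a, u ^ k * ((arcHeight h r u ^ (l + 1) - (b / a * u) ^ (l + 1)) / (l + 1))

/-- The data of an arc of centre `(0, -h)` and radius `r` that ends at `(a, b)`. -/
structure IsArc (a b h r : ℝ) : Prop where
  a_pos : 0 < a
  b_pos : 0 < b
  h_pos : 0 < h
  r_pos : 0 < r
  r_sq : r ^ 2 = a ^ 2 + (b + h) ^ 2

section Arc

variable {a b h r : ℝ}

theorem IsArc.lt_r (H : IsArc a b h r) : a < r := by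
  have := H.a_pos; have := H.b_pos; have := H.h_pos; have := H.r_pos
  have := H.r_sq
  nlinarith [mul_pos H.b_pos H.b_pos, mul_pos H.h_pos H.h_pos, mul_pos H.b_pos H.h_pos]

theorem IsArc.arcHeight_a (H : IsArc a b h r) : arcHeight h r a = b := by
  have := H.b_pos; have := H.h_pos
  rw [arcHeight, H.r_sq, add_sub_cancel_left, Real.sqrt_sq (by positivity), add_sub_cancel_right]

theorem arcHeight_anti (h r : ℝ) {u u' : ℝ} (hu : 0 ≤ u) (huu : u ≤ u') :
    arcHeight h r u' ≤ arcHeight h r u := by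
  unfold arcHeight
  gcongr

theorem IsArc.le_arcHeight (H : IsArc a b h r) {u : ℝ} (h0 : 0 ≤ u) (h1 : u ≤ a) :
    b / a * u ≤ arcHeight h r u := by
  have := H.a_pos; have := H.b_pos
  refine le_trans ?_ (H.arcHeight_a.symm.le.trans (arcHeight_anti h r h0 h1))
  rw [div_mul_eq_mul_div, div_le_iff₀ H.a_pos]
  gcongr

/-- The region between the segment from the origin to `(a, b)` and the arc. -/
def arcRegion (a b h r : ℝ) : Set (ℝ × ℝ) :=
  {q | 0 ≤ q.1 ∧ b * q.1 ≤ a * q.2 ∧ q.1 ^ 2 + (q.2 + h) ^ 2 < r ^ 2}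

theorem measurableSet_arcRegion (a b h r : ℝ) : MeasurableSet (arcRegion a b h r) :=
  (measurableSet_le measurable_const measurable_fst).inter
    ((measurableSet_le (f := fun q : ℝ × ℝ => b * q.1) (g := fun q => a * q.2)
      (by fun_prop) (by fun_prop)).inter
      (measurableSet_lt (f := fun q : ℝ × ℝ => q.1 ^ 2 + (q.2 + h) ^ 2)
        (by fun_prop) measurable_const))

theorem continuous_arcHeight (h r : ℝ) : Continuous (arcHeight h r) := by
  unfold arcHeight
  fun_prop

theorem IsArc.radialMeasure_arcRegion (H : IsArc a b h r) (k l : ℕ) :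
    ((radialMeasure k).prod (radialMeasure l)) (arcRegion a b h r) =
      ENNReal.ofReal (arcVolume k l a b h r) := by
  have ha := H.a_pos; have hb := H.b_pos; have hh := H.h_pos
  rw [radialMeasure_prod_apply k l (measurableSet_arcRegion a b h r)]
  have hsec (u : ℝ) (hu : 0 < u) : Prod.mk u ⁻¹' arcRegion a b h r =
      Ico (b / a * u) (arcHeight h r u) := by
    ext v
    have e1 : b * u ≤ a * v ↔ b / a * u ≤ v := by
      rw [div_mul_eq_mul_div, div_le_iff₀ ha, mul_comm v]
    simp only [arcRegion, mem_preimage, mem_ofPred_eq, mem_Ico, e1, hu.le, true_and, arcHeight]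
    refine and_congr_right fun hv => ?_
    have hv0 : 0 < v := lt_of_lt_of_le (by positivity) hv
    rw [lt_sub_iff_add_lt, Real.lt_sqrt (by positivity), lt_sub_iff_add_lt, add_comm]
  have h1 : ∫⁻ u in Ioi 0, ENNReal.ofReal (u ^ k) *
        radialMeasure l (Prod.mk u ⁻¹' arcRegion a b h r) =
      ∫⁻ u in Ioi 0, (Ioc 0 a).indicator (fun u => ENNReal.ofReal
        (u ^ k * ((arcHeight h r u ^ (l + 1) - (b / a * u) ^ (l + 1)) / (l + 1)))) u := by
    refine setLIntegral_congr_fun measurableSet_Ioi fun u hu => ?_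
    have hu : 0 < u := hu
    rw [hsec u hu]
    by_cases hua : u ≤ a
    · rw [indicator_of_mem (show u ∈ Ioc 0 a from ⟨hu, hua⟩),
        radialMeasure_Ico (by positivity) (H.le_arcHeight hu.le hua),
        ENNReal.ofReal_mul (by positivity)]
    · rw [indicator_of_notMem (fun h => hua h.2), Ico_eq_empty, measure_empty, mul_zero]
      rw [not_lt]
      have h2 := arcHeight_anti h r ha.le (not_le.1 hua).le
      rw [H.arcHeight_a] at h2
      refine h2.trans ?_
      rw [div_mul_eq_mul_div, le_div_iff₀ ha]
      exact mul_le_mul_of_nonneg_left (not_le.1 hua).le hb.le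
  rw [h1, lintegral_indicator measurableSet_Ioc, Measure.restrict_restrict measurableSet_Ioc,
    inter_eq_self_of_subset_left (show Ioc 0 a ⊆ Ioi 0 from fun x hx => hx.1),
    arcVolume, intervalIntegral.integral_of_le ha.le, ofReal_integral_eq_lintegral_ofReal]
  · have := continuous_arcHeight h r
    exact (Continuous.integrableOn_Ioc (by fun_prop))
  · filter_upwards [ae_restrict_mem measurableSet_Ioc] with u hu
    have hu0 := hu.1
    have := pow_le_pow_left₀ (show 0 ≤ b / a * u by positivity) (H.le_arcHeight hu.1.le hu.2) (l + 1)
    have : 0 ≤ arcHeight h r u ^ (l + 1) - (b / a * u) ^ (l + 1) := sub_nonneg.2 this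
    show 0 ≤ u ^ k * _
    positivity

/-- The inner layer of width `ε` along the arc, extended by `C ε` past the end point. -/
def arcLayer (a h r C ε : ℝ) : Set (ℝ × ℝ) :=
  {q | q.1 ≤ a + C * ε ∧ 0 < q.2 ∧ q.1 ^ 2 + (q.2 + h) ^ 2 < r ^ 2 ∧
    (r - ε) ^ 2 < q.1 ^ 2 + (q.2 + h) ^ 2}

theorem measurableSet_arcLayer (a h r C ε : ℝ) : MeasurableSet (arcLayer a h r C ε) :=
  (measurableSet_le measurable_fst measurable_const).inter
    ((measurableSet_lt measurable_const measurable_snd).inter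
      ((measurableSet_lt (f := fun q : ℝ × ℝ => q.1 ^ 2 + (q.2 + h) ^ 2)
        (by fun_prop) measurable_const).inter
        (measurableSet_lt (g := fun q : ℝ × ℝ => q.1 ^ 2 + (q.2 + h) ^ 2)
          measurable_const (by fun_prop))))

theorem IsArc.continuousOn_arcIntegrand (h r : ℝ) (k l : ℕ) :
    ContinuousOn (fun u => u ^ k * arcHeight h r u ^ l * (r / Real.sqrt (r ^ 2 - u ^ 2)))
      (Ioo (-r) r) := by
  have := continuous_arcHeight h r
  refine ContinuousOn.mul (by fun_prop) (ContinuousOn.div continuousOn_const (by fun_prop) ?_)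
  intro u hu
  have : 0 < r ^ 2 - u ^ 2 := by nlinarith [hu.1, hu.2]
  positivity

/-- For `a' < r - ε`, the layer over `[0, a']` has weighted area at most `ε` times a weighted length
that tends to the one of the arc. -/
theorem IsArc.radialMeasure_arcLayer_le (H : IsArc a b h r) (k l : ℕ) {C ε a' : ℝ}
    (hε : 0 < ε) (hC : 0 ≤ C) (ha' : a + C * ε ≤ a') (har : a' < r - ε)
    (hpos : 0 ≤ arcHeight h r a') :
    ((radialMeasure k).prod (radialMeasure l)) (arcLayer a h r C ε) ≤
      ENNReal.ofReal (ε * (Real.sqrt (r ^ 2 - a' ^ 2) / Real.sqrt ((r - ε) ^ 2 - a' ^ 2) *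
        arcArea k l (a + C * ε) h r)) := by
  have ha := H.a_pos; have hb := H.b_pos; have hh := H.h_pos; have hr := H.r_pos
  have haC : 0 < a + C * ε := by positivity
  set R := Real.sqrt (r ^ 2 - a' ^ 2) / Real.sqrt ((r - ε) ^ 2 - a' ^ 2) with hR
  have hR0 : 0 ≤ R := by positivity
  rw [radialMeasure_prod_apply k l (measurableSet_arcLayer a h r C ε)]
  have h1 : ∫⁻ u in Ioi 0, ENNReal.ofReal (u ^ k) *
        radialMeasure l (Prod.mk u ⁻¹' arcLayer a h r C ε) ≤
      ∫⁻ u in Ioi 0, (Ioc 0 (a + C * ε)).indicator (fun u => ENNReal.ofReal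
        (ε * R * (u ^ k * arcHeight h r u ^ l * (r / Real.sqrt (r ^ 2 - u ^ 2))))) u := by
    refine setLIntegral_mono' measurableSet_Ioi fun u hu => ?_
    have hu : 0 < u := hu
    by_cases hua : u ≤ a + C * ε
    · rw [indicator_of_mem (show u ∈ Ioc 0 (a + C * ε) from ⟨hu, hua⟩)]
      have hua' : u ≤ a' := hua.trans ha'
      have hs1 : 0 < (r - ε) ^ 2 - a' ^ 2 := by nlinarith
      have hs2 : (r - ε) ^ 2 - a' ^ 2 ≤ (r - ε) ^ 2 - u ^ 2 := by gcongr
      have hs3 : (r - ε) ^ 2 - u ^ 2 ≤ r ^ 2 - u ^ 2 := by nlinarith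
      set s := Real.sqrt (r ^ 2 - u ^ 2) with hs
      set t := Real.sqrt ((r - ε) ^ 2 - u ^ 2) with ht
      have hs0 : 0 < s := Real.sqrt_pos.2 (by linarith)
      have ht0 : 0 < t := Real.sqrt_pos.2 (by linarith)
      have hss : s ^ 2 = r ^ 2 - u ^ 2 := Real.sq_sqrt (by linarith)
      have htt : t ^ 2 = (r - ε) ^ 2 - u ^ 2 := Real.sq_sqrt (by linarith)
      have hts : t ≤ s := Real.sqrt_le_sqrt hs3
      have hsub : Prod.mk u ⁻¹' arcLayer a h r C ε ⊆ Ioo (t - h) (s - h) := by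
        rintro v ⟨-, hv0, hv1, hv2⟩
        simp only at hv0 hv1 hv2
        have hvh : 0 ≤ v + h := by positivity
        constructor
        · rw [sub_lt_iff_lt_add, ht, Real.sqrt_lt' (by positivity)]
          linarith
        · rw [lt_sub_iff_add_lt, hs, Real.lt_sqrt hvh]
          linarith
      have hpos' : 0 ≤ s - h := hpos.trans (arcHeight_anti h r hu.le hua')
      have hm := (measure_mono hsub).trans
        (radialMeasure_Ioo_le (l := l) (a := t - h) hpos')
      refine (mul_le_mul_right hm _).trans ?_
      rw [← ENNReal.ofReal_mul (by positivity)]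
      apply ENNReal.ofReal_le_ofReal
      -- `s - t ≤ ε r / t` and `s / t` increases with `u`
      have hd : s - t ≤ ε * (r / t) := by
        rw [mul_div_assoc', le_div_iff₀ ht0]
        nlinarith
      have hq : s / t ≤ R := by
        rw [hR, div_le_div_iff₀ ht0 (Real.sqrt_pos.2 hs1), hs, ht,
          ← Real.sqrt_mul (by linarith), ← Real.sqrt_mul (by nlinarith)]
        apply Real.sqrt_le_sqrt
        have h3 : u ^ 2 ≤ a' ^ 2 := by gcongr
        have h4 : (r - ε) ^ 2 ≤ r ^ 2 := by nlinarith
        nlinarith [mul_le_mul_of_nonneg_left h3 (sub_nonneg.2 h4)]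
      have hd' : s - t ≤ ε * (R * (r / s)) := by
        refine hd.trans ?_
        have : r / t = s / t * (r / s) := by field_simp
        rw [this]
        gcongr
      have hsh : arcHeight h r u = s - h := rfl
      rw [hsh]
      calc u ^ k * ((s - h) ^ l * (s - h - (t - h)))
          = u ^ k * (s - h) ^ l * (s - t) := by ring
        _ ≤ u ^ k * (s - h) ^ l * (ε * (R * (r / s))) := by gcongr
        _ = _ := by ring
    · have : Prod.mk u ⁻¹' arcLayer a h r C ε = ∅ := by
        ext v
        simp only [mem_empty_iff_false, iff_false]
        exact fun hv => hua hv.1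
      simp [this]
  refine h1.trans (le_of_eq ?_)
  rw [lintegral_indicator measurableSet_Ioc, Measure.restrict_restrict measurableSet_Ioc,
    inter_eq_self_of_subset_left (show Ioc 0 (a + C * ε) ⊆ Ioi 0 from fun x hx => hx.1),
    arcArea, ← mul_assoc, ← intervalIntegral.integral_const_mul,
    intervalIntegral.integral_of_le haC.le, ofReal_integral_eq_lintegral_ofReal]
  · refine Integrable.const_mul ?_ _
    refine ((IsArc.continuousOn_arcIntegrand h r k l).mono ?_).integrableOn_Icc.mono_set
      Ioc_subset_Icc_self
    exact fun u hu => ⟨by linarith [hu.1], by linarith [hu.2]⟩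
  · filter_upwards [ae_restrict_mem measurableSet_Ioc] with u hu
    have hu0 := hu.1
    have : 0 ≤ arcHeight h r u := hpos.trans (arcHeight_anti h r hu0.le (hu.2.trans ha'))
    show 0 ≤ ε * R * _
    positivity

theorem IsArc.eventually_radialMeasure_arcLayer_le (H : IsArc a b h r) (k l : ℕ) {C η : ℝ}
    (hC : 0 ≤ C) (hη : 0 < η) :
    ∀ᶠ ε in 𝓝[>] (0 : ℝ), ((radialMeasure k).prod (radialMeasure l)) (arcLayer a h r C ε) ≤
      ENNReal.ofReal (ε * (arcArea k l a h r + η)) := by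
  have ha := H.a_pos; have hr := H.r_pos; have har := H.lt_r
  obtain ⟨a', ha1, ha2⟩ : ∃ a', (a < a' ∧ a' < r) ∧ 0 ≤ arcHeight h r a' := by
    have h1 : ∀ᶠ x in 𝓝[>] a, 0 < arcHeight h r x := by
      refine ((continuous_arcHeight h r).continuousAt.eventually ?_).filter_mono nhdsWithin_le_nhds
      rw [H.arcHeight_a]
      exact lt_mem_nhds H.b_pos
    obtain ⟨x, hx1, hx2⟩ := (h1.and (Ioo_mem_nhdsGT har)).exists
    exact ⟨x, hx2, hx1.le⟩
  have hlim : Tendsto (fun ε => Real.sqrt (r ^ 2 - a' ^ 2) / Real.sqrt ((r - ε) ^ 2 - a' ^ 2) *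
        arcArea k l (a + C * ε) h r) (𝓝 0) (𝓝 (arcArea k l a h r)) := by
    have hs : 0 < Real.sqrt (r ^ 2 - a' ^ 2) := Real.sqrt_pos.2 (by nlinarith)
    have h1 : Tendsto (fun ε => Real.sqrt (r ^ 2 - a' ^ 2) / Real.sqrt ((r - ε) ^ 2 - a' ^ 2))
        (𝓝 0) (𝓝 1) := by
      have : ContinuousAt (fun ε : ℝ =>
          Real.sqrt (r ^ 2 - a' ^ 2) / Real.sqrt ((r - ε) ^ 2 - a' ^ 2)) 0 := by
        have h0 : Real.sqrt ((r - 0) ^ 2 - a' ^ 2) ≠ 0 := by rw [sub_zero]; exact hs.ne'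
        fun_prop (disch := assumption)
      have h2 := this.tendsto
      rwa [sub_zero, div_self hs.ne'] at h2
    have h2 : ContinuousAt (fun x => arcArea k l x h r) a := by
      have hI : ContinuousOn (fun x => arcArea k l x h r) (Icc 0 a') := by
        have hint : IntegrableOn (fun u => u ^ k * arcHeight h r u ^ l *
            (r / Real.sqrt (r ^ 2 - u ^ 2))) (Icc 0 a') :=
          ((IsArc.continuousOn_arcIntegrand h r k l).mono
            fun u hu => ⟨by linarith [hu.1], by linarith [hu.2]⟩).integrableOn_Icc
        have h0a : (0 : ℝ) ≤ a' := by linarith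
        have h4 := intervalIntegral.continuousOn_primitive_interval
          (show IntegrableOn _ (uIcc 0 a') by rwa [uIcc_of_le h0a])
        rwa [uIcc_of_le h0a] at h4
      exact hI.continuousAt (Icc_mem_nhds ha ha1.1)
    have h3 : Tendsto (fun ε => arcArea k l (a + C * ε) h r) (𝓝 0) (𝓝 (arcArea k l a h r)) := by
      refine h2.tendsto.comp ?_
      have : Continuous fun ε : ℝ => a + C * ε := by fun_prop
      simpa using this.tendsto 0
    simpa using h1.mul h3
  have e1 : ∀ᶠ ε in 𝓝 (0 : ℝ), a + C * ε < a' := by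
    have : Continuous fun ε : ℝ => a + C * ε := by fun_prop
    exact this.continuousAt.eventually (gt_mem_nhds (by simpa using ha1.1))
  have e2 : ∀ᶠ ε in 𝓝 (0 : ℝ), a' < r - ε := by
    have : Continuous fun ε : ℝ => r - ε := by fun_prop
    exact this.continuousAt.eventually (lt_mem_nhds (by simpa using ha1.2))
  have e3 := hlim.eventually (gt_mem_nhds (show arcArea k l a h r < arcArea k l a h r + η by linarith))
  filter_upwards [nhdsWithin_le_nhds e1, nhdsWithin_le_nhds e2, nhdsWithin_le_nhds e3,
    self_mem_nhdsWithin] with ε h1 h2 h3 h4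
  have h4 : 0 < ε := h4
  refine (H.radialMeasure_arcLayer_le k l h4 hC h1.le h2 ha2).trans ?_
  apply ENNReal.ofReal_le_ofReal
  gcongr

end Arc

end LensLawson

namespace LensLawson

open Filter Topology

/-! ### The two arcs of the Lawson set -/

/-- The two contact conditions are compatible when the slope lies strictly between `1/√3` and `√3`:
then both arcs have centres outside the quadrant. -/
structure IsWideSlope (lam : ℝ) : Prop where
  pos : 0 < lam
  one_lt : 1 < Real.sqrt 3 * lam
  lt_sqrt : lam < Real.sqrt 3

theorem isWideSlope_slope {k l : ℕ} (hl : l < 3 * k) (hk : k < 3 * l) :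
    IsWideSlope (slope k l) := by
  have hk0 : (0 : ℝ) < k := by norm_cast; omega
  have hl0 : (0 : ℝ) < l := by norm_cast; omega
  have hk' : (k : ℝ) < 3 * l := by exact_mod_cast hk
  have hl' : (l : ℝ) < 3 * k := by exact_mod_cast hl
  refine ⟨Real.sqrt_pos.2 (by positivity), ?_, ?_⟩
  · rw [slope, ← Real.sqrt_mul (by norm_num), Real.lt_sqrt (by norm_num), mul_div_assoc',
      lt_div_iff₀ hl0]
    linarith
  · rw [slope]
    apply Real.sqrt_lt_sqrt (by positivity)
    rwa [div_lt_iff₀ hl0]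

section Trigonometry

variable {k l : ℕ}

theorem cos_two_pi_div_three_sub (x : ℝ) :
    Real.cos (2 * Real.pi / 3 - Real.arctan x) =
      (Real.sqrt 3 * x - 1) / (2 * Real.sqrt (1 + x ^ 2)) := by
  have h : (0 : ℝ) < 1 + x ^ 2 := by positivity
  have e : 2 * Real.pi / 3 - Real.arctan x = Real.pi - (Real.pi / 3 + Real.arctan x) := by ring
  have hs : Real.sqrt (1 + x ^ 2) ≠ 0 := by positivity
  rw [e, Real.cos_pi_sub, Real.cos_add, Real.cos_pi_div_three, Real.sin_pi_div_three,
    Real.cos_arctan, Real.sin_arctan]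
  field_simp
  ring

theorem sin_two_pi_div_three_sub (x : ℝ) :
    Real.sin (2 * Real.pi / 3 - Real.arctan x) =
      (Real.sqrt 3 + x) / (2 * Real.sqrt (1 + x ^ 2)) := by
  have h : (0 : ℝ) < 1 + x ^ 2 := by positivity
  have e : 2 * Real.pi / 3 - Real.arctan x = Real.pi - (Real.pi / 3 + Real.arctan x) := by ring
  have hs : Real.sqrt (1 + x ^ 2) ≠ 0 := by positivity
  rw [e, Real.sin_pi_sub, Real.sin_add, Real.cos_pi_div_three, Real.sin_pi_div_three,
    Real.cos_arctan, Real.sin_arctan]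
  field_simp

theorem cos_pi_div_six_add (x : ℝ) :
    Real.cos (Real.pi / 6 + Real.arctan x) =
      (Real.sqrt 3 - x) / (2 * Real.sqrt (1 + x ^ 2)) := by
  have hs : Real.sqrt (1 + x ^ 2) ≠ 0 := by positivity
  rw [Real.cos_add, Real.cos_pi_div_six, Real.sin_pi_div_six, Real.cos_arctan, Real.sin_arctan]
  field_simp

theorem sin_pi_div_six_add (x : ℝ) :
    Real.sin (Real.pi / 6 + Real.arctan x) =
      (1 + Real.sqrt 3 * x) / (2 * Real.sqrt (1 + x ^ 2)) := by
  have hs : Real.sqrt (1 + x ^ 2) ≠ 0 := by positivity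
  rw [Real.sin_add, Real.cos_pi_div_six, Real.sin_pi_div_six, Real.cos_arctan, Real.sin_arctan]
  field_simp

theorem arcH_eq (H : IsWideSlope (slope k l)) :
    arcH k l = (1 + slope k l ^ 2) / (Real.sqrt 3 * slope k l - 1) := by
  have h1 : Real.sqrt 3 * slope k l - 1 ≠ 0 := (sub_pos.2 H.one_lt).ne'
  have hs : Real.sqrt (1 + slope k l ^ 2) ≠ 0 := by positivity
  have h1' : slope k l * Real.sqrt 3 - 1 ≠ 0 := by rwa [mul_comm]
  rw [arcH, coneAngle, Real.tan_eq_sin_div_cos, cos_two_pi_div_three_sub, sin_two_pi_div_three_sub]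
  field_simp
  ring

theorem arcR_eq (H : IsWideSlope (slope k l)) :
    arcR k l = 2 * slope k l * Real.sqrt (1 + slope k l ^ 2) / (Real.sqrt 3 * slope k l - 1) := by
  have h1 : Real.sqrt 3 * slope k l - 1 ≠ 0 := (sub_pos.2 H.one_lt).ne'
  have hs : Real.sqrt (1 + slope k l ^ 2) ≠ 0 := by positivity
  rw [arcR, coneAngle, cos_two_pi_div_three_sub]
  field_simp

theorem arcD_eq (H : IsWideSlope (slope k l)) :
    arcD k l = (1 + slope k l ^ 2) / (Real.sqrt 3 - slope k l) := by
  have h1 : Real.sqrt 3 - slope k l ≠ 0 := (sub_pos.2 H.lt_sqrt).ne'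
  have hs : Real.sqrt (1 + slope k l ^ 2) ≠ 0 := by positivity
  rw [arcD, coneAngle, Real.tan_eq_sin_div_cos, cos_pi_div_six_add, sin_pi_div_six_add]
  field_simp
  ring

theorem arcRho_eq (H : IsWideSlope (slope k l)) :
    arcRho k l = 2 * Real.sqrt (1 + slope k l ^ 2) / (Real.sqrt 3 - slope k l) := by
  have h1 : Real.sqrt 3 - slope k l ≠ 0 := (sub_pos.2 H.lt_sqrt).ne'
  have hs : Real.sqrt (1 + slope k l ^ 2) ≠ 0 := by positivity
  rw [arcRho, coneAngle, cos_pi_div_six_add]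
  field_simp

theorem isArc_fst (H : IsWideSlope (slope k l)) : IsArc (slope k l) 1 (arcH k l) (arcR k l) := by
  have h0 := H.pos
  have h1 : 0 < Real.sqrt 3 * slope k l - 1 := sub_pos.2 H.one_lt
  have h3 : Real.sqrt 3 ^ 2 = 3 := Real.sq_sqrt (by norm_num)
  have hs : Real.sqrt (1 + slope k l ^ 2) ^ 2 = 1 + slope k l ^ 2 := Real.sq_sqrt (by positivity)
  refine ⟨h0, one_pos, ?_, ?_, ?_⟩
  · rw [arcH_eq H]; positivity
  · rw [arcR_eq H]; positivity
  · rw [arcH_eq H, arcR_eq H, div_pow, mul_pow, hs]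
    have := h1.ne'
    have : slope k l * Real.sqrt 3 - 1 ≠ 0 := by rwa [mul_comm]
    field_simp
    ring_nf
    rw [h3]
    ring

theorem isArc_snd (H : IsWideSlope (slope k l)) : IsArc 1 (slope k l) (arcD k l) (arcRho k l) := by
  have h0 := H.pos
  have h1 : 0 < Real.sqrt 3 - slope k l := sub_pos.2 H.lt_sqrt
  have h3 : Real.sqrt 3 ^ 2 = 3 := Real.sq_sqrt (by norm_num)
  have hs : Real.sqrt (1 + slope k l ^ 2) ^ 2 = 1 + slope k l ^ 2 := Real.sq_sqrt (by positivity)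
  refine ⟨one_pos, h0, ?_, ?_, ?_⟩
  · rw [arcD_eq H]; positivity
  · rw [arcRho_eq H]; positivity
  · rw [arcD_eq H, arcRho_eq H, div_pow, mul_pow, hs]
    have := h1.ne'
    field_simp
    ring_nf
    rw [h3]
    ring

end Trigonometry

/-! ### Volume and perimeter of the Lawson set -/

/-- In the closed quadrant the set enclosed by two arcs with a common end point `(a, b)` is the
intersection of the two discs. -/
theorem mem_arcs_iff {a b h r d ρ u v : ℝ} (H₁ : IsArc a b h r) (H₂ : IsArc b a d ρ)
    (hu : 0 ≤ u) (hv : 0 ≤ v) :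
    ((b * u ≤ a * v → u ^ 2 + (v + h) ^ 2 < r ^ 2) ∧
      (a * v ≤ b * u → (u + d) ^ 2 + v ^ 2 < ρ ^ 2)) ↔
    u ^ 2 + (v + h) ^ 2 < r ^ 2 ∧ (u + d) ^ 2 + v ^ 2 < ρ ^ 2 := by
  have ha := H₁.a_pos; have hb := H₁.b_pos; have hh := H₁.h_pos; have hd := H₂.h_pos
  rw [H₁.r_sq, H₂.r_sq]
  constructor
  · rintro ⟨h1, h2⟩
    rcases le_total (b * u) (a * v) with hle | hle
    · refine ⟨h1 hle, ?_⟩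
      have h1 := h1 hle
      rcases le_total b v with hbv | hbv
      · have : u < a := by
          by_contra! hc
          nlinarith [mul_le_mul hc hc ha.le hu, mul_le_mul hbv hbv hb.le hv,
            mul_le_mul_of_nonneg_left hbv hh.le]
        nlinarith [mul_le_mul_of_nonneg_left hbv hh.le, mul_lt_mul_of_pos_left this hd]
      · rcases hbv.lt_or_eq with hbv | rfl
        · have : u < a := by
            by_contra! hc
            nlinarith [mul_lt_mul_of_pos_left hbv ha, mul_le_mul_of_nonneg_left hc hb.le]
          nlinarith
        · have : u < a := by nlinarith
          nlinarith
    · refine ⟨?_, h2 hle⟩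
      have h2 := h2 hle
      rcases le_total a u with hau | hau
      · have : v < b := by
          by_contra! hc
          nlinarith [mul_le_mul hc hc hb.le hv, mul_le_mul hau hau ha.le hu,
            mul_le_mul_of_nonneg_left hau hd.le]
        nlinarith [mul_le_mul_of_nonneg_left hau hd.le, mul_lt_mul_of_pos_left this hh]
      · rcases hau.lt_or_eq with hau | rfl
        · have : v < b := by
            by_contra! hc
            nlinarith [mul_lt_mul_of_pos_left hau hb, mul_le_mul_of_nonneg_left hc ha.le]
          nlinarith
        · have : v < b := by nlinarith
          nlinarith
  · exact fun h => ⟨fun _ => h.1, fun _ => h.2⟩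

variable {k l : ℕ}

theorem mem_slice_iff (H : IsWideSlope (slope k l)) {u v : ℝ} :
    (u, v) ∈ slice k l ↔ 0 ≤ u ∧ 0 ≤ v ∧ u ^ 2 + (v + arcH k l) ^ 2 < arcR k l ^ 2 ∧
      (u + arcD k l) ^ 2 + v ^ 2 < arcRho k l ^ 2 := by
  have h := fun hu hv => mem_arcs_iff (u := u) (v := v) (isArc_fst H) (isArc_snd H) hu hv
  simp only [one_mul] at h
  simp only [slice, mem_ofPred_eq]
  exact and_congr_right fun hu => and_congr_right fun hv => h hu hv

theorem radialMeasure_prod_line (k l : ℕ) (a b : ℝ) (ha : a ≠ 0) :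
    ((radialMeasure k).prod (radialMeasure l)) {q | b * q.1 = a * q.2} = 0 := by
  have hm : MeasurableSet {q : ℝ × ℝ | b * q.1 = a * q.2} :=
    measurableSet_eq_fun (by fun_prop) (by fun_prop)
  rw [Measure.measure_prod_null hm]
  refine Eventually.of_forall fun u => ?_
  have : Prod.mk u ⁻¹' {q : ℝ × ℝ | b * q.1 = a * q.2} ⊆ {b * u / a} := by
    intro v hv
    have hv : b * u = a * v := hv
    rw [mem_singleton_iff, hv]
    field_simp
  exact measure_mono_null this (measure_singleton _)

theorem radialMeasure_prod_axes (k l : ℕ) :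
    ((radialMeasure k).prod (radialMeasure l)) {q | q.1 ≤ 0 ∨ q.2 ≤ 0} = 0 := by
  have h0 (m : ℕ) : radialMeasure m (Iic 0) = 0 := by
    rw [radialMeasure, withDensity_apply _ measurableSet_Iic, Measure.restrict_restrict
      measurableSet_Iic, Iic_inter_Ioi, Ioc_self, Measure.restrict_empty, lintegral_zero_measure]
  have : {q : ℝ × ℝ | q.1 ≤ 0 ∨ q.2 ≤ 0} = (Iic 0 ×ˢ univ) ∪ (univ ×ˢ Iic 0) := by
    ext q; simp
  rw [this]
  exact measure_union_null (by rw [Measure.prod_prod, h0, zero_mul])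
    (by rw [Measure.prod_prod, h0, mul_zero])

theorem slice_eq (H : IsWideSlope (slope k l)) :
    slice k l = arcRegion (slope k l) 1 (arcH k l) (arcR k l) ∪
      Prod.swap ⁻¹' arcRegion 1 (slope k l) (arcD k l) (arcRho k l) := by
  have hp := H.pos
  have key := fun u v hu hv => mem_arcs_iff (u := u) (v := v) (isArc_fst H) (isArc_snd H) hu hv
  simp only [one_mul] at key
  ext ⟨u, v⟩
  simp only [slice, arcRegion, mem_ofPred_eq, mem_union, mem_preimage, Prod.swap_prod_mk, one_mul]
  constructor
  · rintro ⟨hu, hv, h1, h2⟩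
    rcases le_total u (slope k l * v) with h | h
    · exact Or.inl ⟨hu, h, h1 h⟩
    · exact Or.inr ⟨hv, h, by rw [add_comm]; exact h2 h⟩
  · rintro (⟨hu, h, h1⟩ | ⟨hv, h, h1⟩)
    · have hv : 0 ≤ v := by
        by_contra! hv
        nlinarith
      refine ⟨hu, hv, fun _ => h1, fun h' => ?_⟩
      have e : u = slope k l * v := le_antisymm h h'
      have hr := (isArc_fst H).r_sq
      have hρ := (isArc_snd H).r_sq
      have hh := (isArc_fst H).h_pos
      have hd := (isArc_snd H).h_pos
      have : v < 1 := by
        by_contra! hc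
        rw [hr, e] at h1
        nlinarith [mul_le_mul_of_nonneg_left (one_le_pow₀ hc (n := 2)) (sq_nonneg (slope k l)),
          mul_le_mul_of_nonneg_left hc hh.le]
      have hvv : v ^ 2 < 1 := by nlinarith
      rw [hρ, e]
      nlinarith [mul_lt_mul_of_pos_left hvv (pow_pos hp 2),
        mul_lt_mul_of_pos_left this (mul_pos hd hp)]
    · have hu : 0 ≤ u := le_trans (by positivity) h
      refine ⟨hu, hv, fun h' => ?_, fun _ => by rw [add_comm] at h1; exact h1⟩
      have e : u = slope k l * v := le_antisymm h' h
      have hr := (isArc_fst H).r_sq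
      have hρ := (isArc_snd H).r_sq
      have hh := (isArc_fst H).h_pos
      have hd := (isArc_snd H).h_pos
      have : v < 1 := by
        by_contra! hc
        rw [hρ, e] at h1
        nlinarith [mul_le_mul_of_nonneg_left (one_le_pow₀ hc (n := 2)) (sq_nonneg (slope k l)),
          mul_le_mul_of_nonneg_left hc (mul_pos hd hp).le]
      have hvv : v ^ 2 < 1 := by nlinarith
      rw [hr, e]
      nlinarith [mul_lt_mul_of_pos_left hvv (pow_pos hp 2),
        mul_lt_mul_of_pos_left this hh]

theorem measurableSet_slice (H : IsWideSlope (slope k l)) : MeasurableSet (slice k l) := by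
  rw [slice_eq H]
  exact (measurableSet_arcRegion _ _ _ _).union (measurable_swap (measurableSet_arcRegion _ _ _ _))

theorem IsArc.arcVolume_nonneg {a b h r : ℝ} (H : IsArc a b h r) (k l : ℕ) :
    0 ≤ arcVolume k l a b h r := by
  refine intervalIntegral.integral_nonneg H.a_pos.le fun u hu => ?_
  have ha := H.a_pos; have hb := H.b_pos; have h0 := hu.1
  have := pow_le_pow_left₀ (show 0 ≤ b / a * u by positivity) (H.le_arcHeight hu.1 hu.2) (l + 1)
  have : 0 ≤ arcHeight h r u ^ (l + 1) - (b / a * u) ^ (l + 1) := sub_nonneg.2 this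
  positivity

theorem IsArc.arcArea_nonneg {a b h r : ℝ} (H : IsArc a b h r) (k l : ℕ) :
    0 ≤ arcArea k l a h r := by
  refine intervalIntegral.integral_nonneg H.a_pos.le fun u hu => ?_
  have ha := H.a_pos; have hb := H.b_pos; have h0 := hu.1; have hr := H.r_pos
  have : 0 ≤ arcHeight h r u := le_trans (by positivity) (H.le_arcHeight hu.1 hu.2)
  positivity

/-- The sum of the weighted areas of the two halves of the slice. -/
noncomputable def sliceVolume (k l : ℕ) : ℝ :=
  arcVolume k l (slope k l) 1 (arcH k l) (arcR k l) +
    arcVolume l k 1 (slope k l) (arcD k l) (arcRho k l)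

/-- The sum of the weighted lengths of the two arcs. -/
noncomputable def sliceArea (k l : ℕ) : ℝ :=
  arcArea k l (slope k l) (arcH k l) (arcR k l) + arcArea l k 1 (arcD k l) (arcRho k l)

theorem volume_lawsonSet (H : IsWideSlope (slope k l)) :
    volume (lawsonSet k l) = ENNReal.ofReal (orbitArea k l * sliceVolume k l) := by
  have h1 := isArc_fst H
  have h2 := isArc_snd H
  have hm := measurableSet_arcRegion 1 (slope k l) (arcD k l) (arcRho k l)
  rw [lawsonSet, volume_norm_preimage k l (measurableSet_slice H), slice_eq H,
    measure_union₀ (measurable_swap hm).nullMeasurableSet, h1.radialMeasure_arcRegion,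
    radialMeasure_prod_swap k l (measurable_swap hm), ← preimage_comp, Prod.swap_swap_eq,
    preimage_id, h2.radialMeasure_arcRegion,
    ← ENNReal.ofReal_add (h1.arcVolume_nonneg _ _) (h2.arcVolume_nonneg _ _),
    ← ENNReal.ofReal_mul (orbitArea_pos k l).le, sliceVolume]
  refine measure_mono_null ?_ (radialMeasure_prod_line k l (slope k l) 1 H.pos.ne')
  rintro ⟨u, v⟩ ⟨⟨-, hq, -⟩, ⟨-, hq', -⟩⟩
  simp only [Prod.swap_prod_mk, one_mul] at hq hq'
  simp only [mem_ofPred_eq, one_mul]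
  exact le_antisymm hq hq'

theorem lawsonSet_eq (H : IsWideSlope (slope k l)) :
    lawsonSet k l = {p | max (quadrantDist 0 (arcH k l) p - arcR k l)
      (quadrantDist (arcD k l) 0 p - arcRho k l) < 0} := by
  ext p
  simp only [lawsonSet, mem_ofPred_eq, mem_slice_iff H, norm_nonneg, true_and, max_lt_iff, sub_neg,
    quadrantDist, add_zero]
  rw [Real.sqrt_lt' (isArc_fst H).r_pos, Real.sqrt_lt' (isArc_snd H).r_pos]

/-- The layer of width `ε` along the boundary of the slice is covered by one layer along each arc.
Where the two arcs meet, these layers extend past the end point by a multiple of `ε`. -/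
theorem perimeter_lawsonSet_le (H : IsWideSlope (slope k l)) :
    perimeter (lawsonSet k l) ≤ ENNReal.ofReal (orbitArea k l * sliceArea k l) := by
  have h1 := isArc_fst H
  have h2 := isArc_snd H
  have hc := orbitArea_pos k l
  have hp := H.pos
  have hh := h1.h_pos; have hd := h2.h_pos; have hr := h1.r_pos; have hρ := h2.r_pos
  have hA : 0 ≤ sliceArea k l := add_nonneg (h1.arcArea_nonneg _ _) (h2.arcArea_nonneg _ _)
  have hL (a b c : ℝ) : LipschitzWith 1 fun p : LawsonSplit k l => quadrantDist a b p - c :=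
    LipschitzWith.of_dist_le_mul fun p q => by
      simpa [Real.dist_eq] using (lipschitzWith_quadrantDist a b).dist_le_mul p q
  have hL' := (hL 0 (arcH k l) (arcR k l)).max (hL (arcD k l) 0 (arcRho k l))
  rw [max_self] at hL'
  rw [lawsonSet_eq H]
  refine perimeter_sublevel_le hL' (by positivity) fun η hη => ?_
  have hη' : 0 < η / (2 * orbitArea k l) := by positivity
  filter_upwards [h1.eventually_radialMeasure_arcLayer_le k l (C := arcR k l / arcD k l)
      (by positivity) hη', h2.eventually_radialMeasure_arcLayer_le l k
      (C := arcRho k l / arcH k l) (by positivity) hη', self_mem_nhdsWithin,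
      nhdsWithin_le_nhds (gt_mem_nhds hr), nhdsWithin_le_nhds (gt_mem_nhds hρ)]
    with ε he1 he2 hε hεr hερ
  have hε : 0 < ε := hε
  set L1 := arcLayer (slope k l) (arcH k l) (arcR k l) (arcR k l / arcD k l) ε with hL1
  set L2 := arcLayer 1 (arcD k l) (arcRho k l) (arcRho k l / arcH k l) ε with hL2
  have hmL1 : MeasurableSet L1 := measurableSet_arcLayer _ _ _ _ _
  have hmL2 : MeasurableSet L2 := measurableSet_arcLayer _ _ _ _ _
  set S : Set (ℝ × ℝ) := (L1 ∪ Prod.swap ⁻¹' L2) ∪ {q | q.1 ≤ 0 ∨ q.2 ≤ 0} with hS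
  have hmax : MeasurableSet {q : ℝ × ℝ | q.1 ≤ 0 ∨ q.2 ≤ 0} :=
    (measurableSet_le measurable_fst measurable_const).union
      (measurableSet_le measurable_snd measurable_const)
  have hmS : MeasurableSet S := (hmL1.union (measurable_swap hmL2)).union hmax
  have hsub : {p : LawsonSplit k l | -ε < max (quadrantDist 0 (arcH k l) p - arcR k l)
      (quadrantDist (arcD k l) 0 p - arcRho k l) ∧ max (quadrantDist 0 (arcH k l) p - arcR k l)
      (quadrantDist (arcD k l) 0 p - arcRho k l) < 0} ⊆
      {p | (‖p.fst‖, ‖p.snd‖) ∈ S} := by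
    rintro p ⟨hp1, hp2⟩
    by_contra hn
    simp only [hS, mem_union, not_or, mem_ofPred_eq, not_le] at hn
    obtain ⟨⟨hn1, hn2⟩, hu, hv⟩ := hn
    set u := ‖p.fst‖
    set v := ‖p.snd‖
    rw [max_lt_iff, sub_neg, sub_neg, quadrantDist, quadrantDist, Real.sqrt_lt' hr,
      Real.sqrt_lt' hρ, add_zero, add_zero] at hp2
    rw [lt_max_iff, neg_lt_sub_iff_lt_add', neg_lt_sub_iff_lt_add', quadrantDist, quadrantDist,
      add_zero, add_zero] at hp1
    obtain ⟨hq1, hq2⟩ := hp2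
    have er := h1.r_sq
    have eρ := h2.r_sq
    rcases hp1 with hq | hq
    · replace hq := (Real.lt_sqrt (sub_pos.2 ‹_›).le).1 (sub_lt_iff_lt_add.2 hq)
      refine hn1 ⟨?_, hv, hq1, hq⟩
      change u ≤ slope k l + arcR k l / arcD k l * ε
      rw [← sub_le_iff_le_add', div_mul_eq_mul_div, le_div_iff₀ hd]
      -- Outside the shrunken disc but inside the other one, `u ≤ λ + O(ε)`.
      rcases le_total v 1 with hv1 | hv1
      · nlinarith [mul_le_mul_of_nonneg_left hv1 hh.le]
      · have : u < slope k l := by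
          by_contra! hc
          nlinarith
        nlinarith [mul_pos hr hε]
    · replace hq := (Real.lt_sqrt (sub_pos.2 ‹_›).le).1 (sub_lt_iff_lt_add.2 hq)
      refine hn2 ⟨?_, hu, by rw [add_comm]; exact hq2, by rw [add_comm (_ ^ 2)]; exact hq⟩
      change v ≤ 1 + arcRho k l / arcH k l * ε
      rw [← sub_le_iff_le_add', div_mul_eq_mul_div, le_div_iff₀ hh]
      rcases le_total u (slope k l) with hv1 | hv1
      · nlinarith [mul_le_mul_of_nonneg_left hv1 hd.le]
      · have : v < 1 := by
          by_contra! hc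
          nlinarith
        nlinarith [mul_pos hρ hε]
  refine (measure_mono hsub).trans ?_
  rw [volume_norm_preimage k l hmS]
  have h3 : ((radialMeasure k).prod (radialMeasure l)) S ≤
      ENNReal.ofReal (ε * (sliceArea k l + η / orbitArea k l)) := by
    refine (measure_union_le _ _).trans ?_
    rw [radialMeasure_prod_axes, add_zero]
    refine (measure_union_le _ _).trans ?_
    rw [radialMeasure_prod_swap k l (measurable_swap hmL2), ← preimage_comp, Prod.swap_swap_eq,
      preimage_id]
    refine (add_le_add he1 he2).trans ?_
    have n1 := h1.arcArea_nonneg k l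
    have n2 := h2.arcArea_nonneg l k
    rw [← ENNReal.ofReal_add (by positivity) (by positivity)]
    apply ENNReal.ofReal_le_ofReal
    rw [sliceArea]
    apply le_of_eq
    field_simp
    ring
  refine (mul_le_mul_right h3 _).trans ?_
  rw [← ENNReal.ofReal_mul hc.le]
  apply ENNReal.ofReal_le_ofReal
  apply le_of_eq
  field_simp

end LensLawson

namespace LensLawson

open Filter Topology Module

/-! ### An area inequality for Hausdorff measure -/

theorem disjoint_image_of_injOn {α β : Type*} {f : α → β} {s t t' : Set α} (h : InjOn f s)
    (ht : t ⊆ s) (ht' : t' ⊆ s) (hd : Disjoint t t') : Disjoint (f '' t) (f '' t') :=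
  disjoint_image_image fun _ hx _ hy hxy =>
    disjoint_left.1 hd hx (h (ht hx) (ht' hy) hxy ▸ hy)

section AreaInequality

variable {U V : Type*} [NormedAddCommGroup U] [InnerProductSpace ℝ U] [FiniteDimensional ℝ U]
  [MeasurableSpace U] [BorelSpace U]
  [NormedAddCommGroup V] [InnerProductSpace ℝ V]
  [MeasurableSpace V] [BorelSpace V]

theorem euclideanHausdorffMeasure_image_le {X Y : Type*} [EMetricSpace X]
    [MeasurableSpace X] [BorelSpace X] [EMetricSpace Y] [MeasurableSpace Y] [BorelSpace Y]
    {K : NNReal} {g : X → Y} {s : Set X} (hg : LipschitzOnWith K g s) (d : ℕ) :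
    μHE[d] (g '' s) ≤ (K : ℝ≥0∞) ^ d * μHE[d] s := by
  have h := hg.hausdorffMeasure_image_le (d := d) (Nat.cast_nonneg d)
  rw [ENNReal.rpow_natCast] at h
  simp only [Measure.euclideanHausdorffMeasure_def, Measure.smul_apply,
    Measure.nnreal_smul_coe_apply]
  rw [mul_left_comm]
  gcongr

/-- If `f` is close to a linear map that does not decrease norms, then the inverse of `f` followed
by that linear map is Lipschitz, which bounds the measure of the image of `f` from below. -/
theorem normDet_mul_volume_le_of_approximatesLinearOn {f : U → V} {A : U →L[ℝ] V} {s : Set U}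
    {δ : NNReal} (hδ : δ < 1) (hA : ∀ v, ‖v‖ ≤ ‖A v‖) (hf : ApproximatesLinearOn f A s δ) :
    ENNReal.ofReal (A : U →ₗ[ℝ] V).normDet * volume s ≤
      ((1 - δ)⁻¹ : NNReal) ^ finrank ℝ U * μHE[finrank ℝ U] (f '' s) := by
  have hδ' : (δ : ℝ) < 1 := by exact_mod_cast hδ
  have hK : (((1 - δ)⁻¹ : NNReal) : ℝ) = (1 - (δ : ℝ))⁻¹ := by
    rw [NNReal.coe_inv, NNReal.coe_sub hδ.le, NNReal.coe_one]
  have key : ∀ x ∈ s, ∀ y ∈ s, ‖A (x - y)‖ ≤ (1 - (δ : ℝ))⁻¹ * ‖f x - f y‖ := by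
    intro x hx y hy
    have h1 := hf x hx y hy
    have h2 : ‖A (x - y)‖ ≤ ‖f x - f y‖ + ‖f x - f y - A (x - y)‖ := by
      have := norm_sub_le (f x - f y) (f x - f y - A (x - y))
      simpa using this
    have h3 := hA (x - y)
    rw [inv_mul_eq_div, le_div_iff₀ (by linarith)]
    nlinarith [mul_le_mul_of_nonneg_left h3 δ.coe_nonneg]
  have hinj : InjOn f s := by
    intro x hx y hy hxy
    have h1 := key x hx y hy
    rw [hxy, sub_self, norm_zero, mul_zero] at h1
    exact sub_eq_zero.1 (norm_le_zero_iff.1 ((hA _).trans h1))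
  have hLip : LipschitzOnWith (1 - δ)⁻¹ (fun p => A (Function.invFunOn f s p)) (f '' s) := by
    refine LipschitzOnWith.of_dist_le_mul ?_
    rintro _ ⟨x, hx, rfl⟩ _ ⟨y, hy, rfl⟩
    rw [hinj.leftInvOn_invFunOn hx, hinj.leftInvOn_invFunOn hy, dist_eq_norm, dist_eq_norm,
      ← map_sub, hK]
    exact key x hx y hy
  have himg : (fun p => A (Function.invFunOn f s p)) '' (f '' s) = A '' s := by
    rw [image_image]
    exact image_congr fun x hx => by rw [hinj.leftInvOn_invFunOn hx]
  have h4 := euclideanHausdorffMeasure_image_le hLip (finrank ℝ U)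
  rw [himg] at h4
  have h5 := (A : U →ₗ[ℝ] V).euclideanHausdorffMeasure_image_eq_normDet_mul_volume s
  rw [← h5]
  exact_mod_cast h4

variable [FiniteDimensional ℝ V]

/-- Cut `s` into countably many pieces on which `f` is nearly linear. -/
theorem const_mul_volume_le_image {f : U → V} {f' : U → U →L[ℝ] V} {s : Set U}
    (hs : MeasurableSet s) (hinj : InjOn f s) (hf : ∀ x ∈ s, HasFDerivAt f (f' x) x)
    (hf' : ∀ x ∈ s, ∀ v, ‖v‖ ≤ ‖f' x v‖) {c : ℝ≥0∞}
    (hc : ∀ x ∈ s, c ≤ ENNReal.ofReal (f' x : U →ₗ[ℝ] V).normDet) :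
    c * volume s ≤ μHE[finrank ℝ U] (f '' s) := by
  rcases s.eq_empty_or_nonempty with rfl | hne
  · simp
  have key (δ : NNReal) (h0 : 0 < δ) (h1 : δ < 1) :
      c * volume s ≤ ((1 - δ)⁻¹ : NNReal) ^ finrank ℝ U * μHE[finrank ℝ U] (f '' s) := by
    obtain ⟨t, A, hdisj, hmeas, hsub, happ, hA⟩ :=
      exists_partition_approximatesLinearOn_of_hasFDerivWithinAt f s f'
        (fun x hx => (hf x hx).hasFDerivWithinAt) (fun _ => δ) fun _ => h0.ne'
    have hsplit : s = ⋃ i, s ∩ t i := by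
      rw [← inter_iUnion, inter_eq_self_of_subset_left hsub]
    have hdisj' : Pairwise (Function.onFun Disjoint fun i => s ∩ t i) := fun i j hij =>
      (hdisj hij).mono inter_subset_right inter_subset_right
    have hfs : f '' s = ⋃ i, f '' (s ∩ t i) := by
      rw [← image_iUnion, ← hsplit]
    have hfd : Pairwise (Function.onFun Disjoint fun i => f '' (s ∩ t i)) := fun i j hij =>
      disjoint_image_of_injOn hinj inter_subset_left inter_subset_left (hdisj' hij)
    have hfm (i) : MeasurableSet (f '' (s ∩ t i)) :=
      (hs.inter (hmeas i)).image_of_continuousOn_injOn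
        (fun x hx => (hf x hx.1).continuousAt.continuousWithinAt) (hinj.mono inter_subset_left)
    have hv : volume s = ∑' i, volume (s ∩ t i) := by
      conv_lhs => rw [hsplit]
      exact measure_iUnion hdisj' fun i => hs.inter (hmeas i)
    rw [hv, hfs, measure_iUnion hfd hfm, ← ENNReal.tsum_mul_left, ← ENNReal.tsum_mul_left]
    refine ENNReal.tsum_le_tsum fun i => ?_
    obtain ⟨y, hy, hAy⟩ := hA hne i
    refine le_trans ?_ (normDet_mul_volume_le_of_approximatesLinearOn h1
      (by rw [hAy]; exact hf' y hy) (happ i))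
    gcongr
    rw [hAy]
    exact hc y hy
  have hlim : Tendsto (fun δ : NNReal => (((1 - δ)⁻¹ : NNReal) : ℝ≥0∞) ^ finrank ℝ U *
      μHE[finrank ℝ U] (f '' s)) (𝓝 0) (𝓝 (1 * μHE[finrank ℝ U] (f '' s))) := by
    refine ENNReal.Tendsto.mul_const ?_ (Or.inl one_ne_zero)
    have h1 : Tendsto (fun δ : NNReal => (1 - δ)⁻¹) (𝓝 0) (𝓝 1) := by
      have h2 : Tendsto (fun δ : NNReal => 1 - δ) (𝓝 0) (𝓝 (1 - 0)) :=
        tendsto_const_nhds.sub tendsto_id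
      rw [tsub_zero] at h2
      simpa using h2.inv₀ one_ne_zero
    have h2 := (ENNReal.tendsto_coe.2 h1)
    simpa using ENNReal.Tendsto.pow (n := finrank ℝ U) h2
  rw [one_mul] at hlim
  refine ge_of_tendsto (hlim.mono_left (nhdsWithin_le_nhds (s := Ioi 0))) ?_
  filter_upwards [self_mem_nhdsWithin, nhdsWithin_le_nhds (gt_mem_nhds one_pos)] with δ h0 h1
  exact key δ h0 h1

/-- One half of the area formula, for an injective map whose derivative does not decrease norms. -/
theorem lintegral_normDet_le {f : U → V} {f' : U → U →L[ℝ] V} {s : Set U}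
    (hs : MeasurableSet s) (hinj : InjOn f s) (hf : ∀ x ∈ s, HasFDerivAt f (f' x) x)
    (hf' : ∀ x ∈ s, ∀ v, ‖v‖ ≤ ‖f' x v‖) :
    ∫⁻ x in s, ENNReal.ofReal (f' x : U →ₗ[ℝ] V).normDet ≤ μHE[finrank ℝ U] (f '' s) := by
  rw [lintegral_def]
  refine iSup₂_le fun g hg => ?_
  rw [SimpleFunc.lintegral]
  have hsub (c : ℝ≥0∞) : s ∩ g ⁻¹' {c} ⊆ s := inter_subset_left
  have hm (c : ℝ≥0∞) : MeasurableSet (s ∩ g ⁻¹' {c}) := hs.inter (g.measurableSet_fiber c)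
  calc ∑ c ∈ g.range, c * volume.restrict s (g ⁻¹' {c})
      ≤ ∑ c ∈ g.range, μHE[finrank ℝ U] (f '' (s ∩ g ⁻¹' {c})) := by
        refine Finset.sum_le_sum fun c _ => ?_
        rw [Measure.restrict_apply (g.measurableSet_fiber c), inter_comm]
        refine const_mul_volume_le_image (hm c) (hinj.mono (hsub c)) (fun x hx => hf x hx.1)
          (fun x hx => hf' x hx.1) fun x hx => ?_
        have : g x = c := hx.2
        exact this ▸ hg x
    _ = μHE[finrank ℝ U] (⋃ c ∈ g.range, f '' (s ∩ g ⁻¹' {c})) := by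
        refine (measure_biUnion_finset (fun c _ c' _ hcc => ?_) fun c _ => ?_).symm
        · refine disjoint_image_of_injOn hinj (hsub c) (hsub c') ?_
          rw [disjoint_left]
          rintro x ⟨-, hx⟩ ⟨-, hx'⟩
          exact hcc (hx.symm.trans hx')
        · exact (hm c).image_of_continuousOn_injOn
            (fun x hx => (hf x hx.1).continuousAt.continuousWithinAt) (hinj.mono (hsub c))
    _ ≤ μHE[finrank ℝ U] (f '' s) :=
        measure_mono (iUnion₂_subset fun c _ => image_mono (hsub c))

/-- The area of a graph over `U` in the direction of a unit vector `e` orthogonal to `U`. -/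
theorem lintegral_sqrt_one_add_sq_le {ι : U →ₗᵢ[ℝ] V} {e : V} (he : ‖e‖ = 1)
    (hι : ∀ w, inner ℝ (ι w) e = 0) {φ : U → ℝ} {G : U → U} {s : Set U} (hs : MeasurableSet s)
    (hφ : ∀ x ∈ s, HasFDerivAt φ (innerSL ℝ (G x)) x) :
    ∫⁻ x in s, ENNReal.ofReal (Real.sqrt (1 + ‖G x‖ ^ 2)) ≤
      μHE[finrank ℝ U] ((fun w => ι w + φ w • e) '' s) := by
  have hnorm (w : U) (c : ℝ) : ‖ι w + c • e‖ ^ 2 = ‖w‖ ^ 2 + c ^ 2 := by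
    rw [norm_add_sq_real, inner_smul_right, hι, norm_smul, he, ι.norm_map, Real.norm_eq_abs]
    simp
  have hle (w : U) (c : ℝ) : ‖w‖ ≤ ‖ι w + c • e‖ := by
    have := hnorm w c
    nlinarith [norm_nonneg w, norm_nonneg (ι w + c • e), sq_nonneg c]
  set f' : U → U →L[ℝ] V := fun x =>
    ι.toContinuousLinearMap + (innerSL ℝ (G x)).smulRight e with hf'
  have hf'a (x w : U) : f' x w = ι w + (inner ℝ (G x) w : ℝ) • e := by
    simp [hf']
  have hdet (x : U) : (f' x : U →ₗ[ℝ] V).normDet = Real.sqrt (1 + ‖G x‖ ^ 2) := by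
    let b := stdOrthonormalBasis ℝ U
    have h1 := (f' x : U →ₗ[ℝ] V).normDet_sq_eq_det_gram b
    have h2 : Matrix.gram ℝ (fun i => (f' x : U →ₗ[ℝ] V) (b i)) =
        1 + Matrix.replicateCol Unit (fun i => inner ℝ (G x) (b i)) *
          Matrix.replicateRow Unit (fun i => inner ℝ (G x) (b i)) := by
      ext i j
      rw [Matrix.gram_apply, Matrix.add_apply, Matrix.mul_apply]
      simp only [ContinuousLinearMap.coe_coe, hf'a, inner_add_left, inner_add_right,
        inner_smul_left, inner_smul_right, hι, real_inner_comm (ι _) e, ι.inner_map_map,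
        real_inner_self_eq_norm_sq, he, Matrix.replicateCol_apply, Matrix.replicateRow_apply,
        orthonormal_iff_ite.1 b.orthonormal, Matrix.one_apply]
      simp
      ring
    rw [h2, Matrix.det_one_add_replicateCol_mul_replicateRow] at h1
    have h3 : (fun i => inner ℝ (G x) (b i)) ⬝ᵥ (fun i => inner ℝ (G x) (b i)) = ‖G x‖ ^ 2 := by
      rw [← real_inner_self_eq_norm_sq, ← b.sum_inner_mul_inner]
      simp [dotProduct, real_inner_comm]
    rw [h3] at h1
    rw [← h1]
    exact (Real.sqrt_sq (LinearMap.normDet_nonneg _)).symm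
  have hinj : InjOn (fun w => ι w + φ w • e) s := by
    intro x _ y _ hxy
    have h1 := hle (x - y) (φ x - φ y)
    have h2 : ι (x - y) + (φ x - φ y) • e = 0 := by
      have : ι x + φ x • e = ι y + φ y • e := hxy
      rw [map_sub, sub_smul, ← sub_eq_zero.2 this]
      abel
    rw [h2, norm_zero] at h1
    exact sub_eq_zero.1 (norm_le_zero_iff.1 h1)
  have h := lintegral_normDet_le (f := fun w => ι w + φ w • e) (f' := f') hs hinj
    (fun x hx => (ι.toContinuousLinearMap.hasFDerivAt).add ((hφ x hx).smul_const e))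
    (fun x _ v => by rw [hf'a]; exact hle _ _)
  simpa only [hdet] using h

end AreaInequality

end LensLawson

namespace LensLawson

open Filter Topology Module

/-! ### Hausdorff measure of the truncated cone: finiteness -/

theorem finrank_lawsonSplit (k l : ℕ) : finrank ℝ (LawsonSplit k l) = k + l + 2 := by
  rw [(WithLp.linearEquiv 2 ℝ (EuclideanSpace ℝ (Fin (k + 1)) ×
    EuclideanSpace ℝ (Fin (l + 1)))).finrank_eq]
  simp; omega

theorem mem_lawsonCone_iff {k l : ℕ} {p : LawsonSplit k l} :
    p ∈ lawsonCone k l ↔ ‖p.fst‖ = slope k l * ‖p.snd‖ := by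
  have h : slope k l ^ 2 = (k : ℝ) / l := Real.sq_sqrt (by positivity)
  have h0 : 0 ≤ slope k l := Real.sqrt_nonneg _
  rw [lawsonCone, mem_ofPred_eq, ← h, ← mul_pow, sq_eq_sq₀ (by positivity) (by positivity)]

theorem lawsonCone_inter_lawsonSet {k l : ℕ} (H : IsWideSlope (slope k l)) :
    lawsonCone k l ∩ lawsonSet k l = {p | ‖p.fst‖ = slope k l * ‖p.snd‖ ∧ ‖p.snd‖ < 1} := by
  ext p
  rw [mem_inter_iff, mem_lawsonCone_iff, lawsonSet, mem_ofPred_eq, mem_slice_iff H, mem_ofPred_eq]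
  refine and_congr_right fun h => ?_
  have hp := H.pos
  have hr := (isArc_fst H).r_sq
  have hρ := (isArc_snd H).r_sq
  have hh := (isArc_fst H).h_pos
  have hd := (isArc_snd H).h_pos
  rw [hr, hρ, h]
  have hv := norm_nonneg p.snd
  set v := ‖p.snd‖
  constructor
  · rintro ⟨-, -, h1, -⟩
    by_contra! hc
    nlinarith [mul_le_mul_of_nonneg_left (one_le_pow₀ hc (n := 2)) (sq_nonneg (slope k l)),
      mul_le_mul_of_nonneg_left hc hh.le]
  · intro hv1
    have hvv : v ^ 2 < 1 := by nlinarith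
    refine ⟨by positivity, hv, ?_, ?_⟩
    · nlinarith [mul_lt_mul_of_pos_left hvv (pow_pos hp 2), mul_lt_mul_of_pos_left hv1 hh]
    · nlinarith [mul_lt_mul_of_pos_left hvv (pow_pos hp 2),
        mul_lt_mul_of_pos_left hv1 (mul_pos hd hp)]

/-- Finitely many unit vectors such that every vector makes an angle of at most `π/3` with one
of them. -/
theorem exists_finset_le_two_mul_inner (k : ℕ) :
    ∃ T : Finset (EuclideanSpace ℝ (Fin (k + 1))), (∀ e ∈ T, ‖e‖ = 1) ∧
      ∀ x, ∃ e ∈ T, ‖x‖ ≤ 2 * inner ℝ e x := by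
  let X := EuclideanSpace ℝ (Fin (k + 1))
  obtain ⟨T, hT, hcov⟩ := (isCompact_sphere (0 : X) 1).elim_nhds_subcover
    (fun e => {z | 1 / 2 < inner ℝ e z}) (fun e he => by
      refine IsOpen.mem_nhds (isOpen_lt continuous_const (by fun_prop)) ?_
      have : ‖e‖ = 1 := by simpa using he
      change 1 / 2 < inner ℝ e e
      rw [real_inner_self_eq_norm_sq, this]
      norm_num)
  refine ⟨T, fun e he => by simpa using hT e he, fun x => ?_⟩
  have hcov' (ξ : X) (hξ : ‖ξ‖ = 1) : ∃ e ∈ T, 1 / 2 < inner ℝ e ξ := by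
    have := hcov (show ξ ∈ Metric.sphere (0 : X) 1 by simpa using hξ)
    simpa using this
  rcases eq_or_ne x 0 with rfl | hx
  · obtain ⟨e, he, -⟩ := hcov' (EuclideanSpace.single (0 : Fin (k + 1)) (1 : ℝ))
      (by rw [PiLp.norm_single, norm_one])
    exact ⟨e, he, by simp⟩
  · have hx0 : 0 < ‖x‖ := norm_pos_iff.2 hx
    obtain ⟨e, he, h⟩ := hcov' (‖x‖⁻¹ • x)
      (by rw [norm_smul, norm_inv, norm_norm, inv_mul_cancel₀ hx0.ne'])
    refine ⟨e, he, ?_⟩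
    rw [inner_smul_right, inv_mul_eq_div, lt_div_iff₀ hx0] at h
    linarith

/-- On the part of a cone where the first coordinate makes an angle of at most `π/3` with `e`,
the component along `e` is a Lipschitz function of the orthogonal component. -/
theorem abs_inner_sub_le {X Y : Type*} [NormedAddCommGroup X] [InnerProductSpace ℝ X]
    [NormedAddCommGroup Y] {lam : ℝ} (hlam : 0 < lam) {e x x' : X} {y y' : Y}
    (he : ‖e‖ = 1) (h : ‖x‖ = lam * ‖y‖) (h' : ‖x'‖ = lam * ‖y'‖) (hx : ‖x‖ ≤ 2 * inner ℝ e x)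
    (hx' : ‖x'‖ ≤ 2 * inner ℝ e x') {D : ℝ} (hy : ‖y - y'‖ ≤ D)
    (hD : ‖(x - inner ℝ e x • e) - (x' - inner ℝ e x' • e)‖ ≤ D) :
    |inner ℝ e x - inner ℝ e x'| ≤ 2 * (1 + lam) * D := by
  have hperp (z : X) : ‖z - inner ℝ e z • e‖ ^ 2 = ‖z‖ ^ 2 - inner ℝ e z ^ 2 := by
    rw [norm_sub_sq_real, inner_smul_right, norm_smul, he, real_inner_comm, Real.norm_eq_abs,
      mul_one, sq_abs]
    ring
  set t : ℝ := inner ℝ e x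
  set t' : ℝ := inner ℝ e x'
  have e1 := hperp x
  have e2 := hperp x'
  set a := x - t • e
  set a' := x' - t' • e
  have ht : 0 ≤ t := by linarith [norm_nonneg x]
  have ht' : 0 ≤ t' := by linarith [norm_nonneg x']
  have ha : ‖a‖ ≤ 2 * t := le_trans (by
    refine le_of_sq_le_sq ?_ (norm_nonneg x)
    nlinarith) hx
  have ha' : ‖a'‖ ≤ 2 * t' := le_trans (by
    refine le_of_sq_le_sq ?_ (norm_nonneg x')
    nlinarith) hx'
  have hDa : |‖a‖ - ‖a'‖| ≤ D := (abs_norm_sub_norm_le _ _).trans hD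
  have hDy : |‖y‖ - ‖y'‖| ≤ D := (abs_norm_sub_norm_le _ _).trans hy
  have hD0 : 0 ≤ D := (norm_nonneg _).trans hy
  rcases (add_nonneg ht ht').eq_or_lt with h0 | h0
  · have h1 : t = 0 := by linarith
    have h2 : t' = 0 := by linarith
    rw [h1, h2, sub_zero, abs_zero]
    positivity
  · have key : (t - t') * (t + t') =
        lam * (‖y‖ - ‖y'‖) * (‖x‖ + ‖x'‖) - (‖a‖ - ‖a'‖) * (‖a‖ + ‖a'‖) := by
      rw [h, h'] at *
      nlinarith
    have h3 : |t - t'| * (t + t') ≤ 2 * (1 + lam) * D * (t + t') := by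
      calc |t - t'| * (t + t') = |(t - t') * (t + t')| := by rw [abs_mul, abs_of_pos h0]
        _ ≤ |lam * (‖y‖ - ‖y'‖) * (‖x‖ + ‖x'‖)| + |(‖a‖ - ‖a'‖) * (‖a‖ + ‖a'‖)| := by
          rw [key]; exact abs_sub _ _
        _ = lam * |‖y‖ - ‖y'‖| * (‖x‖ + ‖x'‖) + |‖a‖ - ‖a'‖| * (‖a‖ + ‖a'‖) := by
          rw [abs_mul, abs_mul, abs_mul, abs_of_pos hlam,
            abs_of_nonneg (by positivity : 0 ≤ ‖x‖ + ‖x'‖),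
            abs_of_nonneg (by positivity : 0 ≤ ‖a‖ + ‖a'‖)]
        _ ≤ lam * D * (2 * t + 2 * t') + D * (2 * t + 2 * t') := by gcongr
        _ = _ := by ring
    exact le_of_mul_le_mul_right h3 h0

/-- The cone is covered by finitely many pieces `P e` on which the orthogonal projection along `e` is
antilipschitz. -/
theorem euclideanHausdorffMeasure_cone_lt_top (k l : ℕ) {lam : ℝ} (hlam : 0 < lam) :
    μHE[k + l + 1] {p : LawsonSplit k l | ‖p.fst‖ = lam * ‖p.snd‖ ∧ ‖p.snd‖ < 1} < ∞ := by
  obtain ⟨T, hT1, hT⟩ := exists_finset_le_two_mul_inner k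
  set P : EuclideanSpace ℝ (Fin (k + 1)) → Set (LawsonSplit k l) := fun e =>
    {p | (‖p.fst‖ = lam * ‖p.snd‖ ∧ ‖p.snd‖ < 1) ∧ ‖p.fst‖ ≤ 2 * inner ℝ e p.fst} with hP
  have hsub : {p : LawsonSplit k l | ‖p.fst‖ = lam * ‖p.snd‖ ∧ ‖p.snd‖ < 1} ⊆ ⋃ e ∈ T, P e := by
    intro p hp
    obtain ⟨e, he, h⟩ := hT p.fst
    exact mem_iUnion₂.2 ⟨e, he, hp, h⟩
  refine (measure_mono hsub).trans_lt (measure_biUnion_lt_top T.finite_toSet fun e he => ?_)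
  have he1 := hT1 e he
  set E : LawsonSplit k l := WithLp.toLp 2 (e, 0) with hE
  have hE1 : ‖E‖ = 1 := by
    have h : ‖E‖ ^ 2 = ‖e‖ ^ 2 + ‖(0 : EuclideanSpace ℝ (Fin (l + 1)))‖ ^ 2 :=
      WithLp.prod_norm_sq_eq_of_L2 E
    rw [he1, norm_zero] at h
    nlinarith [norm_nonneg E]
  have hEin (p : LawsonSplit k l) : inner ℝ E p = inner ℝ e p.fst := by
    rw [WithLp.prod_inner_apply]; simp [hE]
  set W := (ℝ ∙ E)ᗮ with hW
  have hdim : finrank ℝ W = k + l + 1 := by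
    have : Fact (finrank ℝ (LawsonSplit k l) = (k + l + 1) + 1) := ⟨finrank_lawsonSplit k l⟩
    exact Submodule.finrank_orthogonal_span_singleton (by rintro h; simp [h] at hE1)
  have hproj (p : LawsonSplit k l) : ((W.orthogonalProjectionOnto p : W) : LawsonSplit k l) =
      p - inner ℝ e p.fst • E := by
    rw [← Submodule.starProjection_apply, Submodule.starProjection_orthogonal_val,
      Submodule.starProjection_unit_singleton ℝ hE1, hEin]
  set f : P e → W := fun p => W.orthogonalProjectionOnto p.1 with hf
  have hanti : AntilipschitzWith (1 + 2 * (1 + lam)).toNNReal f := by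
    refine AntilipschitzWith.of_le_mul_dist fun p q => ?_
    rw [Real.coe_toNNReal _ (by positivity), Subtype.dist_eq, Subtype.dist_eq, dist_eq_norm,
      dist_eq_norm]
    simp only [hf, hproj]
    obtain ⟨p, ⟨hp1, hp2⟩, hp3⟩ := p
    obtain ⟨q, ⟨hq1, hq2⟩, hq3⟩ := q
    simp only
    set D := ‖p - inner ℝ e p.fst • E - (q - inner ℝ e q.fst • E)‖ with hD
    have hDsq := WithLp.prod_norm_sq_eq_of_L2 (p - inner ℝ e p.fst • E - (q - inner ℝ e q.fst • E))
    have h1 : ‖p.snd - q.snd‖ ≤ D := by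
      refine le_of_sq_le_sq ?_ (norm_nonneg _)
      rw [hDsq]
      simp [hE]
    have h2 : ‖(p.fst - inner ℝ e p.fst • e) - (q.fst - inner ℝ e q.fst • e)‖ ≤ D := by
      refine le_of_sq_le_sq ?_ (norm_nonneg _)
      rw [hDsq]
      simp [hE]
    have h3 := abs_inner_sub_le hlam he1 hp1 hq1 hp3 hq3 h1 h2
    have h4 : p - q = (p - inner ℝ e p.fst • E - (q - inner ℝ e q.fst • E)) +
        (inner ℝ e p.fst - inner ℝ e q.fst : ℝ) • E := by
      rw [sub_smul]; abel
    calc ‖p - q‖ ≤ D + ‖(inner ℝ e p.fst - inner ℝ e q.fst : ℝ) • E‖ := by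
          conv_lhs => rw [h4]
          exact norm_add_le _ _
      _ = D + |inner ℝ e p.fst - inner ℝ e q.fst| := by rw [norm_smul, hE1, mul_one, Real.norm_eq_abs]
      _ ≤ _ := by linarith
  have hball : f ⁻¹' Metric.closedBall 0 (1 + lam) = univ := by
    refine eq_univ_of_forall fun p => ?_
    obtain ⟨p, ⟨hp1, hp2⟩, hp3⟩ := p
    rw [mem_preimage, mem_closedBall_zero_iff]
    refine (Submodule.norm_orthogonalProjectionOnto_apply_le W p).trans ?_
    have := WithLp.prod_norm_sq_eq_of_L2 p
    refine abs_le_of_sq_le_sq' ?_ (by positivity) |>.2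
    rw [this, hp1]
    have : ‖p.snd‖ ^ 2 ≤ 1 := by nlinarith [norm_nonneg p.snd]
    nlinarith [mul_le_mul_of_nonneg_left this (sq_nonneg lam)]
  have h1 := hanti.hausdorffMeasure_preimage_le (d := ((k + l + 1 : ℕ) : ℝ)) (Nat.cast_nonneg _)
    (Metric.closedBall 0 (1 + lam))
  rw [hball] at h1
  have h2 : μHE[k + l + 1] (P e) = μHE[k + l + 1] (univ : Set (P e)) := by
    have := (isometry_subtype_coe (s := P e)).euclideanHausdorffMeasure_image (d := k + l + 1) univ
    rwa [image_univ, Subtype.range_coe] at this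
  rw [h2]
  have h3 : μHE[k + l + 1] (univ : Set (P e)) ≤
      ((1 + 2 * (1 + lam)).toNNReal : ℝ≥0∞) ^ ((k + l + 1 : ℕ) : ℝ) *
        μHE[k + l + 1] (Metric.closedBall (0 : W) (1 + lam)) := by
    simp only [Measure.euclideanHausdorffMeasure_def, Measure.smul_apply,
      Measure.nnreal_smul_coe_apply]
    rw [mul_left_comm]
    gcongr
  refine h3.trans_lt (ENNReal.mul_lt_top (ENNReal.rpow_lt_top_of_nonneg (Nat.cast_nonneg _)
    ENNReal.coe_ne_top) ?_)
  rw [← hdim, InnerProductSpace.euclideanHausdorffMeasure_eq_volume]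
  exact Metric.isBounded_closedBall.measure_lt_top

end LensLawson

namespace LensLawson

open Filter Topology Module

/-! ### Hausdorff measure of the truncated cone: lower bound -/

theorem unitBallVolume_eq {m : ℕ} (hm : m ≠ 0) :
    unitBallVolume m = Real.sqrt Real.pi ^ m / Real.Gamma (m / 2 + 1) := by
  have : Nonempty (Fin m) := Fin.pos_iff_nonempty.1 (by omega)
  have h0 : 0 < Real.Gamma ((m : ℝ) / 2 + 1) := Real.Gamma_pos_of_pos (by positivity)
  rw [unitBallVolume, EuclideanSpace.volume_ball, Fintype.card_fin, ENNReal.ofReal_one, one_pow,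
    one_mul, ENNReal.toReal_ofReal (by positivity)]

theorem sphereArea_eq (k : ℕ) :
    sphereArea k = 2 * Real.sqrt Real.pi ^ (k + 1) / Real.Gamma ((k + 1) / 2) := by
  have h0 : 0 < Real.Gamma (((k : ℝ) + 1) / 2) := Real.Gamma_pos_of_pos (by positivity)
  rw [sphereArea, unitBallVolume_eq (by omega), Nat.cast_succ, Real.Gamma_add_one (by positivity)]
  field_simp

theorem two_mul_integral_sin_pow (m : ℕ) :
    2 * ∫ θ in (0 : ℝ)..(Real.pi / 2), Real.sin θ ^ m =
      Real.sqrt Real.pi * Real.Gamma ((m + 1) / 2) / Real.Gamma ((m + 2) / 2) := by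
  have hpi : Real.sqrt Real.pi ^ 2 = Real.pi := Real.sq_sqrt Real.pi_pos.le
  induction m using Nat.twoStepInduction with
  | zero =>
    have e : ((0 : ℕ) + 2 : ℝ) / 2 = 1 := by norm_num
    simp only [pow_zero, Nat.cast_zero, zero_add] at e ⊢
    rw [e, Real.Gamma_one, Real.Gamma_one_half_eq, intervalIntegral.integral_const, smul_eq_mul]
    nlinarith
  | one =>
    have e : ((1 : ℕ) + 2 : ℝ) / 2 = 1 / 2 + 1 := by norm_num
    have e' : ((1 : ℕ) + 1 : ℝ) / 2 = 1 := by norm_num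
    rw [e, e', Real.Gamma_one, Real.Gamma_add_one (by norm_num), Real.Gamma_one_half_eq]
    simp only [pow_one, integral_sin, Real.cos_zero, Real.cos_pi_div_two]
    have : Real.sqrt Real.pi ≠ 0 := by positivity
    field_simp
    norm_num
  | more m ih _ =>
    have h1 : 0 < Real.Gamma (((m : ℝ) + 1) / 2) := Real.Gamma_pos_of_pos (by positivity)
    have h2 : 0 < Real.Gamma (((m : ℝ) + 2) / 2) := Real.Gamma_pos_of_pos (by positivity)
    have e1 : (((m + 2 : ℕ) : ℝ) + 1) / 2 = ((m : ℝ) + 1) / 2 + 1 := by push_cast; ring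
    have e2 : (((m + 2 : ℕ) : ℝ) + 2) / 2 = ((m : ℝ) + 2) / 2 + 1 := by push_cast; ring
    rw [e1, e2, Real.Gamma_add_one (by positivity), Real.Gamma_add_one (by positivity),
      integral_sin_pow, Real.sin_zero, Real.cos_pi_div_two, zero_pow (by omega)]
    have h3 : 2 * (((m : ℝ) + 1) / (m + 2) * ∫ θ in (0 : ℝ)..(Real.pi / 2), Real.sin θ ^ m) =
        ((m : ℝ) + 1) / (m + 2) * (2 * ∫ θ in (0 : ℝ)..(Real.pi / 2), Real.sin θ ^ m) := by ring
    rw [zero_mul, mul_zero, sub_zero, zero_div, zero_add, h3, ih]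
    field_simp

theorem sphereArea_succ (m : ℕ) :
    sphereArea (m + 1) =
      2 * sphereArea m * ∫ θ in (0 : ℝ)..(Real.pi / 2), Real.sin θ ^ m := by
  have h1 : 0 < Real.Gamma (((m : ℝ) + 1) / 2) := Real.Gamma_pos_of_pos (by positivity)
  have h2 : 0 < Real.Gamma (((m : ℝ) + 2) / 2) := Real.Gamma_pos_of_pos (by positivity)
  have e1 : (((m + 1 : ℕ) : ℝ) + 1) / 2 = ((m : ℝ) + 2) / 2 := by push_cast; ring
  have h := two_mul_integral_sin_pow m
  rw [sphereArea_eq, sphereArea_eq, e1, mul_comm 2 (2 * _ / _), mul_assoc, h]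
  field_simp
  ring

theorem lintegral_pow_div_sqrt (m : ℕ) {R c : ℝ} (hR : 0 < R) (hc : 0 ≤ c) :
    ∫⁻ u in Ioo 0 R, ENNReal.ofReal (u ^ m * (c / Real.sqrt (R ^ 2 - u ^ 2))) =
      ENNReal.ofReal (c * R ^ m * ∫ θ in (0 : ℝ)..(Real.pi / 2), Real.sin θ ^ m) := by
  have hpi := Real.pi_pos
  have hmono : StrictMonoOn (fun θ => R * Real.sin θ) (Icc 0 (Real.pi / 2)) := by
    intro x hx y hy hxy
    exact mul_lt_mul_of_pos_left (Real.strictMonoOn_sin ⟨by linarith [hx.1], hx.2⟩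
      ⟨by linarith [hy.1], hy.2⟩ hxy) hR
  have himg : (fun θ => R * Real.sin θ) '' Ioo 0 (Real.pi / 2) = Ioo 0 R := by
    apply Subset.antisymm
    · rintro _ ⟨θ, hθ, rfl⟩
      have h1 := hmono (left_mem_Icc.2 (by linarith)) ⟨hθ.1.le, hθ.2.le⟩ hθ.1
      have h2 := hmono ⟨hθ.1.le, hθ.2.le⟩ (right_mem_Icc.2 (by linarith)) hθ.2
      simp only [Real.sin_zero, mul_zero, Real.sin_pi_div_two, mul_one] at h1 h2
      exact ⟨h1, h2⟩
    · have h := intermediate_value_Ioo (show (0 : ℝ) ≤ Real.pi / 2 by linarith)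
        (f := fun θ => R * Real.sin θ) (by fun_prop)
      simpa using h
  rw [← himg, lintegral_image_eq_lintegral_abs_deriv_mul measurableSet_Ioo
    (f' := fun θ => R * Real.cos θ)
    (fun θ _ => ((Real.hasDerivAt_sin θ).const_mul R).hasDerivWithinAt)
    (hmono.injOn.mono Ioo_subset_Icc_self), ← intervalIntegral.integral_const_mul,
    intervalIntegral.integral_of_le (by linarith), ← setIntegral_congr_set Ioo_ae_eq_Ioc,
    ofReal_integral_eq_lintegral_ofReal]
  · refine setLIntegral_congr_fun measurableSet_Ioo fun θ hθ => ?_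
    have hcos : 0 < Real.cos θ := Real.cos_pos_of_mem_Ioo ⟨by linarith [hθ.1], hθ.2⟩
    have hsq : Real.sqrt (R ^ 2 - (R * Real.sin θ) ^ 2) = R * Real.cos θ := by
      rw [show R ^ 2 - (R * Real.sin θ) ^ 2 = (R * Real.cos θ) ^ 2 by
        rw [mul_pow, mul_pow, Real.cos_sq']; ring]
      exact Real.sqrt_sq (by positivity)
    rw [hsq, abs_of_pos (by positivity), ← ENNReal.ofReal_mul (by positivity)]
    congr 1
    field_simp
    ring
  · exact (Continuous.integrableOn_Icc (by fun_prop)).mono_set Ioo_subset_Icc_self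
  · filter_upwards [ae_restrict_mem measurableSet_Ioo] with θ hθ
    have : 0 < Real.sin θ := Real.sin_pos_of_pos_of_lt_pi hθ.1 (by linarith [hθ.2])
    show 0 ≤ c * R ^ m * _
    positivity

theorem lintegral_norm_norm (k l : ℕ) {g : ℝ × ℝ → ℝ≥0∞} (hg : Measurable g) :
    ∫⁻ p : LawsonSplit k l, g (‖p.fst‖, ‖p.snd‖) =
      ENNReal.ofReal (orbitArea k l) * ∫⁻ q, g q ∂(radialMeasure k).prod (radialMeasure l) := by
  have hm : Measurable fun p : LawsonSplit k l => (‖p.fst‖, ‖p.snd‖) := by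
    refine Measurable.prodMk ?_ ?_ <;> exact (by fun_prop : Continuous _).measurable
  have h : Measure.map (fun p : LawsonSplit k l => (‖p.fst‖, ‖p.snd‖)) volume =
      ENNReal.ofReal (orbitArea k l) • (radialMeasure k).prod (radialMeasure l) := by
    ext S hS
    rw [Measure.map_apply hm hS, Measure.smul_apply, smul_eq_mul, ← volume_norm_preimage k l hS]
    rfl
  rw [← lintegral_map hg hm, h, lintegral_smul_measure, smul_eq_mul]

/-- The open base over which each half of the truncated cone is a graph. -/
def coneBase (m l : ℕ) (lam : ℝ) : Set (LawsonSplit m l) :=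
  {p | ‖p.fst‖ < lam * ‖p.snd‖ ∧ ‖p.snd‖ < 1}

theorem measurableSet_coneBase (m l : ℕ) (lam : ℝ) : MeasurableSet (coneBase m l lam) :=
  ((isOpen_lt (f := fun p : LawsonSplit m l => ‖p.fst‖) (g := fun p => lam * ‖p.snd‖)
    (by fun_prop) (by fun_prop)).inter
    (isOpen_lt (f := fun p : LawsonSplit m l => ‖p.snd‖)
      (by fun_prop) continuous_const)).measurableSet

/-- The left side is the area integral of one half of the truncated cone over its base, see
`lintegral_coneBase_le`. -/
theorem lintegral_coneBase (m l : ℕ) {lam : ℝ} (hlam : 0 < lam) :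
    ∫⁻ p in coneBase m l lam, ENNReal.ofReal (lam * Real.sqrt (1 + lam ^ 2) * ‖p.snd‖ /
        Real.sqrt ((lam * ‖p.snd‖) ^ 2 - ‖p.fst‖ ^ 2)) =
      ENNReal.ofReal (sphereArea (m + 1) * sphereArea l / 2 *
        (lam ^ (m + 1) * Real.sqrt (1 + lam ^ 2) / (m + l + 2))) := by
  set S := ∫ θ in (0 : ℝ)..(Real.pi / 2), Real.sin θ ^ m with hS
  have hS0 : 0 ≤ S := by
    refine intervalIntegral.integral_nonneg (by positivity) fun θ hθ => pow_nonneg ?_ m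
    exact Real.sin_nonneg_of_nonneg_of_le_pi hθ.1 (by linarith [hθ.2, Real.pi_pos])
  set σ := Real.sqrt (1 + lam ^ 2) with hσ
  have hσ0 : 0 ≤ σ := Real.sqrt_nonneg _
  set B : Set (ℝ × ℝ) := {q | q.1 < lam * q.2 ∧ q.2 < 1} with hB
  have hBm : MeasurableSet B :=
    (measurableSet_lt (f := fun q : ℝ × ℝ => q.1) (g := fun q => lam * q.2)
      (by fun_prop) (by fun_prop)).inter (measurableSet_lt measurable_snd measurable_const)
  set g : ℝ × ℝ → ℝ≥0∞ := fun q =>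
    ENNReal.ofReal (lam * σ * q.2 / Real.sqrt ((lam * q.2) ^ 2 - q.1 ^ 2)) with hg
  have hgm : Measurable g := by
    refine Measurable.ennreal_ofReal (Measurable.div (by fun_prop) ?_)
    exact (by fun_prop : Continuous _).measurable
  have h1 : ∫⁻ p in coneBase m l lam, g (‖p.fst‖, ‖p.snd‖) =
      ∫⁻ p : LawsonSplit m l, B.indicator g (‖p.fst‖, ‖p.snd‖) := by
    rw [← lintegral_indicator (measurableSet_coneBase m l lam)]
    rfl
  have hgi := hgm.indicator hBm
  have hinner (v : ℝ) (hv : 0 < v) :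
      ∫⁻ u, B.indicator g (u, v) ∂radialMeasure m =
        (Iio 1).indicator (fun v => ENNReal.ofReal (σ * lam ^ (m + 1) * S * v ^ (m + 1))) v := by
    have hgv : Measurable fun u => B.indicator g (u, v) := hgi.comp measurable_prodMk_right
    rw [radialMeasure, lintegral_withDensity_eq_lintegral_mul _ (by fun_prop) hgv]
    by_cases hv1 : v < 1
    · rw [indicator_of_mem (show v ∈ Iio 1 from hv1)]
      have h2 : ∫⁻ u in Ioi 0, ((fun u : ℝ => ENNReal.ofReal (u ^ m)) *
            fun u => B.indicator g (u, v)) u =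
          ∫⁻ u in Ioi 0, (Ioo 0 (lam * v)).indicator (fun u => ENNReal.ofReal
            (u ^ m * (lam * σ * v / Real.sqrt ((lam * v) ^ 2 - u ^ 2)))) u := by
        refine setLIntegral_congr_fun measurableSet_Ioi fun u hu => ?_
        have hu : 0 < u := hu
        by_cases huv : u < lam * v
        · rw [indicator_of_mem (show u ∈ Ioo 0 (lam * v) from ⟨hu, huv⟩), Pi.mul_apply,
            indicator_of_mem (show (u, v) ∈ B from ⟨huv, hv1⟩), ENNReal.ofReal_mul (by positivity)]
        · rw [indicator_of_notMem (fun h => huv h.2), Pi.mul_apply,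
            indicator_of_notMem (fun h => huv h.1), mul_zero]
      rw [h2, lintegral_indicator measurableSet_Ioo, Measure.restrict_restrict measurableSet_Ioo,
        inter_eq_self_of_subset_left (show Ioo 0 (lam * v) ⊆ Ioi 0 from fun x hx => hx.1),
        lintegral_pow_div_sqrt m (by positivity) (by positivity)]
      congr 1
      ring
    · rw [indicator_of_notMem (show v ∉ Iio 1 from hv1)]
      have (u : ℝ) : B.indicator g (u, v) = 0 := indicator_of_notMem (fun h => hv1 h.2) _
      simp [this]
  have h3 : ∫⁻ q, B.indicator g q ∂(radialMeasure m).prod (radialMeasure l) =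
      ENNReal.ofReal (σ * lam ^ (m + 1) * S / (m + l + 2)) := by
    rw [lintegral_prod_symm' _ hgi]
    conv_lhs => rw [radialMeasure.eq_def l]
    rw [lintegral_withDensity_eq_lintegral_mul _ (by fun_prop) hgi.lintegral_prod_left']
    have h4 : ∫⁻ v in Ioi 0, ((fun v : ℝ => ENNReal.ofReal (v ^ l)) *
          fun v => ∫⁻ u, B.indicator g (u, v) ∂radialMeasure m) v =
        ∫⁻ v in Ioi 0, (Ioo 0 1).indicator (fun v => ENNReal.ofReal
          (σ * lam ^ (m + 1) * S * v ^ (m + l + 1))) v := by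
      refine setLIntegral_congr_fun measurableSet_Ioi fun v hv => ?_
      have hv : 0 < v := hv
      rw [Pi.mul_apply, hinner v hv]
      by_cases hv1 : v < 1
      · rw [indicator_of_mem (show v ∈ Iio 1 from hv1),
          indicator_of_mem (show v ∈ Ioo 0 1 from ⟨hv, hv1⟩), ← ENNReal.ofReal_mul (by positivity)]
        congr 1
        ring
      · rw [indicator_of_notMem (show v ∉ Iio 1 from hv1), indicator_of_notMem fun h => hv1 h.2,
          mul_zero]
    rw [h4, lintegral_indicator measurableSet_Ioo, Measure.restrict_restrict measurableSet_Ioo,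
      inter_eq_self_of_subset_left (show Ioo (0 : ℝ) 1 ⊆ Ioi 0 from fun x hx => hx.1),
      ← ofReal_integral_eq_lintegral_ofReal, setIntegral_congr_set Ioo_ae_eq_Ioc,
      ← intervalIntegral.integral_of_le zero_le_one, intervalIntegral.integral_const_mul,
      integral_pow]
    · congr 1
      push_cast
      rw [one_pow, zero_pow (by omega)]
      field_simp
      ring
    · exact (Continuous.integrableOn_Icc (by fun_prop)).mono_set Ioo_subset_Icc_self
    · filter_upwards [ae_restrict_mem measurableSet_Ioo] with v hv
      have := hv.1
      show 0 ≤ _ * v ^ (m + l + 1)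
      positivity
  change ∫⁻ p in coneBase m l lam, g (‖p.fst‖, ‖p.snd‖) = _
  rw [h1, lintegral_norm_norm m l hgi, h3, ← ENNReal.ofReal_mul (orbitArea_pos m l).le,
    sphereArea_succ, orbitArea]
  congr 1
  ring

/-- `ℝ^(m+1) → ℝ^(m+2)`, `z ↦ (0, z)`. -/
noncomputable def consZero (m : ℕ) :
    EuclideanSpace ℝ (Fin (m + 1)) →ₗᵢ[ℝ] EuclideanSpace ℝ (Fin (m + 2)) where
  toFun z := WithLp.toLp 2 (Fin.cons 0 z.ofLp)
  map_add' z w := by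
    ext i
    refine Fin.cases ?_ (fun j => ?_) i <;> simp
  map_smul' c z := by
    ext i
    refine Fin.cases ?_ (fun j => ?_) i <;> simp
  norm_map' z := by
    simp [EuclideanSpace.norm_eq, Fin.sum_univ_succ]

/-- The inclusion of the base into the space of the cone, `(z, y) ↦ ((0, z), y)`. -/
noncomputable def baseInclusion (m l : ℕ) : LawsonSplit m l →ₗᵢ[ℝ] LawsonSplit (m + 1) l where
  toFun p := WithLp.toLp 2 (consZero m p.fst, p.snd)
  map_add' p q := WithLp.ofLp_injective 2 (Prod.ext (by simp) (by simp))
  map_smul' c p := WithLp.ofLp_injective 2 (Prod.ext (by simp) (by simp))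
  norm_map' p := by
    refine (sq_eq_sq₀ (norm_nonneg _) (norm_nonneg _)).1 ?_
    rw [WithLp.prod_norm_sq_eq_of_L2, WithLp.prod_norm_sq_eq_of_L2]
    simp

/-- The unit vector along which the two halves of the cone are graphs. -/
noncomputable def graphDirection (m l : ℕ) : LawsonSplit (m + 1) l :=
  WithLp.toLp 2 (EuclideanSpace.single 0 1, 0)

theorem inner_graphDirection (m l : ℕ) (p : LawsonSplit (m + 1) l) :
    inner ℝ p (graphDirection m l) = p.fst 0 := by
  rw [WithLp.prod_inner_apply]
  simp [graphDirection, EuclideanSpace.inner_single_right]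

theorem norm_graphDirection (m l : ℕ) : ‖graphDirection m l‖ = 1 := by
  refine (sq_eq_sq₀ (norm_nonneg _) zero_le_one).1 ?_
  rw [WithLp.prod_norm_sq_eq_of_L2]
  simp [graphDirection]

theorem hasFDerivAt_coneHeight {m l : ℕ} {lam s : ℝ} {p : LawsonSplit m l}
    (hp : ‖p.fst‖ < lam * ‖p.snd‖) :
    HasFDerivAt (fun p : LawsonSplit m l => s * Real.sqrt ((lam * ‖p.snd‖) ^ 2 - ‖p.fst‖ ^ 2))
      (innerSL ℝ ((s / Real.sqrt ((lam * ‖p.snd‖) ^ 2 - ‖p.fst‖ ^ 2)) •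
        (WithLp.toLp 2 (-p.fst, lam ^ 2 • p.snd) : LawsonSplit m l))) p := by
  have hpos : 0 < (lam * ‖p.snd‖) ^ 2 - ‖p.fst‖ ^ 2 := by
    nlinarith [norm_nonneg p.fst]
  have h1 := ((WithLp.fstL 2 ℝ (EuclideanSpace ℝ (Fin (m + 1)))
    (EuclideanSpace ℝ (Fin (l + 1)))).hasFDerivAt (x := p)).norm_sq
  have h2 := ((WithLp.sndL 2 ℝ (EuclideanSpace ℝ (Fin (m + 1)))
    (EuclideanSpace ℝ (Fin (l + 1)))).hasFDerivAt (x := p)).norm_sq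
  have h3 := ((((h2.const_mul (lam ^ 2)).sub h1).sqrt (by
    simpa [mul_pow] using hpos.ne')).const_mul s)
  have e : (fun p : LawsonSplit m l => s * Real.sqrt ((lam * ‖p.snd‖) ^ 2 - ‖p.fst‖ ^ 2)) =
      fun p : LawsonSplit m l => s * Real.sqrt (lam ^ 2 * ‖WithLp.sndL 2 ℝ
        (EuclideanSpace ℝ (Fin (m + 1))) (EuclideanSpace ℝ (Fin (l + 1))) p‖ ^ 2 -
        ‖WithLp.fstL 2 ℝ (EuclideanSpace ℝ (Fin (m + 1)))
          (EuclideanSpace ℝ (Fin (l + 1))) p‖ ^ 2) := by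
    funext q
    rw [mul_pow]
    rfl
  rw [e]
  refine h3.congr_fderiv ?_
  ext w
  rw [innerSL_apply_apply, inner_smul_left, WithLp.prod_inner_apply]
  simp [mul_pow, inner_smul_left]
  ring

theorem norm_sq_coneGradient {m l : ℕ} (lam c : ℝ) (p : LawsonSplit m l) :
    ‖c • (WithLp.toLp 2 (-p.fst, lam ^ 2 • p.snd) : LawsonSplit m l)‖ ^ 2 =
      c ^ 2 * (‖p.fst‖ ^ 2 + lam ^ 4 * ‖p.snd‖ ^ 2) := by
  have h : ‖(WithLp.toLp 2 (-p.fst, lam ^ 2 • p.snd) : LawsonSplit m l)‖ ^ 2 =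
      ‖-p.fst‖ ^ 2 + ‖lam ^ 2 • p.snd‖ ^ 2 := WithLp.prod_norm_sq_eq_of_L2 _
  rw [norm_smul, mul_pow, h, norm_neg, norm_smul, mul_pow, Real.norm_eq_abs, Real.norm_eq_abs,
    sq_abs, sq_abs]
  ring

theorem lintegral_coneBase_le {m l : ℕ} {lam s : ℝ} (hlam : 0 < lam) (hs : s ^ 2 = 1) :
    ∫⁻ p in coneBase m l lam, ENNReal.ofReal (lam * Real.sqrt (1 + lam ^ 2) * ‖p.snd‖ /
        Real.sqrt ((lam * ‖p.snd‖) ^ 2 - ‖p.fst‖ ^ 2)) ≤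
      μHE[m + l + 2] ((fun p => baseInclusion m l p +
        (s * Real.sqrt ((lam * ‖p.snd‖) ^ 2 - ‖p.fst‖ ^ 2)) • graphDirection m l) ''
          coneBase m l lam) := by
  have h := lintegral_sqrt_one_add_sq_le (ι := baseInclusion m l) (norm_graphDirection m l)
    (fun w => by rw [inner_graphDirection]; simp [baseInclusion, consZero])
    (measurableSet_coneBase m l lam) (fun p hp => hasFDerivAt_coneHeight (s := s) hp.1)
  rw [finrank_lawsonSplit] at h
  refine le_trans (le_of_eq ?_) h
  refine setLIntegral_congr_fun (measurableSet_coneBase m l lam) fun p hp => ?_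
  have hpos : 0 < (lam * ‖p.snd‖) ^ 2 - ‖p.fst‖ ^ 2 := by
    nlinarith [norm_nonneg p.fst, hp.1]
  have hsq := Real.sq_sqrt hpos.le
  have hsq0 := Real.sqrt_pos.2 hpos
  have hσ : Real.sqrt (1 + lam ^ 2) ^ 2 = 1 + lam ^ 2 := Real.sq_sqrt (by positivity)
  rw [norm_sq_coneGradient]
  congr 1
  rw [eq_comm, Real.sqrt_eq_iff_mul_self_eq (by positivity) (by positivity), ← pow_two]
  generalize Real.sqrt ((lam * ‖p.snd‖) ^ 2 - ‖p.fst‖ ^ 2) = Q at hsq hsq0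
  rw [mul_pow] at hsq
  rw [div_pow (lam * _ * _), mul_pow, mul_pow, hσ, div_pow, hs]
  field_simp
  rw [hsq]
  ring

/-- The halves of the cone are the graphs of `±√(λ² |y|² - |z|²)` over the base, where
`x = (x₀, z)`; they are told apart by the sign of `x₀`. -/
theorem le_euclideanHausdorffMeasure_cone (m l : ℕ) {lam : ℝ} (hlam : 0 < lam) :
    ENNReal.ofReal (orbitArea (m + 1) l *
      (lam ^ (m + 1) * Real.sqrt (1 + lam ^ 2) / (m + l + 2))) ≤
    μHE[m + l + 2]
      {p : LawsonSplit (m + 1) l | ‖p.fst‖ = lam * ‖p.snd‖ ∧ ‖p.snd‖ < 1} := by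
  set A := {p : LawsonSplit (m + 1) l | ‖p.fst‖ = lam * ‖p.snd‖ ∧ ‖p.snd‖ < 1} with hA
  set M : Set (LawsonSplit (m + 1) l) := {p | 0 < p.fst 0} with hM
  have hMm : MeasurableSet M :=
    (isOpen_lt (f := fun _ : LawsonSplit (m + 1) l => (0 : ℝ)) (g := fun p => p.fst 0)
      continuous_const (by fun_prop)).measurableSet
  have hpos (p : LawsonSplit m l) (hp : p ∈ coneBase m l lam) :
      0 < (lam * ‖p.snd‖) ^ 2 - ‖p.fst‖ ^ 2 := by
    nlinarith [norm_nonneg p.fst, hp.1]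
  have hfst (p : LawsonSplit m l) (c : ℝ) :
      (baseInclusion m l p + c • graphDirection m l).fst 0 = c := by
    simp [baseInclusion, graphDirection, consZero]
  have hmem (s : ℝ) (hs : s ^ 2 = 1) (p : LawsonSplit m l) (hp : p ∈ coneBase m l lam) :
      baseInclusion m l p + (s * Real.sqrt ((lam * ‖p.snd‖) ^ 2 - ‖p.fst‖ ^ 2)) •
        graphDirection m l ∈ A := by
    set c := s * Real.sqrt ((lam * ‖p.snd‖) ^ 2 - ‖p.fst‖ ^ 2) with hc
    have hc2 : c ^ 2 = (lam * ‖p.snd‖) ^ 2 - ‖p.fst‖ ^ 2 := by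
      rw [hc, mul_pow, hs, one_mul, Real.sq_sqrt (hpos p hp).le]
    have h1 : (baseInclusion m l p + c • graphDirection m l).snd = p.snd := by
      simp [baseInclusion, graphDirection]
    have h2 : ‖(baseInclusion m l p + c • graphDirection m l).fst‖ ^ 2 = ‖p.fst‖ ^ 2 + c ^ 2 := by
      simp [baseInclusion, graphDirection, consZero, EuclideanSpace.norm_sq_eq, Fin.sum_univ_succ]
      ring
    refine ⟨?_, by rw [h1]; exact hp.2⟩
    rw [h1, ← sq_eq_sq₀ (norm_nonneg _) (by positivity), h2, hc2]
    ring
  have h1 := (lintegral_coneBase m l hlam).symm.le.trans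
    (lintegral_coneBase_le hlam (s := 1) (by norm_num))
  have h2 := (lintegral_coneBase m l hlam).symm.le.trans
    (lintegral_coneBase_le hlam (s := -1) (by norm_num))
  rw [← measure_inter_add_sdiff A hMm]
  have hpS := sphereArea_pos (m + 1)
  have hpS' := sphereArea_pos l
  calc ENNReal.ofReal (orbitArea (m + 1) l *
        (lam ^ (m + 1) * Real.sqrt (1 + lam ^ 2) / (m + l + 2)))
      = ENNReal.ofReal (sphereArea (m + 1) * sphereArea l / 2 *
        (lam ^ (m + 1) * Real.sqrt (1 + lam ^ 2) / (m + l + 2))) +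
        ENNReal.ofReal (sphereArea (m + 1) * sphereArea l / 2 *
        (lam ^ (m + 1) * Real.sqrt (1 + lam ^ 2) / (m + l + 2))) := by
        rw [← ENNReal.ofReal_add (by positivity) (by positivity), orbitArea]
        congr 1
        ring
    _ ≤ _ := by
        refine add_le_add (h1.trans (measure_mono ?_)) (h2.trans (measure_mono ?_))
        · rintro _ ⟨p, hp, rfl⟩
          refine ⟨hmem 1 (by norm_num) p hp, ?_⟩
          change (0 : ℝ) < (WithLp.fst (_ : LawsonSplit (m + 1) l)) 0
          rw [hfst, one_mul]
          exact Real.sqrt_pos.2 (hpos p hp)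
        · rintro _ ⟨p, hp, rfl⟩
          refine ⟨hmem (-1) (by norm_num) p hp, ?_⟩
          change ¬ (0 : ℝ) < (WithLp.fst (_ : LawsonSplit (m + 1) l)) 0
          rw [hfst, not_lt, neg_one_mul, neg_nonpos]
          exact Real.sqrt_nonneg _

end LensLawson

namespace LensLawson

open Filter Topology Module

/-! ### Reduction of the energy comparison to a real inequality -/

variable {k l : ℕ}

theorem sliceVolume_pos (H : IsWideSlope (slope k l)) : 0 < sliceVolume k l := by
  have h1 := isArc_fst H
  have h2 := isArc_snd H
  have hc (a b : ℝ) : Continuous (quadrantDist a b : LawsonSplit k l → ℝ) :=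
    (lipschitzWith_quadrantDist a b).continuous
  have hopen : IsOpen (lawsonSet k l) := by
    rw [lawsonSet_eq H]
    exact isOpen_lt (((hc _ _).sub continuous_const).max ((hc _ _).sub continuous_const))
      continuous_const
  have h0 : (0 : LawsonSplit k l) ∈ lawsonSet k l := by
    rw [lawsonSet, mem_ofPred_eq, mem_slice_iff H]
    have := h1.a_pos; have := h1.h_pos; have := h2.h_pos
    simp only [WithLp.zero_fst, WithLp.zero_snd, norm_zero, le_refl, true_and]
    rw [h1.r_sq, h2.r_sq]
    constructor <;> nlinarith
  have h := hopen.measure_pos volume ⟨0, h0⟩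
  rw [volume_lawsonSet H, ENNReal.ofReal_pos] at h
  exact pos_of_mul_pos_right h (orbitArea_pos k l).le

/-- The competitor has less energy than the lens as soon as its slice satisfies two
scale-invariant inequalities. -/
theorem lawsonEnergy_lt_planeEnergy (H : IsWideSlope (slope k l)) (hk : 1 ≤ k) {q : ℝ}
    (h1 : sliceArea k l - slope k l ^ k * Real.sqrt (1 + slope k l ^ 2) / (k + l + 1) ≤
      (k + l + 2) * q * sliceVolume k l) (hq : 0 ≤ q)
    (h2 : q ^ (k + l + 2) * (orbitArea k l * sliceVolume k l) <
      volume.real (unitLens (k + l + 2))) :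
    lawsonEnergy k l < (planeEnergy (k + l + 2) : EReal) := by
  have hc := orbitArea_pos k l
  have hV := sliceVolume_pos H
  set c := orbitArea k l
  set V := sliceVolume k l
  set A := sliceArea k l
  set B := slope k l ^ k * Real.sqrt (1 + slope k l ^ 2) / (k + l + 1) with hB
  have hA : 0 ≤ A := add_nonneg ((isArc_fst H).arcArea_nonneg _ _) ((isArc_snd H).arcArea_nonneg _ _)
  have hvol : (volume (lawsonSet k l)).toReal = c * V := by
    rw [volume_lawsonSet H, ENNReal.toReal_ofReal (by positivity)]
  set s : ℝ := (c * V) ^ (-(1 : ℝ) / ((k : ℝ) + l + 2)) with hs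
  have hs0 : 0 < s := Real.rpow_pos_of_pos (by positivity) _
  have hsn : s ^ (k + l + 2) * (c * V) = 1 := by
    have : ((k + l + 2 : ℕ) : ℝ) = (k : ℝ) + l + 2 := by push_cast; ring
    rw [hs, ← Real.rpow_natCast, this, ← Real.rpow_mul (by positivity),
      div_mul_cancel₀ _ (by positivity), Real.rpow_neg_one, inv_mul_cancel₀ (by positivity)]
  have hch : lawsonChamber k l = s • lawsonSet k l := by rw [lawsonChamber, hvol]
  have hper : perimeter (lawsonChamber k l) ≤ ENNReal.ofReal (s ^ (k + l + 1) * (c * A)) := by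
    rw [hch, perimeter_smul (by rw [finrank_lawsonSplit]; omega) hs0, finrank_lawsonSplit,
      ENNReal.ofReal_mul (by positivity)]
    exact mul_le_mul' le_rfl (perimeter_lawsonSet_le H)
  have hcone : s ^ (k + l + 1) * (c * B) ≤
      (μHE[k + l + 1] (lawsonCone k l ∩ lawsonChamber k l)).toReal := by
    have e1 : lawsonCone k l ∩ lawsonChamber k l = s • (lawsonCone k l ∩ lawsonSet k l) := by
      rw [hch, smul_set_inter₀ hs0.ne']
      congr 1
      ext p
      rw [mem_smul_set_iff_inv_smul_mem₀ hs0.ne', mem_lawsonCone_iff, mem_lawsonCone_iff,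
        WithLp.smul_fst, WithLp.smul_snd, norm_smul, norm_smul, mul_left_comm]
      exact (mul_right_inj' (by simpa using hs0.ne')).symm
    rw [e1, Measure.euclideanHausdorffMeasure_smul₀ _ hs0.ne', lawsonCone_inter_lawsonSet H]
    have hfin := euclideanHausdorffMeasure_cone_lt_top k l H.pos
    have hle : ENNReal.ofReal (c * B) ≤ μHE[k + l + 1]
        {p : LawsonSplit k l | ‖p.fst‖ = slope k l * ‖p.snd‖ ∧ ‖p.snd‖ < 1} := by
      obtain ⟨m, rfl⟩ : ∃ m, k = m + 1 := ⟨k - 1, by omega⟩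
      have h := le_euclideanHausdorffMeasure_cone m l H.pos
      have e2 : m + 1 + l + 1 = m + l + 2 := by omega
      rw [e2]
      convert h using 3
      rw [hB]
      push_cast
      ring_nf
    have hle' := (ENNReal.ofReal_le_iff_le_toReal hfin.ne).1 hle
    rw [ENNReal.toReal_smul, NNReal.smul_def, smul_eq_mul, NNReal.coe_pow, coe_nnnorm,
      Real.norm_of_nonneg hs0.le]
    gcongr
  have hupper : lawsonEnergy k l ≤ ((s ^ (k + l + 1) * (c * A) - s ^ (k + l + 1) * (c * B) : ℝ) : EReal) := by
    rw [lawsonEnergy, EReal.coe_sub]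
    refine EReal.sub_le_sub ?_ (EReal.coe_le_coe_iff.2 hcone)
    have := EReal.coe_ennreal_le_coe_ennreal_iff.2 hper
    rwa [EReal.coe_ennreal_ofReal, max_eq_left (by positivity)] at this
  refine hupper.trans_lt (EReal.coe_lt_coe_iff.2 (lt_of_lt_of_le ?_
    (le_planeEnergy (by omega))))
  have ht := lensScale_pos (k + l + 2)
  have htn := lensScale_pow_mul (n := k + l + 2) (by omega)
  set t := lensScale (k + l + 2)
  -- The second inequality says that `q` times the scale of the lens is below that of the competitor.
  have hqt : q * t < s := by
    refine lt_of_pow_lt_pow_left₀ (k + l + 2) hs0.le ?_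
    have hL : 0 < volume.real (unitLens (k + l + 2)) := lt_of_le_of_lt (by positivity) h2
    have e1 : t ^ (k + l + 2) = 1 / volume.real (unitLens (k + l + 2)) := by
      rw [eq_div_iff hL.ne', htn]
    have e2 : s ^ (k + l + 2) = 1 / (c * V) := by rw [eq_div_iff (by positivity), hsn]
    rw [mul_pow, e1, e2, mul_one_div, div_lt_div_iff₀ hL (by positivity)]
    linarith
  calc s ^ (k + l + 1) * (c * A) - s ^ (k + l + 1) * (c * B)
      = s ^ (k + l + 1) * c * (A - B) := by ring
    _ ≤ s ^ (k + l + 1) * c * ((k + l + 2) * q * V) := by gcongr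
    _ = (k + l + 2) * q * (s ^ (k + l + 2) * (c * V)) / s := by
        field_simp
        ring
    _ = (k + l + 2) * (q / s) := by rw [hsn]; ring
    _ < (k + l + 2) * (1 / t) := by
        gcongr ?_ * ?_
        rw [div_lt_div_iff₀ hs0 ht]
        linarith
    _ = _ := by push_cast; ring

end LensLawson

namespace LensLawson

open Filter Topology Module

/-! ### Integral estimates along one arc -/

theorem hasDerivAt_arcHeight {h r u : ℝ} (hu : u ^ 2 < r ^ 2) :
    HasDerivAt (arcHeight h r) (-(u / Real.sqrt (r ^ 2 - u ^ 2))) u := by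
  have h1 : HasDerivAt (fun u : ℝ => r ^ 2 - u ^ 2) (-(2 * u)) u := by
    simpa using (hasDerivAt_pow 2 u).const_sub (r ^ 2)
  have h2 := (h1.sqrt (sub_pos.2 hu).ne').sub_const h
  refine h2.congr_deriv ?_
  have : Real.sqrt (r ^ 2 - u ^ 2) ≠ 0 := (Real.sqrt_pos.2 (sub_pos.2 hu)).ne'
  field_simp

/-- The weighted integral of the height of an arc. -/
noncomputable def arcMoment (k l : ℕ) (a h r : ℝ) : ℝ :=
  ∫ u in (0 : ℝ)..a, u ^ k * arcHeight h r u ^ l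

/-- Integration by parts; it is the divergence theorem for the position vector on the region below
the arc. The segment does not contribute, as the position vector is tangent to it. -/
theorem IsArc.mul_arcVolume_eq {a b h r : ℝ} (H : IsArc a b h r) (k l : ℕ) :
    (k + l + 2) * arcVolume k l a b h r = r * arcArea k l a h r - h * arcMoment k l a h r := by
  have ha := H.a_pos; have hb := H.b_pos; have hr := H.r_pos; have har := H.lt_r
  have hlt (u : ℝ) (hu : u ∈ uIcc 0 a) : u ^ 2 < r ^ 2 := by
    rw [uIcc_of_le ha.le] at hu
    nlinarith [hu.1, hu.2]
  have hcf := continuous_arcHeight h r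
  have hI1 : IntervalIntegrable (fun u => u ^ k * arcHeight h r u ^ l *
      (r / Real.sqrt (r ^ 2 - u ^ 2))) volume 0 a :=
    ((IsArc.continuousOn_arcIntegrand h r k l).mono fun u hu => by
      rw [uIcc_of_le ha.le] at hu
      exact ⟨by linarith [hu.1], by linarith [hu.2]⟩).intervalIntegrable
  have hI2 : IntervalIntegrable (fun u => u ^ k * arcHeight h r u ^ l) volume 0 a :=
    Continuous.intervalIntegrable (by fun_prop) _ _
  have hI3 : IntervalIntegrable (fun u => u ^ k * ((arcHeight h r u ^ (l + 1) -
      (b / a * u) ^ (l + 1)) / (l + 1))) volume 0 a :=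
    Continuous.intervalIntegrable (by fun_prop) _ _
  rw [arcVolume, arcArea, arcMoment, ← intervalIntegral.integral_const_mul,
    ← intervalIntegral.integral_const_mul, ← intervalIntegral.integral_const_mul,
    ← intervalIntegral.integral_sub (hI1.const_mul r) (hI2.const_mul h), ← sub_eq_zero,
    ← intervalIntegral.integral_sub (hI3.const_mul _)
      ((hI1.const_mul r).sub (hI2.const_mul h))]
  have hderiv (u : ℝ) (hu : u ∈ uIcc 0 a) :
      HasDerivAt (fun u => u ^ (k + 1) * ((arcHeight h r u ^ (l + 1) -
        (b / a * u) ^ (l + 1)) / (l + 1)))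
      ((k + l + 2) * (u ^ k * ((arcHeight h r u ^ (l + 1) - (b / a * u) ^ (l + 1)) / (l + 1))) -
        (r * (u ^ k * arcHeight h r u ^ l * (r / Real.sqrt (r ^ 2 - u ^ 2))) -
          h * (u ^ k * arcHeight h r u ^ l))) u := by
    have hpos : 0 < r ^ 2 - u ^ 2 := sub_pos.2 (hlt u hu)
    have h1 := (hasDerivAt_arcHeight (h := h) (hlt u hu)).pow (l + 1)
    have h2 := ((hasDerivAt_id u).const_mul (b / a)).pow (l + 1)
    have h3 := (hasDerivAt_pow (k + 1) u).mul ((h1.sub h2).div_const ((l : ℝ) + 1))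
    refine h3.congr_deriv ?_
    have hs : Real.sqrt (r ^ 2 - u ^ 2) ^ 2 = r ^ 2 - u ^ 2 := Real.sq_sqrt hpos.le
    have hs0 : 0 < Real.sqrt (r ^ 2 - u ^ 2) := Real.sqrt_pos.2 hpos
    have hf : arcHeight h r u = Real.sqrt (r ^ 2 - u ^ 2) - h := rfl
    simp only [Pi.pow_apply, Pi.sub_apply, id, Nat.add_sub_cancel, Nat.cast_add, Nat.cast_one, hf]
    generalize Real.sqrt (r ^ 2 - u ^ 2) = s at hs hs0
    have hr2 : r ^ 2 = s ^ 2 + u ^ 2 := by linarith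
    generalize b / a = c
    rw [mul_div_assoc' _ r s, mul_div_assoc' r _ s,
      show r * (u ^ k * (s - h) ^ l * r) = u ^ k * (s - h) ^ l * r ^ 2 by ring, hr2]
    field_simp
    ring
  rw [intervalIntegral.integral_eq_sub_of_hasDerivAt hderiv
    ((hI3.const_mul _).sub ((hI1.const_mul r).sub (hI2.const_mul h)))]
  rw [H.arcHeight_a, div_mul_cancel₀ _ ha.ne']
  simp

/-- `∫₀¹ t^k (1 + α (1 - t²))^l dt`. -/
noncomputable def capIntegral (k l : ℕ) (α : ℝ) : ℝ :=
  ∫ t in (0 : ℝ)..1, t ^ k * (1 + α * (1 - t ^ 2)) ^ l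

/-- `∫₀¹ t^k (1 + α (1 - t²))^l (1 - t²) dt`. -/
noncomputable def capMoment (k l : ℕ) (α : ℝ) : ℝ :=
  ∫ t in (0 : ℝ)..1, t ^ k * (1 + α * (1 - t ^ 2)) ^ l * (1 - t ^ 2)

theorem hasDerivAt_cap (k l : ℕ) (α t : ℝ) :
    HasDerivAt (fun t : ℝ => t ^ (k + 1) * (1 + α * (1 - t ^ 2)) ^ (l + 1))
      (t ^ k * (1 + α * (1 - t ^ 2)) ^ l * (2 * (((k + 1) / 2 - α * (l + 1)) +
        α * ((k + 1) / 2 + (l + 1)) * (1 - t ^ 2)))) t := by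
  have h1 : HasDerivAt (fun t : ℝ => 1 + α * (1 - t ^ 2)) (α * -(2 * t)) t := by
    simpa using (((hasDerivAt_pow 2 t).const_sub 1).const_mul α).const_add 1
  refine ((hasDerivAt_pow (k + 1) t).mul (h1.pow (l + 1))).congr_deriv ?_
  simp only [Pi.pow_apply, Nat.add_sub_cancel, Nat.cast_add, Nat.cast_one]
  ring

/-- The integral of the derivative of `t^(k+1) (1 + α (1 - t²))^(l+1)`. -/
theorem capIntegral_identity (k l : ℕ) (α : ℝ) :
    2 * (((k + 1) / 2 - α * (l + 1)) * capIntegral k l α +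
      α * ((k + 1) / 2 + (l + 1)) * capMoment k l α) = 1 := by
  have h := intervalIntegral.integral_eq_sub_of_hasDerivAt
    (fun t (_ : t ∈ uIcc (0 : ℝ) 1) => hasDerivAt_cap k l α t)
    (Continuous.intervalIntegrable (by fun_prop) _ _)
  rw [capIntegral, capMoment, ← intervalIntegral.integral_const_mul,
    ← intervalIntegral.integral_const_mul, ← intervalIntegral.integral_add
      (Continuous.intervalIntegrable (by fun_prop) _ _)
      (Continuous.intervalIntegrable (by fun_prop) _ _),
    ← intervalIntegral.integral_const_mul]
  convert h using 1
  · refine intervalIntegral.integral_congr fun t _ => ?_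
    ring
  · simp

/-- The integrand is dominated by the derivative of
`t^(k+1) (1 + α (1 - t²))^(l+1) / ((1 + β (1 - t²)) (μ + β))`. -/
theorem two_mul_capIntegral_le (k l : ℕ) {α β μ : ℝ} (hα : 0 ≤ α) (hβ : 0 ≤ β) (hμ : 0 < μ)
    (hμe : μ = (k + 1) / 2 - α * (l + 1))
    (hβe : β * (μ + 2) = α * ((k + 1) / 2 + (l + 1)))
    (h1 : 2 * β ≤ 1 + α) (h2 : α ≤ β * (2 - β)) :
    2 * capIntegral k l α ≤ 1 / (μ + β) := by
  have hden (t : ℝ) (ht : t ∈ Icc (0 : ℝ) 1) : 0 < 1 + β * (1 - t ^ 2) := by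
    have : 0 ≤ 1 - t ^ 2 := by nlinarith [ht.1, ht.2]
    positivity
  set D : ℝ → ℝ := fun t => t ^ k * (1 + α * (1 - t ^ 2)) ^ l *
    ((2 * (μ + β * (μ + 2) * (1 - t ^ 2)) * (1 + β * (1 - t ^ 2)) +
      t * (1 + α * (1 - t ^ 2)) * (β * (2 * t))) / (1 + β * (1 - t ^ 2)) ^ 2) / (μ + β) with hD
  have hderiv (t : ℝ) (ht : t ∈ uIcc (0 : ℝ) 1) :
      HasDerivAt (fun t : ℝ => t ^ (k + 1) * (1 + α * (1 - t ^ 2)) ^ (l + 1) /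
        (1 + β * (1 - t ^ 2)) / (μ + β)) (D t) t := by
    rw [uIcc_of_le zero_le_one] at ht
    have h3 : HasDerivAt (fun t : ℝ => 1 + β * (1 - t ^ 2)) (β * -(2 * t)) t := by
      simpa using (((hasDerivAt_pow 2 t).const_sub 1).const_mul β).const_add 1
    refine (((hasDerivAt_cap k l α t).div h3 (hden t ht).ne').div_const (μ + β)).congr_deriv ?_
    rw [← hμe, ← hβe, hD]
    simp only
    congr 1
    rw [mul_div_assoc']
    congr 1
    ring
  have hDi : IntervalIntegrable D volume 0 1 := by
    refine ContinuousOn.intervalIntegrable ?_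
    rw [uIcc_of_le zero_le_one]
    refine ContinuousOn.div_const (ContinuousOn.mul (by fun_prop)
      (ContinuousOn.div (by fun_prop) (by fun_prop) ?_)) _
    exact fun t ht => (pow_pos (hden t ht) 2).ne'
  have h := intervalIntegral.integral_eq_sub_of_hasDerivAt hderiv hDi
  have hμβ : 0 < μ + β := by positivity
  have hle : ∫ t in (0 : ℝ)..1, 2 * (t ^ k * (1 + α * (1 - t ^ 2)) ^ l) ≤
      ∫ t in (0 : ℝ)..1, D t := by
    refine intervalIntegral.integral_mono_on zero_le_one
      (Continuous.intervalIntegrable (by fun_prop) _ _) hDi fun t ht => ?_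
    have hd := hden t ht
    have ht0 := ht.1
    have hy0 : 0 ≤ 1 - t ^ 2 := by nlinarith [ht.1, ht.2]
    have htt : t * t = 1 - (1 - t ^ 2) := by ring
    rw [hD]
    simp only
    rw [mul_comm 2, mul_div_assoc, div_div]
    have hw : 0 ≤ t ^ k * (1 + α * (1 - t ^ 2)) ^ l := by positivity
    refine mul_le_mul_of_nonneg_left ?_ hw
    rw [le_div_iff₀ (by positivity)]
    have e : t * (1 + α * (1 - t ^ 2)) * (β * (2 * t)) =
        2 * (1 - (1 - t ^ 2)) * (1 + α * (1 - t ^ 2)) * β := by ring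
    rw [e]
    set y := 1 - t ^ 2
    have k1 : 0 ≤ (1 + α - 2 * β) * (β * y) := by
      have := sub_nonneg.2 h1
      positivity
    have k2 : 0 ≤ (β * (2 - β) - α) * (β * y ^ 2) := by
      have := sub_nonneg.2 h2
      positivity
    nlinarith
  rw [intervalIntegral.integral_const_mul] at hle
  rw [h] at hle
  simpa [capIntegral] using hle

end LensLawson

namespace LensLawson

open Filter Topology Module

/-! ### Length and area of an arc with contact angle `π/3` -/

/-- The data of an arc that ends at `(a, b)` and makes there the angle `π/3` with the ray from the
origin; `X / ζ` is the tangent of the angle by which the arc turns up to its end point. -/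
structure IsContactArc (a b h r σ X ζ : ℝ) : Prop extends IsArc a b h r where
  σ_pos : 0 < σ
  σ_sq : σ ^ 2 = a ^ 2 + b ^ 2
  X_pos : 0 < X
  X_eq : X = Real.sqrt 3 * a - b
  ζ_eq : ζ = Real.sqrt 3 * b + a
  h_eq : h = σ ^ 2 / X
  r_eq : r = 2 * a * σ / X

section ContactArc

variable {a b h r σ X ζ : ℝ}

theorem IsContactArc.ζ_pos (H : IsContactArc a b h r σ X ζ) : 0 < ζ := by
  have := H.a_pos; have := H.b_pos
  rw [H.ζ_eq]
  positivity

theorem IsContactArc.b_add_h (H : IsContactArc a b h r σ X ζ) : b + h = a * ζ / X := by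
  have h3 : Real.sqrt 3 ^ 2 = 3 := Real.sq_sqrt (by norm_num)
  have hX := H.X_pos.ne'
  rw [H.h_eq, H.σ_sq, eq_div_iff hX, add_mul, div_mul_cancel₀ _ hX, H.ζ_eq]
  rw [H.X_eq]
  ring

theorem IsContactArc.r_eq' (H : IsContactArc a b h r σ X ζ) : r = 2 * σ / ζ * (a * ζ / X) := by
  have hX := H.X_pos.ne'
  have hζ := H.ζ_pos.ne'
  rw [H.r_eq]
  field_simp

/-- The distance of a point of the arc from the horizontal line through its centre; above it is
bounded by `√(1 + z) ≤ 1 + z / 2`. -/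
theorem IsContactArc.sqrt_bounds (H : IsContactArc a b h r σ X ζ) {u y : ℝ}
    (hy : y = 1 - (u / a) ^ 2) (hy0 : 0 ≤ y) :
    a * ζ / X ≤ Real.sqrt (r ^ 2 - u ^ 2) ∧
      Real.sqrt (r ^ 2 - u ^ 2) ≤ a * ζ / X * (1 + (X / ζ) ^ 2 / 2 * y) := by
  have ha := H.a_pos; have hX := H.X_pos; have hζ := H.ζ_pos
  have e : r ^ 2 - u ^ 2 = (a * ζ / X) ^ 2 * (1 + (X / ζ) ^ 2 * y) := by
    rw [H.r_sq, H.b_add_h, hy]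
    field_simp
    ring
  constructor
  · apply Real.le_sqrt_of_sq_le
    rw [e]
    exact le_mul_of_one_le_right (by positivity) (le_add_of_nonneg_right (by positivity))
  · rw [e, Real.sqrt_le_left (by positivity), mul_pow]
    gcongr
    nlinarith [sq_nonneg ((X / ζ) ^ 2 / 2 * y)]

theorem IsContactArc.arcHeight_le (H : IsContactArc a b h r σ X ζ) {u y : ℝ}
    (hy : y = 1 - (u / a) ^ 2) (hy0 : 0 ≤ y) :
    arcHeight h r u ≤ b * (1 + a * X / (2 * b * ζ) * y) := by
  have ha := H.a_pos; have hb := H.b_pos; have hX := H.X_pos; have hζ := H.ζ_pos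
  have h1 := (H.sqrt_bounds hy hy0).2
  have h2 := H.b_add_h
  rw [arcHeight]
  have e : a * ζ / X * (1 + (X / ζ) ^ 2 / 2 * y) - h = b * (1 + a * X / (2 * b * ζ) * y) := by
    rw [eq_sub_of_add_eq' h2]
    field_simp
    ring
  linarith

/-- Substitution `u = a t` after the arc has been replaced by a parabola above it. -/
theorem IsContactArc.arcMoment_le (H : IsContactArc a b h r σ X ζ) (k l : ℕ) :
    arcMoment k l a h r ≤ a ^ (k + 1) * b ^ l * capIntegral k l (a * X / (2 * b * ζ)) ∧
    ∫ u in (0 : ℝ)..a, u ^ k * arcHeight h r u ^ l * (1 - (u / a) ^ 2) ≤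
      a ^ (k + 1) * b ^ l * capMoment k l (a * X / (2 * b * ζ)) := by
  have ha := H.a_pos; have hb := H.b_pos
  have hcf := continuous_arcHeight h r
  have hpt (t : ℝ) (ht : t ∈ Icc (0 : ℝ) 1) : 0 ≤ arcHeight h r (a * t) ∧ arcHeight h r (a * t) ≤
      b * (1 + a * X / (2 * b * ζ) * (1 - t ^ 2)) := by
    have h0 : 0 ≤ a * t := mul_nonneg ha.le ht.1
    have h1 : a * t ≤ a := mul_le_of_le_one_right ha.le ht.2
    refine ⟨le_trans (by positivity) (H.le_arcHeight h0 h1), ?_⟩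
    refine H.arcHeight_le ?_ (by nlinarith [ht.1, ht.2])
    rw [mul_div_cancel_left₀ _ ha.ne']
  constructor
  · have e := intervalIntegral.mul_integral_comp_mul_left (a := 0) (b := 1)
      (f := fun u => u ^ k * arcHeight h r u ^ l) a
    rw [mul_zero, mul_one] at e
    rw [arcMoment, ← e, capIntegral, ← intervalIntegral.integral_const_mul,
      ← intervalIntegral.integral_const_mul]
    refine intervalIntegral.integral_mono_on zero_le_one
      (Continuous.intervalIntegrable (by fun_prop) _ _)
      (Continuous.intervalIntegrable (by fun_prop) _ _) fun t ht => ?_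
    obtain ⟨h1, h2⟩ := hpt t ht
    have ht0 := ht.1
    have h3 := pow_le_pow_left₀ h1 h2 l
    rw [mul_pow b] at h3
    calc a * ((a * t) ^ k * arcHeight h r (a * t) ^ l)
        ≤ a * ((a * t) ^ k * (b ^ l * (1 + a * X / (2 * b * ζ) * (1 - t ^ 2)) ^ l)) := by gcongr
      _ = _ := by ring
  · have e := intervalIntegral.mul_integral_comp_mul_left (a := 0) (b := 1)
      (f := fun u => u ^ k * arcHeight h r u ^ l * (1 - (u / a) ^ 2)) a
    rw [mul_zero, mul_one] at e
    rw [← e, capMoment, ← intervalIntegral.integral_const_mul,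
      ← intervalIntegral.integral_const_mul]
    refine intervalIntegral.integral_mono_on zero_le_one
      (Continuous.intervalIntegrable (by fun_prop) _ _)
      (Continuous.intervalIntegrable (by fun_prop) _ _) fun t ht => ?_
    obtain ⟨h1, h2⟩ := hpt t ht
    have ht0 := ht.1
    have hy : 0 ≤ 1 - t ^ 2 := by nlinarith [ht.1, ht.2]
    have h3 := pow_le_pow_left₀ h1 h2 l
    rw [mul_pow b] at h3
    rw [mul_div_cancel_left₀ _ ha.ne']
    calc a * ((a * t) ^ k * arcHeight h r (a * t) ^ l * (1 - t ^ 2))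
        ≤ a * ((a * t) ^ k * (b ^ l * (1 + a * X / (2 * b * ζ) * (1 - t ^ 2)) ^ l) *
          (1 - t ^ 2)) := by gcongr
      _ = _ := by ring

theorem IsContactArc.arcArea_bounds (H : IsContactArc a b h r σ X ζ) (k l : ℕ) :
    2 * σ / ζ * (arcMoment k l a h r - (X / ζ) ^ 2 / 2 *
      ∫ u in (0 : ℝ)..a, u ^ k * arcHeight h r u ^ l * (1 - (u / a) ^ 2)) ≤ arcArea k l a h r ∧
    arcArea k l a h r ≤ 2 * σ / ζ * arcMoment k l a h r := by
  have ha := H.a_pos; have hb := H.b_pos; have hX := H.X_pos; have hζ := H.ζ_pos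
  have hσ := H.σ_pos
  have hcf := continuous_arcHeight h r
  have hI1 : IntervalIntegrable (fun u => u ^ k * arcHeight h r u ^ l *
      (r / Real.sqrt (r ^ 2 - u ^ 2))) volume 0 a :=
    ((IsArc.continuousOn_arcIntegrand h r k l).mono fun u hu => by
      rw [uIcc_of_le ha.le] at hu
      exact ⟨by linarith [hu.1, H.r_pos], by linarith [hu.2, H.lt_r]⟩).intervalIntegrable
  have hpt (u : ℝ) (hu : u ∈ Icc 0 a) : 0 ≤ u ^ k * arcHeight h r u ^ l ∧
      2 * σ / ζ * (1 - (X / ζ) ^ 2 / 2 * (1 - (u / a) ^ 2)) ≤ r / Real.sqrt (r ^ 2 - u ^ 2) ∧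
      r / Real.sqrt (r ^ 2 - u ^ 2) ≤ 2 * σ / ζ := by
    have hu0 := hu.1
    have hf : 0 ≤ arcHeight h r u := le_trans (by positivity) (H.le_arcHeight hu.1 hu.2)
    have hua : u / a ≤ 1 := (div_le_one ha).2 hu.2
    have hua0 : 0 ≤ u / a := by positivity
    have hy : 0 ≤ 1 - (u / a) ^ 2 := by nlinarith
    obtain ⟨h1, h2⟩ := H.sqrt_bounds (u := u) (y := 1 - (u / a) ^ 2) rfl hy
    have hc : 0 < a * ζ / X := by positivity
    have hs : 0 < Real.sqrt (r ^ 2 - u ^ 2) := hc.trans_le h1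
    refine ⟨by positivity, ?_, ?_⟩
    · rw [le_div_iff₀ hs, mul_assoc]
      refine le_trans (mul_le_mul_of_nonneg_left ?_ (by positivity)) H.r_eq'.symm.le
      set z := (X / ζ) ^ 2 / 2 * (1 - (u / a) ^ 2) with hz
      have hz0 : 0 ≤ z := by positivity
      rcases le_total z 1 with hz1 | hz1
      · calc (1 - z) * Real.sqrt (r ^ 2 - u ^ 2) ≤ (1 - z) * (a * ζ / X * (1 + z)) :=
              mul_le_mul_of_nonneg_left h2 (by linarith)
          _ = a * ζ / X * (1 - z ^ 2) := by ring
          _ ≤ a * ζ / X := mul_le_of_le_one_right hc.le (by nlinarith)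
      · exact (mul_nonpos_of_nonpos_of_nonneg (by linarith) hs.le).trans hc.le
    · rw [div_le_iff₀ hs]
      exact H.r_eq'.le.trans (mul_le_mul_of_nonneg_left h1 (by positivity))
  constructor
  · rw [arcMoment, arcArea, ← intervalIntegral.integral_const_mul,
      ← intervalIntegral.integral_sub (Continuous.intervalIntegrable (by fun_prop) _ _)
      (Continuous.intervalIntegrable (by fun_prop) _ _), ← intervalIntegral.integral_const_mul]
    refine intervalIntegral.integral_mono_on ha.le
      (Continuous.intervalIntegrable (by fun_prop) _ _) hI1 fun u hu => ?_
    obtain ⟨h1, h2, -⟩ := hpt u hu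
    have := mul_le_mul_of_nonneg_left h2 h1
    linarith
  · rw [arcMoment, arcArea, ← intervalIntegral.integral_const_mul]
    refine intervalIntegral.integral_mono_on ha.le hI1
      (Continuous.intervalIntegrable (by fun_prop) _ _) fun u hu => ?_
    obtain ⟨h1, -, h2⟩ := hpt u hu
    have := mul_le_mul_of_nonneg_left h2 h1
    linarith

set_option maxHeartbeats 800000 in
/-- The area bound and the volume bound for one half of the slice. The parameter `x` is the factor of
`√3 / (2σ)` in the multiplier of the volume. -/
theorem IsContactArc.estimates (H : IsContactArc a b h r σ X ζ) (k l : ℕ) {x α β μ : ℝ}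
    (hα : α = a * X / (2 * b * ζ)) (hβ : 0 < β) (hμ : 0 < μ)
    (hμe : μ = (k + 1) / 2 - α * (l + 1)) (hβe : β * (μ + 2) = α * ((k + 1) / 2 + (l + 1)))
    (h1 : 2 * β ≤ 1 + α) (h2 : α ≤ β * (2 - β)) (hx1 : x ≤ 1) (hx : X ≤ Real.sqrt 3 * a * x)
    (he : b * X / ζ ^ 2 * μ ≤ 1 / 2 * (β * (μ + 2))) :
    arcArea k l a h r - Real.sqrt 3 / (2 * σ) * x * ((k + l + 2) * arcVolume k l a b h r) ≤
      a ^ k * b ^ l * σ * (a / ζ / 2 * (1 / (μ + β)) *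
        (2 - 3 / 2 * x + b * X / ζ ^ 2 / (μ + 2))) ∧
    (k + l + 2) * arcVolume k l a b h r ≤
      a ^ k * b ^ l * σ ^ 2 * (Real.sqrt 3 / 2 * (a / ζ) * (1 / (μ + β))) := by
  have ha := H.a_pos; have hb := H.b_pos; have hX := H.X_pos; have hζ := H.ζ_pos
  have hσ := H.σ_pos; have hh := H.h_pos; have hr := H.r_pos
  have h3 : Real.sqrt 3 ^ 2 = 3 := Real.sq_sqrt (by norm_num)
  have h30 : 0 < Real.sqrt 3 := by positivity
  obtain ⟨hC, hCy⟩ := H.arcMoment_le k l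
  obtain ⟨hA1, hA2⟩ := H.arcArea_bounds k l
  rw [← hα] at hC hCy
  have hα0 : 0 ≤ α := by rw [hα]; positivity
  have hj := two_mul_capIntegral_le k l hα0 hβ.le hμ hμe hβe h1 h2
  have hid := capIntegral_identity k l α
  rw [← hμe, ← hβe] at hid
  rw [H.toIsArc.mul_arcVolume_eq k l]
  set A := arcArea k l a h r
  set C := arcMoment k l a h r
  set Cy := ∫ u in (0 : ℝ)..a, u ^ k * arcHeight h r u ^ l * (1 - (u / a) ^ 2)
  have hCy0 : 0 ≤ Cy := by
    refine intervalIntegral.integral_nonneg ha.le fun u hu => ?_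
    have hu0 := hu.1
    have hf : 0 ≤ arcHeight h r u := le_trans (by positivity) (H.le_arcHeight hu.1 hu.2)
    have hua : u / a ≤ 1 := (div_le_one ha).2 hu.2
    have hua0 : 0 ≤ u / a := by positivity
    have hy : 0 ≤ 1 - (u / a) ^ 2 := by nlinarith
    positivity
  set j := capIntegral k l α
  set y := capMoment k l α
  set J := 1 / (μ + β) with hJ
  set w := a ^ k * b ^ l with hw
  have hw0 : 0 < w := by positivity
  have hpow : a ^ (k + 1) * b ^ l = w * a := by rw [hw]; ring
  rw [hpow] at hC hCy
  clear_value A C Cy j y w J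
  have hXX : X = Real.sqrt 3 * a - b := H.X_eq
  have hζe := H.ζ_eq
  constructor
  · -- By `mul_arcVolume_eq` the left side is `-g A` plus a multiple of `C`. As `g ≥ 0`, the lower
    -- bound for the length integral `A` applies.
    set g := Real.sqrt 3 / (2 * σ) * x * r - 1 with hg
    have hgX : g * X = Real.sqrt 3 * a * x - X := by
      rw [hg, H.r_eq]
      field_simp
    have hg0 : 0 ≤ g := by
      refine nonneg_of_mul_nonneg_left (b := X) ?_ hX
      rw [hgX]
      linarith
    have hgb : g ≤ b / X := by
      rw [le_div_iff₀ hX, hgX]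
      nlinarith [mul_le_mul_of_nonneg_left hx1 (mul_pos h30 ha).le]
    have s1 : A - Real.sqrt 3 / (2 * σ) * x * (r * A - h * C) ≤
        σ / ζ * ((2 - 3 / 2 * x) * C + b * X / ζ ^ 2 * Cy) := by
      have e1 : A - Real.sqrt 3 / (2 * σ) * x * (r * A - h * C) =
          -(g * A) + Real.sqrt 3 / (2 * σ) * x * h * C := by rw [hg]; ring
      have e2 : Real.sqrt 3 / (2 * σ) * x * h = σ / ζ * (2 - 3 / 2 * x) + g * (2 * σ / ζ) := by
        have hgX' : g = (Real.sqrt 3 * a * x - X) / X := by rw [eq_div_iff hX.ne', hgX]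
        rw [hgX', H.h_eq]
        field_simp
        rw [hζe, hXX]
        linear_combination (x * b) * h3
      have e3 : g * (2 * σ / ζ * (C - (X / ζ) ^ 2 / 2 * Cy)) ≤ g * A :=
        mul_le_mul_of_nonneg_left hA1 hg0
      have e4 : σ / ζ * (g * (X / ζ) ^ 2) * Cy ≤ σ / ζ * (b / X * (X / ζ) ^ 2) * Cy := by gcongr
      have e5 : b / X * (X / ζ) ^ 2 = b * X / ζ ^ 2 := by field_simp
      have e6 : 2 * σ / ζ = 2 * (σ / ζ) := mul_div_assoc _ _ _
      rw [e5] at e4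
      rw [e6] at e2 e3
      rw [e1, e2]
      clear_value g
      generalize σ / ζ = p at *
      generalize (X / ζ) ^ 2 = q at *
      generalize b * X / ζ ^ 2 = e at *
      have e7 : g * (2 * p * (C - q / 2 * Cy)) = 2 * g * p * C - p * (g * q) * Cy := by ring
      rw [e7] at e3
      calc -(g * A) + (p * (2 - 3 / 2 * x) + g * (2 * p)) * C
          = p * ((2 - 3 / 2 * x) * C) + (2 * g * p * C - g * A) := by ring
        _ ≤ p * ((2 - 3 / 2 * x) * C) + p * e * Cy :=
          add_le_add le_rfl (by linarith only [e3, e4])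
        _ = _ := by ring
    have s2 : (2 - 3 / 2 * x) * C + b * X / ζ ^ 2 * Cy ≤
        w * a * ((2 - 3 / 2 * x) * j + b * X / ζ ^ 2 * y) := by
      have t1 : (2 - 3 / 2 * x) * C ≤ (2 - 3 / 2 * x) * (w * a * j) :=
        mul_le_mul_of_nonneg_left hC (by linarith)
      have t2 : b * X / ζ ^ 2 * Cy ≤ b * X / ζ ^ 2 * (w * a * y) := by gcongr
      linarith
    have s3 : (2 - 3 / 2 * x) * j + b * X / ζ ^ 2 * y ≤
        1 / 2 * J * (2 - 3 / 2 * x + b * X / ζ ^ 2 / (μ + 2)) := by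
      generalize b * X / ζ ^ 2 = e at *
      -- Eliminating `y` by `capIntegral_identity` leaves a nonnegative coefficient at `j`.
      have hν : 0 < β * (μ + 2) := by positivity
      have ey : y = (1 / 2 - μ * j) / (β * (μ + 2)) := by
        rw [eq_div_iff hν.ne']
        linarith
      have hco : 0 ≤ 2 - 3 / 2 * x - e * μ / (β * (μ + 2)) := by
        have : e * μ / (β * (μ + 2)) ≤ 1 / 2 := by rwa [div_le_iff₀ hν]
        linarith
      have t1 := mul_le_mul_of_nonneg_left hj hco
      have t2 : (2 - 3 / 2 * x) * j + e * y =
          1 / 2 * ((2 - 3 / 2 * x - e * μ / (β * (μ + 2))) * (2 * j)) +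
            e / (2 * (β * (μ + 2))) := by
        rw [ey]
        field_simp
        ring
      have t3 : 1 / 2 * J * (2 - 3 / 2 * x + e / (μ + 2)) =
          1 / 2 * ((2 - 3 / 2 * x - e * μ / (β * (μ + 2))) * J) + e / (2 * (β * (μ + 2))) := by
        rw [hJ]
        field_simp
        ring
      rw [t2, t3]
      linarith
    calc _ ≤ σ / ζ * ((2 - 3 / 2 * x) * C + b * X / ζ ^ 2 * Cy) := s1
      _ ≤ σ / ζ * (w * a * (1 / 2 * J * (2 - 3 / 2 * x + b * X / ζ ^ 2 / (μ + 2)))) := by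
          gcongr
          exact s2.trans (by gcongr)
      _ = _ := by ring
  · have s1 : r * A - h * C ≤ Real.sqrt 3 * σ ^ 2 / ζ * C := by
      have e1 : r * A ≤ r * (2 * σ / ζ * C) := by gcongr
      have e2 : r * (2 * σ / ζ) - h = Real.sqrt 3 * σ ^ 2 / ζ := by
        rw [H.r_eq, H.h_eq]
        field_simp
        rw [hζe, hXX]
        linear_combination (-a) * h3
      have e3 : r * (2 * σ / ζ * C) - h * C = (r * (2 * σ / ζ) - h) * C := by ring
      rw [e2] at e3
      linarith
    have s2 : C ≤ w * a * (1 / 2 * J) := by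
      refine hC.trans ?_
      gcongr
      linarith
    calc r * A - h * C ≤ Real.sqrt 3 * σ ^ 2 / ζ * C := s1
      _ ≤ Real.sqrt 3 * σ ^ 2 / ζ * (w * a * (1 / 2 * J)) := by gcongr
      _ = _ := by ring

end ContactArc

variable {k l : ℕ}

theorem isContactArc_fst (H : IsWideSlope (slope k l)) :
    IsContactArc (slope k l) 1 (arcH k l) (arcR k l) (Real.sqrt (1 + slope k l ^ 2))
      (Real.sqrt 3 * slope k l - 1) (Real.sqrt 3 + slope k l) where
  toIsArc := isArc_fst H
  σ_pos := by positivity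
  σ_sq := by rw [Real.sq_sqrt (by positivity)]; ring
  X_pos := sub_pos.2 H.one_lt
  X_eq := rfl
  ζ_eq := by ring
  h_eq := by rw [Real.sq_sqrt (by positivity), arcH_eq H]
  r_eq := arcR_eq H

theorem isContactArc_snd (H : IsWideSlope (slope k l)) :
    IsContactArc 1 (slope k l) (arcD k l) (arcRho k l) (Real.sqrt (1 + slope k l ^ 2))
      (Real.sqrt 3 - slope k l) (Real.sqrt 3 * slope k l + 1) where
  toIsArc := isArc_snd H
  σ_pos := by positivity
  σ_sq := by rw [Real.sq_sqrt (by positivity)]; ring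
  X_pos := sub_pos.2 H.lt_sqrt
  X_eq := by ring
  ζ_eq := rfl
  h_eq := by rw [Real.sq_sqrt (by positivity), arcD_eq H]
  r_eq := by rw [arcRho_eq H]; ring

end LensLawson

namespace LensLawson

open Filter Topology

/-! ### The one-variable inequality for nearly equal dimensions -/

/-- The numerator of the slack in `IsBalanced.sum_bound`, after the dimension has been eliminated
in favour of `w` and of the difference `c` of the two dimensions. -/
noncomputable def slackPoly (c w : ℝ) : ℝ :=
  let v := w ^ 2 - 3
  let n1 := 2 * v + c * (w ^ 2 + 3)
  let n2 := 4 * v + c * (w ^ 2 + 3)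
  let d := n1 * w + v * (5 * w ^ 2 + 4 * w - 3)
  let G := (2 * w - v) * (3 * n1 + c * v)
  2 * w * n2 * (v * n1 - w * n1 + 2 * v * w) * d + w ^ 2 * n1 * n2 * G -
    8 * w ^ 3 * n1 * n2 * (n1 - v) * (27 / 50 - 31 / 200 * w) -
    3 / 5 * (2 * n1 * v * (n1 * w + v ^ 2) * d + v ^ 2 * w * n1 * G)

/-- The sign of `slackPoly` on an interval `[p, q]` follows from its expansion in the products
`(w - p)^i (q - w)^j`, whose coefficients are all positive. The same holds for the other values
of `c` below. -/
theorem slackPoly_one {w : ℝ} (h1 : 17 / 10 ≤ w) (h2 : w ≤ 5 / 2) :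
    0 ≤ slackPoly 1 w := by
  have key : slackPoly 1 w =
        951630609585583 / 34359738368 * (w - 17 / 10) ^ 0 * (5 / 2 - w) ^ 12 +
        3360369003639053 / 8589934592 * (w - 17 / 10) ^ 1 * (5 / 2 - w) ^ 11 +
        40483374577851215 / 17179869184 * (w - 17 / 10) ^ 2 * (5 / 2 - w) ^ 10 +
        68346053169569625 / 8589934592 * (w - 17 / 10) ^ 3 * (5 / 2 - w) ^ 9 +
        573044461618521825 / 34359738368 * (w - 17 / 10) ^ 4 * (5 / 2 - w) ^ 8 +
        99900749353102125 / 4294967296 * (w - 17 / 10) ^ 5 * (5 / 2 - w) ^ 7 +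
        214620336026195625 / 8589934592 * (w - 17 / 10) ^ 6 * (5 / 2 - w) ^ 6 +
        120645333717478125 / 4294967296 * (w - 17 / 10) ^ 7 * (5 / 2 - w) ^ 5 +
        1216435477610390625 / 34359738368 * (w - 17 / 10) ^ 8 * (5 / 2 - w) ^ 4 +
        311267759472265625 / 8589934592 * (w - 17 / 10) ^ 9 * (5 / 2 - w) ^ 3 +
        411901882818359375 / 17179869184 * (w - 17 / 10) ^ 10 * (5 / 2 - w) ^ 2 +
        76471431142578125 / 8589934592 * (w - 17 / 10) ^ 11 * (5 / 2 - w) ^ 1 +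
        48467068505859375 / 34359738368 * (w - 17 / 10) ^ 12 * (5 / 2 - w) ^ 0 := by
    unfold slackPoly
    ring
  rw [key]
  have h1 := sub_nonneg.2 h1
  have h2 := sub_nonneg.2 h2
  generalize w - 17 / 10 = y at h1 ⊢
  generalize 5 / 2 - w = z at h2 ⊢
  positivity

theorem slackPoly_two {w : ℝ} (h1 : 17 / 10 ≤ w) (h2 : w ≤ 5 / 2) :
    0 ≤ slackPoly 2 w := by
  have key : slackPoly 2 w =
        1902717355532463 / 8589934592 * (w - 17 / 10) ^ 0 * (5 / 2 - w) ^ 12 +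
        6658240734962985 / 2147483648 * (w - 17 / 10) ^ 1 * (5 / 2 - w) ^ 11 +
        82738402743595767 / 4294967296 * (w - 17 / 10) ^ 2 * (5 / 2 - w) ^ 10 +
        150183969463632285 / 2147483648 * (w - 17 / 10) ^ 3 * (5 / 2 - w) ^ 9 +
        1409398783310420625 / 8589934592 * (w - 17 / 10) ^ 4 * (5 / 2 - w) ^ 8 +
        278438911897085625 / 1073741824 * (w - 17 / 10) ^ 5 * (5 / 2 - w) ^ 7 +
        597909568945280625 / 2147483648 * (w - 17 / 10) ^ 6 * (5 / 2 - w) ^ 6 +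
        213764139917840625 / 1073741824 * (w - 17 / 10) ^ 7 * (5 / 2 - w) ^ 5 +
        770835055287890625 / 8589934592 * (w - 17 / 10) ^ 8 * (5 / 2 - w) ^ 4 +
        49480360526953125 / 2147483648 * (w - 17 / 10) ^ 9 * (5 / 2 - w) ^ 3 +
        14563056146484375 / 4294967296 * (w - 17 / 10) ^ 10 * (5 / 2 - w) ^ 2 +
        1928696337890625 / 2147483648 * (w - 17 / 10) ^ 11 * (5 / 2 - w) ^ 1 +
        2251527099609375 / 8589934592 * (w - 17 / 10) ^ 12 * (5 / 2 - w) ^ 0 := by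
    unfold slackPoly
    ring
  rw [key]
  have h1 := sub_nonneg.2 h1
  have h2 := sub_nonneg.2 h2
  generalize w - 17 / 10 = y at h1 ⊢
  generalize 5 / 2 - w = z at h2 ⊢
  positivity

theorem slackPoly_neg_one {w : ℝ} (h1 : 6 / 5 ≤ w) (h2 : w ≤ 7 / 4) :
    slackPoly (-1) w ≤ 0 := by
  have key : -slackPoly (-1) w =
        2005151369668853760 / 3138428376721 * (w - 6 / 5) ^ 0 * (7 / 4 - w) ^ 12 +
        28174819995905163264 / 3138428376721 * (w - 6 / 5) ^ 1 * (7 / 4 - w) ^ 11 +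
        16486939746663137280 / 285311670611 * (w - 6 / 5) ^ 2 * (7 / 4 - w) ^ 10 +
        63678507320357683200 / 285311670611 * (w - 6 / 5) ^ 3 * (7 / 4 - w) ^ 9 +
        163661206236984115200 / 285311670611 * (w - 6 / 5) ^ 4 * (7 / 4 - w) ^ 8 +
        294702562581221376000 / 285311670611 * (w - 6 / 5) ^ 5 * (7 / 4 - w) ^ 7 +
        382083678037785600000 / 285311670611 * (w - 6 / 5) ^ 6 * (7 / 4 - w) ^ 6 +
        360973985157600000000 / 285311670611 * (w - 6 / 5) ^ 7 * (7 / 4 - w) ^ 5 +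
        248149887982680000000 / 285311670611 * (w - 6 / 5) ^ 8 * (7 / 4 - w) ^ 4 +
        121888268654280000000 / 285311670611 * (w - 6 / 5) ^ 9 * (7 / 4 - w) ^ 3 +
        40847498894775000000 / 285311670611 * (w - 6 / 5) ^ 10 * (7 / 4 - w) ^ 2 +
        92499905615625000000 / 3138428376721 * (w - 6 / 5) ^ 11 * (7 / 4 - w) ^ 1 +
        8824834032714843750 / 3138428376721 * (w - 6 / 5) ^ 12 * (7 / 4 - w) ^ 0 := by
    unfold slackPoly
    ring
  rw [← neg_nonneg, key]
  have h1 := sub_nonneg.2 h1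
  have h2 := sub_nonneg.2 h2
  generalize w - 6 / 5 = y at h1 ⊢
  generalize 7 / 4 - w = z at h2 ⊢
  positivity

theorem slackPoly_neg_two {w : ℝ} (h1 : 6 / 5 ≤ w) (h2 : w ≤ 7 / 4) :
    slackPoly (-2) w ≤ 0 := by
  have key : -slackPoly (-2) w =
        1792972762487193600 / 285311670611 * (w - 6 / 5) ^ 0 * (7 / 4 - w) ^ 12 +
        23670910498111488000 / 285311670611 * (w - 6 / 5) ^ 1 * (7 / 4 - w) ^ 11 +
        13066327400487321600 / 25937424601 * (w - 6 / 5) ^ 2 * (7 / 4 - w) ^ 10 +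
        48175045692987801600 / 25937424601 * (w - 6 / 5) ^ 3 * (7 / 4 - w) ^ 9 +
        119988456577656422400 / 25937424601 * (w - 6 / 5) ^ 4 * (7 / 4 - w) ^ 8 +
        212568749933985792000 / 25937424601 * (w - 6 / 5) ^ 5 * (7 / 4 - w) ^ 7 +
        274659017938698240000 / 25937424601 * (w - 6 / 5) ^ 6 * (7 / 4 - w) ^ 6 +
        260936826626304000000 / 25937424601 * (w - 6 / 5) ^ 7 * (7 / 4 - w) ^ 5 +
        181082488062336000000 / 25937424601 * (w - 6 / 5) ^ 8 * (7 / 4 - w) ^ 4 +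
        89640424721080000000 / 25937424601 * (w - 6 / 5) ^ 9 * (7 / 4 - w) ^ 3 +
        30089925649100000000 / 25937424601 * (w - 6 / 5) ^ 10 * (7 / 4 - w) ^ 2 +
        67736124770000000000 / 285311670611 * (w - 6 / 5) ^ 11 * (7 / 4 - w) ^ 1 +
        6397207312500000000 / 285311670611 * (w - 6 / 5) ^ 12 * (7 / 4 - w) ^ 0 := by
    unfold slackPoly
    ring
  rw [← neg_nonneg, key]
  have h1 := sub_nonneg.2 h1
  have h2 := sub_nonneg.2 h2
  generalize w - 6 / 5 = y at h1 ⊢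
  generalize 7 / 4 - w = z at h2 ⊢
  positivity


/-- Two dimensions `k` and `l` that differ by at most two, with `w = √(3 l / k)`. For an arc that
ends at `(a, b)` with `a / b = √(k / l)`, this is `w = √3 b / a`. -/
structure IsBalanced (k l w : ℝ) : Prop where
  one_le_fst : 1 ≤ k
  one_le_snd : 1 ≤ l
  fst_le : k ≤ 2 * l
  snd_le : l ≤ 2 * k
  w_pos : 0 < w
  w_sq : k * w ^ 2 = 3 * l
  sub_mem : l - k = 0 ∨ l - k = 1 ∨ l - k = 2 ∨ l - k = -1 ∨ l - k = -2

namespace IsBalanced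

variable {k l w : ℝ}

theorem le_w (H : IsBalanced k l w) : 6 / 5 ≤ w := by
  have h1 := H.one_le_fst; have h2 := H.fst_le; have h3 := H.w_sq; have h4 := H.w_pos
  by_contra! h
  have : w ^ 2 < 36 / 25 := by nlinarith
  nlinarith

theorem w_le (H : IsBalanced k l w) : w ≤ 5 / 2 := by
  have h1 := H.one_le_fst; have h2 := H.snd_le; have h3 := H.w_sq; have h4 := H.w_pos
  by_contra! h
  have : 25 / 4 < w ^ 2 := by nlinarith
  nlinarith

theorem abs_sub_le (H : IsBalanced k l w) : |l - k| ≤ 2 := by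
  rcases H.sub_mem with h | h | h | h | h <;> rw [h] <;> norm_num

theorem le_add (H : IsBalanced k l w) : 4 ≤ k + l + 2 := by
  linarith [H.one_le_fst, H.one_le_snd]

theorem mul_eq (H : IsBalanced k l w) :
    (k + l + 2) * (w ^ 2 - 3) = 2 * (w ^ 2 - 3) + (l - k) * (w ^ 2 + 3) := by
  linear_combination 2 * H.w_sq

theorem le_t (H : IsBalanced k l w) : -(13 / 10) ≤ w - 3 / w := by
  have h := H.le_w
  have : 3 / w ≤ 5 / 2 := by
    rw [div_le_iff₀ H.w_pos]; linarith
  linarith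

theorem t_le (H : IsBalanced k l w) : w - 3 / w ≤ 13 / 10 := by
  have h := H.w_le
  have : 6 / 5 ≤ 3 / w := by
    rw [le_div_iff₀ H.w_pos]; linarith
  linarith

/-- The inequality `IsBalanced.sum_bound` with denominators cleared, after the coefficient
`w (3 - w) / (3 (w + 1))` has been replaced by an upper bound linear in `w`. -/
theorem slack_nonneg (H : IsBalanced k l w) :
    0 ≤ (w - 3 / w - 1 + 2 / (k + l + 2)) * (k + l + 2 + 4 + (w - 3 / w) + 4 * w) +
      (2 - (w - 3 / w)) * (k + l + 2 + l + 1) -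
      4 * (k + l + 2 - 1) * (27 / 50 - 31 / 200 * w) -
      3 / 5 * (w - 3 / w) / (k + l + 2 + 2) *
        ((k + l + 2 + (w - 3 / w)) * (k + l + 2 + 4 + (w - 3 / w) + 4 * w) +
          (2 - (w - 3 / w)) * (k + l + 2 + l + 1)) := by
  have hn := H.le_add
  have he := H.mul_eq
  have hw := H.w_pos
  have hk := H.one_le_fst
  obtain ⟨c, hc⟩ : ∃ c, c = l - k := ⟨_, rfl⟩
  have hl : k + l + 2 + l + 1 = (3 * (k + l + 2) + c) / 2 := by rw [hc]; ring
  have hsub := H.sub_mem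
  have hvk : k * (w ^ 2 - 3) = 3 * c := by rw [hc]; linear_combination H.w_sq
  have hw1 := H.le_w
  have hw2 := H.w_le
  rw [hl]
  rw [← hc] at he hsub
  generalize hnn : k + l + 2 = n at *
  by_cases hc0 : c = 0
  · have hv : w ^ 2 = 3 := by
      have : k * (w ^ 2 - 3) = 0 := by rw [hvk, hc0]; ring
      rcases mul_eq_zero.1 this with h | h <;> linarith
    have ht : w - 3 / w = 0 := by
      rw [← hv]; field_simp; ring
    have hw3 : 433 / 250 ≤ w := by
      by_contra! h
      nlinarith
    rw [ht, hc0]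
    have e : (0 - 1 + 2 / n) * (n + 4 + 0 + 4 * w) = -(n + 4 + 4 * w) + 2 + 8 * (w + 1) / n := by
      field_simp
      ring
    -- `2 / 5 - n / 25` is the tangent of `1 / n` at `n = 5`.
    have e2 : 8 * (w + 1) * (2 / 5 - n / 25) ≤ 8 * (w + 1) / n := by
      rw [div_eq_mul_one_div (8 * (w + 1))]
      have : 2 / 5 - n / 25 ≤ 1 / n := by
        rw [le_div_iff₀ (by linarith)]
        nlinarith [sq_nonneg (n - 5)]
      gcongr
    have hw4 : w ≤ 87 / 50 := by nlinarith
    rw [e, mul_zero, zero_div, zero_mul]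
    have : 0 ≤ (n - 4) * (w - 433 / 250) := by nlinarith
    nlinarith
  · have hv0 : w ^ 2 - 3 ≠ 0 := by
      intro h
      rw [h] at hvk
      apply hc0
      linarith
    have e : n = (2 * (w ^ 2 - 3) + c * (w ^ 2 + 3)) / (w ^ 2 - 3) := by
      rw [eq_div_iff hv0, he]
    -- For `c ≠ 0` the dimension `n` is a rational function of `w` and `c`.
    have key : ∀ n1 n2 : ℝ, n1 = n * (w ^ 2 - 3) → n2 = (n + 2) * (w ^ 2 - 3) →
        n1 = 2 * (w ^ 2 - 3) + c * (w ^ 2 + 3) → n2 = 4 * (w ^ 2 - 3) + c * (w ^ 2 + 3) →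
        (w - 3 / w - 1 + 2 / n) * (n + 4 + (w - 3 / w) + 4 * w) +
          (2 - (w - 3 / w)) * ((3 * n + c) / 2) - 4 * (n - 1) * (27 / 50 - 31 / 200 * w) -
          3 / 5 * (w - 3 / w) / (n + 2) *
            ((n + (w - 3 / w)) * (n + 4 + (w - 3 / w) + 4 * w) +
              (2 - (w - 3 / w)) * ((3 * n + c) / 2)) =
          slackPoly c w / (2 * w ^ 3 * (n * (n + 2)) * (w ^ 2 - 3) ^ 3) := by
      intro n1 n2 h1 h2 h3 h4
      unfold slackPoly
      simp only
      rw [← h3, ← h4, h1, h2]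
      have : n + 2 ≠ 0 := by linarith
      have : n ≠ 0 := by linarith
      field_simp
      ring
    rw [key _ _ rfl rfl he (by linear_combination he)]
    have hpos : 0 < 2 * w ^ 3 * (n * (n + 2)) := by positivity
    have hup : 0 < c → 17 / 10 ≤ w := by
      intro h
      have : 0 < w ^ 2 - 3 := by
        by_contra! h'
        nlinarith
      nlinarith
    have hdown : c < 0 → w ≤ 7 / 4 := by
      intro h
      have : w ^ 2 - 3 < 0 := by
        by_contra! h'
        nlinarith
      nlinarith
    have hvpos : 0 < c → 0 < (w ^ 2 - 3) ^ 3 := by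
      intro h
      have : 0 < w ^ 2 - 3 := by
        by_contra! h'
        nlinarith
      positivity
    have hvneg : c < 0 → (w ^ 2 - 3) ^ 3 < 0 := by
      intro h
      have : w ^ 2 - 3 < 0 := by
        by_contra! h'
        nlinarith
      exact Odd.pow_neg (by decide) this
    rcases hsub with h | h | h | h | h
    · exact absurd h hc0
    · have hc : 0 < c := by rw [h]; norm_num
      rw [h]
      exact div_nonneg (slackPoly_one (hup hc) hw2) (mul_pos hpos (hvpos hc)).le
    · have hc : 0 < c := by rw [h]; norm_num
      rw [h]
      exact div_nonneg (slackPoly_two (hup hc) hw2) (mul_pos hpos (hvpos hc)).le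
    · have hc : c < 0 := by rw [h]; norm_num
      rw [h]
      exact div_nonneg_of_nonpos (slackPoly_neg_one hw1 (hdown hc))
        (mul_neg_of_pos_of_neg hpos (hvneg hc)).le
    · have hc : c < 0 := by rw [h]; norm_num
      rw [h]
      exact div_nonneg_of_nonpos (slackPoly_neg_two hw1 (hdown hc))
        (mul_neg_of_pos_of_neg hpos (hvneg hc)).le

end IsBalanced

end LensLawson

namespace LensLawson

open Filter Topology

/-! ### Parameters of one arc for nearly equal dimensions -/

namespace IsBalanced

variable {k l w α β μ : ℝ}

theorem μ_eq (H : IsBalanced k l w) (hα : α = (3 - w) / (2 * w * (w + 1)))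
    (hμ : μ = (k + 1) / 2 - α * (l + 1)) :
    μ = (k + l + 2 + (w - 3 / w)) / (2 * (w + 1)) := by
  have hw := H.w_pos
  rw [hμ, hα]
  field_simp
  linear_combination H.w_sq

theorem μ_pos (H : IsBalanced k l w) (hα : α = (3 - w) / (2 * w * (w + 1)))
    (hμ : μ = (k + 1) / 2 - α * (l + 1)) : 0 < μ := by
  have hw := H.w_pos
  have := H.le_t
  have := H.le_add
  rw [H.μ_eq hα hμ]
  apply div_pos <;> linarith

theorem μ_add_two (H : IsBalanced k l w) (hα : α = (3 - w) / (2 * w * (w + 1)))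
    (hμ : μ = (k + 1) / 2 - α * (l + 1)) :
    μ + 2 = (k + l + 2 + 4 + (w - 3 / w) + 4 * w) / (2 * (w + 1)) := by
  have hw := H.w_pos
  rw [H.μ_eq hα hμ]
  field_simp
  ring

theorem denom_pos (H : IsBalanced k l w) : 0 < k + l + 2 + 4 + (w - 3 / w) + 4 * w := by
  linarith [H.w_pos, H.le_t, H.le_add]

theorem β_eq (H : IsBalanced k l w) (hα : α = (3 - w) / (2 * w * (w + 1)))
    (hμ : μ = (k + 1) / 2 - α * (l + 1)) (hβ : β * (μ + 2) = α * ((k + 1) / 2 + (l + 1))) :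
    β = (3 - w) * (k + l + 2 + l + 1) / (2 * w * (k + l + 2 + 4 + (w - 3 / w) + 4 * w)) := by
  have hw := H.w_pos
  have hD := H.denom_pos
  rw [H.μ_add_two hα hμ, hα] at hβ
  generalize k + l + 2 + 4 + (w - 3 / w) + 4 * w = D at *
  field_simp at hβ ⊢
  linear_combination hβ

theorem β_pos (H : IsBalanced k l w) (hα : α = (3 - w) / (2 * w * (w + 1)))
    (hμ : μ = (k + 1) / 2 - α * (l + 1)) (hβ : β * (μ + 2) = α * ((k + 1) / 2 + (l + 1))) :
    0 < β := by
  rw [H.β_eq hα hμ hβ]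
  have hw := H.w_pos
  have := H.w_le
  have := H.one_le_fst
  have := H.one_le_snd
  have := H.denom_pos
  apply div_pos
  · apply mul_pos <;> linarith
  · positivity

theorem two_mul_β_le (H : IsBalanced k l w) (hα : α = (3 - w) / (2 * w * (w + 1)))
    (hμ : μ = (k + 1) / 2 - α * (l + 1)) (hβ : β * (μ + 2) = α * ((k + 1) / 2 + (l + 1))) :
    2 * β ≤ 1 + α := by
  have hw := H.w_pos
  have hw1 := H.le_w
  have hw2 := H.w_le
  have hn := H.le_add
  have he := H.mul_eq
  have ht := H.le_t
  have hk := H.one_le_fst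
  have hkw := H.w_sq
  have hc := abs_le.1 H.abs_sub_le
  have hD := H.denom_pos
  rw [H.β_eq hα hμ hβ, hα]
  have key : (w + 1) * (3 - w) * (3 * (k + l + 2) + (l - k)) ≤
      (k + l + 2 + 4 + (w - 3 / w) + 4 * w) * (2 * w ^ 2 + w + 3) := by
    have hE : (15 / 2) * (708 / 100) ≤ (4 + (w - 3 / w) + 4 * w) * (2 * w ^ 2 + w + 3) :=
      mul_le_mul (by linarith) (by nlinarith) (by norm_num) (by linarith)
    obtain ⟨c, hc'⟩ : ∃ c, c = l - k := ⟨_, rfl⟩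
    have hvk : k * (w ^ 2 - 3) = 3 * c := by rw [hc']; linear_combination H.w_sq
    rw [← hc'] at he hc ⊢
    generalize w - 3 / w = T at *
    generalize k + l + 2 = n at *
    rcases le_or_gt 0 c with h | h
    · have h3 : 0 ≤ w ^ 2 - 3 := by
        by_contra! h'
        nlinarith
      have hw3 : 173 / 100 ≤ w := by nlinarith
      have h4 : 0 ≤ (5 * w ^ 2 - 5 * w - 6) * n := by
        apply mul_nonneg <;> nlinarith
      have h5 : c * ((w + 1) * (3 - w)) ≤ 2 * (35 / 10) := by
        apply mul_le_mul <;> nlinarith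
      nlinarith
    · have h5 : n * (3 - w ^ 2) ≤ 12 := by nlinarith
      have h6 : 0 ≤ (5 * w ^ 2 - 5 * w - 6 + 7 / 2 * (3 - w ^ 2)) * n := by
        apply mul_nonneg <;> nlinarith [sq_nonneg (w - 5 / 3)]
      have h7 : c * ((w + 1) * (3 - w)) ≤ 0 := by
        apply mul_nonpos_of_nonpos_of_nonneg h.le
        apply mul_nonneg <;> linarith
      nlinarith
  rw [show k + l + 2 + l + 1 = (3 * (k + l + 2) + (l - k)) / 2 by ring]
  have e : 1 + (3 - w) / (2 * w * (w + 1)) = (2 * w ^ 2 + w + 3) / (2 * w * (w + 1)) := by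
    field_simp
    ring
  rw [e]
  generalize k + l + 2 + 4 + (w - 3 / w) + 4 * w = D at *
  have e2 : 2 * ((3 - w) * ((3 * (k + l + 2) + (l - k)) / 2) / (2 * w * D)) =
      (w + 1) * (3 - w) * (3 * (k + l + 2) + (l - k)) / (2 * w * (w + 1) * D) := by
    field_simp
  rw [e2, div_le_div_iff₀ (by positivity) (by positivity)]
  have : 0 ≤ 2 * w * (w + 1) := by positivity
  nlinarith

theorem α_le (H : IsBalanced k l w) (hα : α = (3 - w) / (2 * w * (w + 1)))
    (hμ : μ = (k + 1) / 2 - α * (l + 1)) (hβ : β * (μ + 2) = α * ((k + 1) / 2 + (l + 1))) :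
    α ≤ β * (2 - β) := by
  have hw := H.w_pos
  have hw1 := H.le_w
  have hw2 := H.w_le
  have hn := H.le_add
  have hc := abs_le.1 H.abs_sub_le
  have hD := H.denom_pos
  have h2 := H.two_mul_β_le hα hμ hβ
  have h3 : α ≤ 2 / 5 := by
    rw [hα, div_le_iff₀ (by positivity)]
    nlinarith
  have hβ0 := H.β_pos hα hμ hβ
  have h4 : α ≤ 13 / 10 * β := by
    rw [H.β_eq hα hμ hβ, hα]
    have key : k + l + 2 + 4 + (w - 3 / w) + 4 * w ≤ 13 / 10 * (w + 1) * (k + l + 2 + l + 1) := by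
      have h5 : 6 / 5 ≤ 3 / w := by
        rw [le_div_iff₀ hw]
        linarith
      have h6 : 3 / 2 * (k + l + 2) - 1 ≤ k + l + 2 + l + 1 := by linarith
      have h7 : 13 / 10 * (w + 1) * (3 / 2 * (k + l + 2) - 1) ≤
          13 / 10 * (w + 1) * (k + l + 2 + l + 1) := by gcongr
      refine le_trans ?_ h7
      nlinarith
    generalize k + l + 2 + 4 + (w - 3 / w) + 4 * w = D at *
    have e : 13 / 10 * ((3 - w) * (k + l + 2 + l + 1) / (2 * w * D)) =
      (3 - w) * (13 / 10 * (w + 1) * (k + l + 2 + l + 1)) / (2 * w * (w + 1) * D) := by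
      field_simp
    have e2 : (3 - w) / (2 * w * (w + 1)) = (3 - w) * D / (2 * w * (w + 1) * D) := by
      field_simp
    rw [e, e2]
    gcongr
    linarith
  nlinarith

theorem mul_μ_le (H : IsBalanced k l w) (hα : α = (3 - w) / (2 * w * (w + 1)))
    (hμ : μ = (k + 1) / 2 - α * (l + 1)) (hβ : β * (μ + 2) = α * ((k + 1) / 2 + (l + 1))) :
    w * (3 - w) / (3 * (w + 1) ^ 2) * μ ≤ 1 / 2 * (β * (μ + 2)) := by
  have hw := H.w_pos
  have hw1 := H.le_w
  have hw2 := H.w_le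
  have hn := H.le_add
  have ht := H.t_le
  have ht' := H.le_t
  have hc := abs_le.1 H.abs_sub_le
  rw [hβ, H.μ_eq hα hμ, hα]
  have key : 4 * w ^ 2 * (k + l + 2 + (w - 3 / w)) ≤ 3 * (w + 1) ^ 2 * (k + l + 2 + l + 1) := by
    have h1 : 4 * w ^ 2 ≤ 21 / 10 * (w + 1) ^ 2 := by nlinarith
    have h2 : 7 / 10 * (k + l + 2 + (w - 3 / w)) ≤ k + l + 2 + l + 1 := by linarith
    calc _ ≤ 21 / 10 * (w + 1) ^ 2 * (k + l + 2 + (w - 3 / w)) := by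
          gcongr
          linarith
      _ = 3 * (w + 1) ^ 2 * (7 / 10 * (k + l + 2 + (w - 3 / w))) := by ring
      _ ≤ _ := by gcongr
  generalize k + l + 2 + (w - 3 / w) = N at *
  have e1 : w * (3 - w) / (3 * (w + 1) ^ 2) * (N / (2 * (w + 1))) =
      (3 - w) * (4 * w ^ 2 * N) / (24 * w * (w + 1) ^ 3) := by
    field_simp
    ring
  have e2 : 1 / 2 * ((3 - w) / (2 * w * (w + 1)) * ((k + 1) / 2 + (l + 1))) =
      (3 - w) * (3 * (w + 1) ^ 2 * (k + l + 2 + l + 1)) / (24 * w * (w + 1) ^ 3) := by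
    field_simp
    ring
  rw [e1, e2]
  gcongr
  linarith

/-- The bound for one of the two arcs, in the form in which it enters `IsContactArc.estimates`. As
the two arcs have reciprocal values of `w / √3`, the
deviations from `1 / (k + l + 1)` cancel when the bounds for both are added. -/
theorem sum_bound (H : IsBalanced k l w) (hα : α = (3 - w) / (2 * w * (w + 1)))
    (hμ : μ = (k + 1) / 2 - α * (l + 1)) (hβ : β * (μ + 2) = α * ((k + 1) / 2 + (l + 1))) :
    1 / (w + 1) * (1 / (μ + β)) *
        (2 - 3 / 2 * (1 - 2 / (3 * (k + l + 2))) + w * (3 - w) / (3 * (w + 1) ^ 2) / (μ + 2)) ≤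
      (1 - 3 / 5 * (w - 3 / w) / (k + l + 2 + 2)) / (k + l + 2 - 1) := by
  have hw := H.w_pos
  have hw1 := H.le_w
  have hw2 := H.w_le
  have hn := H.le_add
  have ht := H.t_le
  have ht' := H.le_t
  have hD := H.denom_pos
  have hk := H.one_le_fst
  have hl := H.one_le_snd
  have hs := H.slack_nonneg
  have hm1 := H.μ_eq hα hμ
  have hm2 := H.μ_add_two hα hμ
  have hb := H.β_eq hα hμ hβ
  have hT : (2 - (w - 3 / w)) = (3 - w) * (w + 1) / w := by
    field_simp
    ring
  -- A line slightly above the concave left side.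
  have he : w * (3 - w) / (3 * (w + 1)) ≤ 27 / 50 - 31 / 200 * w := by
    rw [div_le_iff₀ (by positivity)]
    nlinarith [sq_nonneg (w - 345 / 200)]
  set D := k + l + 2 + 4 + (w - 3 / w) + 4 * w with hDdef
  have hK : 0 < (k + l + 2 + (w - 3 / w)) * D + (2 - (w - 3 / w)) * (k + l + 2 + l + 1) := by
    have h1 : 0 < (k + l + 2 + (w - 3 / w)) * D := by
      apply mul_pos _ hD
      linarith
    have h2 : 0 ≤ (2 - (w - 3 / w)) * (k + l + 2 + l + 1) := by
      apply mul_nonneg <;> linarith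
    linarith
  set K := (k + l + 2 + (w - 3 / w)) * D + (2 - (w - 3 / w)) * (k + l + 2 + l + 1) with hKdef
  have hsum : μ + β = K / (2 * (w + 1) * D) := by
    rw [hm1, hb, hKdef, hT]
    field_simp
  have hlhs : 1 / (w + 1) * (1 / (μ + β)) *
        (2 - 3 / 2 * (1 - 2 / (3 * (k + l + 2))) + w * (3 - w) / (3 * (w + 1) ^ 2) / (μ + 2)) =
      ((k + l + 2 + 2) / (k + l + 2) * D + 4 * (w * (3 - w) / (3 * (w + 1)))) / K := by
    rw [hsum, hm2]
    field_simp
    ring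
  rw [hlhs, div_le_div_iff₀ hK (by linarith)]
  have h5 : 4 * (k + l + 2 - 1) * (w * (3 - w) / (3 * (w + 1))) ≤
      4 * (k + l + 2 - 1) * (27 / 50 - 31 / 200 * w) := by
    apply mul_le_mul_of_nonneg_left he
    linarith
  have h6 : (k + l + 2 + 2) / (k + l + 2) * D * (k + l + 2 - 1) =
      (k + l + 2 + 1 - 2 / (k + l + 2)) * D := by
    field_simp
    ring
  nlinarith

end IsBalanced

end LensLawson

namespace LensLawson

open Filter Topology

/-! ### Sum over the two arcs -/

/-- The estimates for one arc, in terms of `w = √3 b / a`. -/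
theorem IsContactArc.balanced_estimates {a b h r σ X ζ w : ℝ} (H : IsContactArc a b h r σ X ζ)
    (k l : ℕ) (hw : Real.sqrt 3 * b = w * a) (HB : IsBalanced k l w) :
    arcArea k l a h r - Real.sqrt 3 / (2 * σ) * (1 - 2 / (3 * (k + l + 2))) *
        ((k + l + 2) * arcVolume k l a b h r) ≤
      a ^ k * b ^ l * σ / 2 *
        ((1 - 3 / 5 * (w - 3 / w) / (k + l + 2 + 2)) / (k + l + 2 - 1)) ∧
    (k + l + 2) * arcVolume k l a b h r ≤
      a ^ k * b ^ l * σ ^ 2 * (Real.sqrt 3 / 2) * (2 * (k + l + 2) / (k + l + 2 + 2) *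
        ((1 - 3 / 5 * (w - 3 / w) / (k + l + 2 + 2)) / (k + l + 2 - 1))) := by
  have ha := H.a_pos; have hb := H.b_pos; have hσ := H.σ_pos
  have h3 : Real.sqrt 3 ^ 2 = 3 := Real.sq_sqrt (by norm_num)
  have h30 : 0 < Real.sqrt 3 := by positivity
  have hw0 := HB.w_pos
  have hw1 := HB.le_w
  have hw2 := HB.w_le
  have hn := HB.le_add
  have hζ : ζ = a * (w + 1) := by rw [H.ζ_eq, hw]; ring
  have hX : Real.sqrt 3 * X = a * (3 - w) := by
    rw [H.X_eq]
    linear_combination a * h3 - hw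
  have hbX : b * X = w * a * (a * (3 - w)) / 3 := by
    rw [← hw, ← hX]
    linear_combination - b * X / 3 * h3
  have hα : a * X / (2 * b * ζ) = (3 - w) / (2 * w * (w + 1)) := by
    rw [hζ, div_eq_div_iff (by positivity) (by positivity)]
    have : X * w = b * (3 - w) := by
      have : Real.sqrt 3 * (X * w) * a = Real.sqrt 3 * (b * (3 - w)) * a := by
        linear_combination w * a * hX - (3 - w) * a * hw
      exact mul_left_cancel₀ h30.ne' (mul_right_cancel₀ ha.ne' this)
    linear_combination 2 * a * (w + 1) * this
  have he : b * X / ζ ^ 2 = w * (3 - w) / (3 * (w + 1) ^ 2) := by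
    rw [hbX, hζ]
    field_simp
  have haζ : a / ζ = 1 / (w + 1) := by
    rw [hζ]
    field_simp
  obtain ⟨α, hα'⟩ : ∃ α, α = (3 - w) / (2 * w * (w + 1)) := ⟨_, rfl⟩
  obtain ⟨μ, hμ⟩ : ∃ μ, μ = ((k : ℝ) + 1) / 2 - α * (l + 1) := ⟨_, rfl⟩
  have hμ0 := HB.μ_pos hα' hμ
  obtain ⟨β, hβ⟩ : ∃ β, β * (μ + 2) = α * (((k : ℝ) + 1) / 2 + (l + 1)) :=
    ⟨α * (((k : ℝ) + 1) / 2 + (l + 1)) / (μ + 2), by field_simp⟩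
  have hβ0 := HB.β_pos hα' hμ hβ
  have hB := HB.sum_bound hα' hμ hβ
  obtain ⟨e1, e2⟩ := H.estimates k l (x := 1 - 2 / (3 * (k + l + 2))) (hα'.trans hα.symm) hβ0 hμ0
    hμ hβ (HB.two_mul_β_le hα' hμ hβ) (HB.α_le hα' hμ hβ)
    (by
      have : (0 : ℝ) ≤ 2 / (3 * (k + l + 2)) := by positivity
      linarith)
    (by
      have h5 : 2 / (3 * ((k : ℝ) + l + 2)) ≤ w / 3 := by
        rw [div_le_div_iff₀ (by positivity) (by norm_num)]
        nlinarith
      have h6 : Real.sqrt 3 * X ≤ 3 * a * (1 - 2 / (3 * (k + l + 2))) := by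
        rw [hX]
        nlinarith
      refine le_of_mul_le_mul_left (h6.trans_eq ?_) h30
      linear_combination (-a) * (1 - 2 / (3 * ((k : ℝ) + l + 2))) * h3)
    (by rw [he]; exact HB.mul_μ_le hα' hμ hβ)
  rw [he, haζ] at e1
  rw [haζ] at e2
  have hM : 0 ≤ a ^ k * b ^ l := by positivity
  constructor
  · refine e1.trans ?_
    refine le_of_eq_of_le ?_ (mul_le_mul_of_nonneg_left hB (by positivity :
      0 ≤ a ^ k * b ^ l * σ / 2))
    ring
  · refine e2.trans ?_
    have hj : 1 / (w + 1) * (1 / (μ + β)) ≤ 2 * (k + l + 2) / (k + l + 2 + 2) *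
        ((1 - 3 / 5 * (w - 3 / w) / (k + l + 2 + 2)) / (k + l + 2 - 1)) := by
      have h0 : 0 ≤ 1 / (w + 1) * (1 / (μ + β)) := by positivity
      have h1 : 0 ≤ w * (3 - w) / (3 * (w + 1) ^ 2) / (μ + 2) := by
        have : 0 ≤ 3 - w := by linarith
        positivity
      have h2 : ((k : ℝ) + l + 2 + 2) / (2 * (k + l + 2)) ≤
          2 - 3 / 2 * (1 - 2 / (3 * (k + l + 2))) +
            w * (3 - w) / (3 * (w + 1) ^ 2) / (μ + 2) := by
        have : 2 - 3 / 2 * (1 - 2 / (3 * ((k : ℝ) + l + 2))) =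
            ((k : ℝ) + l + 2 + 2) / (2 * (k + l + 2)) := by
          field_simp
          ring
        linarith
      have h4 := (mul_le_mul_of_nonneg_left h2 h0).trans hB
      refine le_of_eq_of_le ?_ (mul_le_mul_of_nonneg_left h4
        (by positivity : 0 ≤ 2 * ((k : ℝ) + l + 2) / (k + l + 2 + 2)))
      field_simp
    refine le_of_eq_of_le ?_ (mul_le_mul_of_nonneg_left hj (by positivity :
      0 ≤ a ^ k * b ^ l * σ ^ 2 * (Real.sqrt 3 / 2)))
    ring

variable {k l : ℕ}

/-- The second arc has the roles of `k` and `l` exchanged, and `w` replaced by `3 / w`. -/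
theorem IsBalanced.symm {k l w : ℝ} (H : IsBalanced k l w) : IsBalanced l k (3 / w) where
  one_le_fst := H.one_le_snd
  one_le_snd := H.one_le_fst
  fst_le := H.snd_le
  snd_le := H.fst_le
  w_pos := by have := H.w_pos; positivity
  w_sq := by
    have := H.w_pos
    field_simp
    linear_combination (-1) * H.w_sq
  sub_mem := by
    rcases H.sub_mem with h | h | h | h | h
    · left; linarith
    · right; right; right; left; linarith
    · right; right; right; right; linarith
    · right; left; linarith
    · right; right; left; linarith

/-- Upper bounds for the slice: its area excess over the volume term, and its volume. -/
theorem slice_estimates (HB : IsBalanced k l (Real.sqrt 3 / slope k l))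
    (H : IsWideSlope (slope k l)) :
    sliceArea k l - Real.sqrt 3 / (2 * Real.sqrt (1 + slope k l ^ 2)) *
        (1 - 2 / (3 * (k + l + 2))) * ((k + l + 2) * sliceVolume k l) ≤
      slope k l ^ k * Real.sqrt (1 + slope k l ^ 2) / (k + l + 1) ∧
    sliceVolume k l ≤ slope k l ^ k * Real.sqrt (1 + slope k l ^ 2) ^ 2 *
      (2 * Real.sqrt 3 / ((k + l + 1) * (k + l + 4))) := by
  have h3 : Real.sqrt 3 ^ 2 = 3 := Real.sq_sqrt (by norm_num)
  have hs := H.pos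
  have hn := HB.le_add
  have hw : 3 / (Real.sqrt 3 / slope k l) = Real.sqrt 3 * slope k l := by
    rw [div_div_eq_mul_div, div_eq_iff (by positivity)]
    linear_combination (-slope k l) * h3
  obtain ⟨a1, v1⟩ := (isContactArc_fst H).balanced_estimates k l (w := Real.sqrt 3 / slope k l)
    (by field_simp) HB
  obtain ⟨a2, v2⟩ := (isContactArc_snd H).balanced_estimates l k
    (w := 3 / (Real.sqrt 3 / slope k l)) (by rw [hw, mul_one]) HB.symm
  rw [show (l : ℝ) + k + 2 = k + l + 2 by ring, one_pow, one_mul] at a2 v2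
  rw [one_pow, mul_one] at a1 v1
  generalize hww : Real.sqrt 3 / slope k l = w at *
  have hw0 := HB.w_pos
  have hcancel : (3 / w - 3 / (3 / w)) = -(w - 3 / w) := by
    field_simp
    ring
  rw [hcancel] at a2 v2
  have hn1 : (0 : ℝ) < k + l + 1 := by positivity
  have hn4 : (0 : ℝ) < k + l + 4 := by positivity
  have hn2 : (0 : ℝ) < k + l + 2 := by positivity
  have e1 : (k : ℝ) + l + 2 - 1 = k + l + 1 := by ring
  have e4 : (k : ℝ) + l + 2 + 2 = k + l + 4 := by ring
  rw [e1, e4] at a1 a2 v1 v2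
  have hsum : (1 - 3 / 5 * (w - 3 / w) / (k + l + 4)) / (k + l + 1) +
      (1 - 3 / 5 * -(w - 3 / w) / (k + l + 4)) / (k + l + 1) = 2 / ((k : ℝ) + l + 1) := by
    field_simp
    ring
  unfold sliceArea sliceVolume
  generalize (1 - 3 / 5 * (w - 3 / w) / (k + l + 4)) / ((k : ℝ) + l + 1) = B1 at *
  generalize (1 - 3 / 5 * -(w - 3 / w) / (k + l + 4)) / ((k : ℝ) + l + 1) = B2 at *
  generalize Real.sqrt (1 + slope k l ^ 2) = σ at *
  generalize slope k l ^ k = s at *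
  obtain rfl : B2 = 2 / ((k : ℝ) + l + 1) - B1 := by linarith
  constructor
  · have e : s * σ / (k + l + 1) = s * σ / 2 * B1 + s * σ / 2 * (2 / ((k : ℝ) + l + 1) - B1) := by
      ring
    rw [e]
    linarith
  · refine le_of_mul_le_mul_left ?_ hn2
    have e : (k + l + 2) * (s * σ ^ 2 * (2 * Real.sqrt 3 / ((k + l + 1) * (k + l + 4)))) =
        s * σ ^ 2 * (Real.sqrt 3 / 2) * (2 * (k + l + 2) / (k + l + 4) * B1) +
        s * σ ^ 2 * (Real.sqrt 3 / 2) *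
          (2 * (k + l + 2) / (k + l + 4) * (2 / ((k : ℝ) + l + 1) - B1)) := by
      field_simp
      ring
    rw [e]
    linarith

/-- The ratio `|S^k| |S^l| / (4 ω_{k+l+1})` times the weight `λ^k / σ^{k+l}`, `σ² = 1 + λ²`. -/
noncomputable def orbitRatio (k l : ℕ) : ℝ :=
  Real.sqrt Real.pi * Real.Gamma ((k + l + 3) / 2) /
    (Real.Gamma ((k + 1) / 2) * Real.Gamma ((l + 1) / 2)) *
    (slope k l ^ k / Real.sqrt (1 + slope k l ^ 2) ^ (k + l))

theorem orbitRatio_nonneg (k l : ℕ) : 0 ≤ orbitRatio k l := by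
  have h1 : 0 < Real.Gamma (((k : ℝ) + 1) / 2) := Real.Gamma_pos_of_pos (by positivity)
  have h2 : 0 < Real.Gamma (((l : ℝ) + 1) / 2) := Real.Gamma_pos_of_pos (by positivity)
  have h3 : 0 < Real.Gamma (((k : ℝ) + l + 3) / 2) := Real.Gamma_pos_of_pos (by positivity)
  have h4 : 0 ≤ slope k l := Real.sqrt_nonneg _
  unfold orbitRatio
  positivity

theorem orbitArea_mul_eq (k l : ℕ) :
    orbitArea k l * (slope k l ^ k / Real.sqrt (1 + slope k l ^ 2) ^ (k + l)) =
      4 * unitBallVolume (k + l + 1) * orbitRatio k l := by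
  have h1 : 0 < Real.Gamma (((k : ℝ) + 1) / 2) := Real.Gamma_pos_of_pos (by positivity)
  have h2 : 0 < Real.Gamma (((l : ℝ) + 1) / 2) := Real.Gamma_pos_of_pos (by positivity)
  have h3 : 0 < Real.Gamma (((k : ℝ) + l + 3) / 2) := Real.Gamma_pos_of_pos (by positivity)
  have hp : 0 < Real.sqrt Real.pi := Real.sqrt_pos.2 Real.pi_pos
  have e : (((k + l + 1 : ℕ) : ℝ) / 2 + 1) = ((k : ℝ) + l + 3) / 2 := by
    push_cast
    ring
  rw [orbitArea, sphereArea_eq, sphereArea_eq, unitBallVolume_eq (by omega), e, orbitRatio]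
  field_simp
  ring

/-- The comparison, given the second of the two inequalities of `lawsonEnergy_lt_planeEnergy`. -/
theorem IsBalanced.lawsonEnergy_lt (HB : IsBalanced k l (Real.sqrt 3 / slope k l))
    (H : IsWideSlope (slope k l))
    (h : (1 - 2 / (3 * (k + l + 2)) : ℝ) ^ (k + l + 2) * orbitRatio k l *
      (4 * (k + l + 3) * (k + l + 8)) < (k + l + 1) * (k + l + 4) * (k + l + 5)) :
    lawsonEnergy k l < (planeEnergy (k + l + 2) : EReal) := by
  obtain ⟨hA, hV⟩ := slice_estimates HB H
  have hn := HB.le_add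
  have hk : 1 ≤ k := by exact_mod_cast HB.one_le_fst
  have hσ : 0 < Real.sqrt (1 + slope k l ^ 2) := by positivity
  have hx : 0 ≤ (1 - 2 / (3 * (k + l + 2)) : ℝ) := by
    rw [sub_nonneg, div_le_one (by positivity)]
    linarith
  refine lawsonEnergy_lt_planeEnergy H hk
    (q := Real.sqrt 3 / (2 * Real.sqrt (1 + slope k l ^ 2)) * (1 - 2 / (3 * (k + l + 2))))
    ?_ (by positivity) ?_
  · linarith
  · have hL := le_volume_unitLens (n := k + l + 2) (by omega)
    refine lt_of_lt_of_le ?_ hL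
    have ho := orbitArea_pos k l
    have hoe := orbitArea_mul_eq k l
    have hω := unitBallVolume_pos (k + l + 1)
    rw [show k + l + 2 - 1 = k + l + 1 by omega]
    push_cast
    generalize (1 - 2 / (3 * (k + l + 2)) : ℝ) = x at *
    generalize Real.sqrt (1 + slope k l ^ 2) = σ at *
    generalize slope k l ^ k = s at *
    calc _ ≤ (Real.sqrt 3 / (2 * σ) * x) ^ (k + l + 2) * (orbitArea k l * (s * σ ^ 2 *
          (2 * Real.sqrt 3 / ((k + l + 1) * (k + l + 4))))) := by gcongr
      _ = x ^ (k + l + 2) * (Real.sqrt 3 / 2) ^ (k + l + 3) * (orbitArea k l * (s / σ ^ (k + l))) *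
          (4 / ((k + l + 1) * (k + l + 4))) := by
        rw [mul_pow, div_pow, mul_pow, pow_add σ, div_pow, pow_succ (Real.sqrt 3),
          pow_succ (2 : ℝ) (k + l + 2)]
        field_simp
        ring
      _ = 4 * unitBallVolume (k + l + 1) * (Real.sqrt 3 / 2) ^ (k + l + 3) *
          (x ^ (k + l + 2) * orbitRatio k l * (4 * (k + l + 3) * (k + l + 8)) /
            ((k + l + 1) * (k + l + 4) * ((k + l + 3) * (k + l + 8)))) := by
        rw [hoe]
        field_simp
      _ < 4 * unitBallVolume (k + l + 1) * (Real.sqrt 3 / 2) ^ (k + l + 3) *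
          (((k + l + 1) * (k + l + 4) * (k + l + 5)) /
            ((k + l + 1) * (k + l + 4) * ((k + l + 3) * (k + l + 8)))) := by gcongr
      _ = _ := by
        rw [show (k : ℝ) + l + 2 + 3 = k + l + 5 by ring, show (k : ℝ) + l + 2 + 1 = k + l + 3 by ring,
          show (k : ℝ) + l + 2 + 6 = k + l + 8 by ring]
        field_simp

end LensLawson

namespace LensLawson

open Filter Topology

/-! ### Orbits of nearly equal dimensions -/

/-- Log-convexity of the Gamma function at the midpoint of `x` and `x + 1`. -/
theorem Gamma_add_half_sq_le {x : ℝ} (hx : 0 < x) :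
    Real.Gamma (x + 1 / 2) ^ 2 ≤ x * Real.Gamma x ^ 2 := by
  have h0 := Real.Gamma_pos_of_pos hx
  have h := Real.Gamma_mul_add_mul_le_rpow_Gamma_mul_rpow_Gamma hx (by linarith : 0 < x + 1)
    (by norm_num : (0 : ℝ) < 1 / 2) (by norm_num : (0 : ℝ) < 1 / 2) (by norm_num)
  rw [Real.Gamma_add_one hx.ne', ← Real.sqrt_eq_rpow, ← Real.sqrt_eq_rpow,
    ← Real.sqrt_mul h0.le, show 1 / 2 * x + 1 / 2 * (x + 1) = x + 1 / 2 by ring] at h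
  have h1 := Real.Gamma_pos_of_pos (by linarith : 0 < x + 1 / 2)
  calc _ ≤ Real.sqrt (Real.Gamma x * (x * Real.Gamma x)) ^ 2 := by gcongr
    _ = _ := by
      rw [Real.sq_sqrt (by positivity)]
      ring

theorem Gamma_duplication_nat (m : ℕ) :
    Real.Gamma ((m + 1) / 2) * Real.Gamma ((m + 2) / 2) * 2 ^ m =
      Real.Gamma (m + 1) * Real.sqrt Real.pi := by
  have h := Real.Gamma_mul_Gamma_add_half (((m : ℝ) + 1) / 2)
  rw [show ((m : ℝ) + 1) / 2 + 1 / 2 = (m + 2) / 2 by ring,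
    show 2 * (((m : ℝ) + 1) / 2) = m + 1 by ring, show (1 : ℝ) - (m + 1) = -m by ring,
    Real.rpow_neg (by norm_num), Real.rpow_natCast] at h
  rw [h]
  field_simp

theorem slope_sq (k l : ℕ) : slope k l ^ 2 = k / l := Real.sq_sqrt (by positivity)

theorem slope_self {k : ℕ} (hk : 1 ≤ k) : slope k k = 1 := by
  have : (0 : ℝ) < k := by exact_mod_cast hk
  rw [slope, div_self this.ne', Real.sqrt_one]

theorem orbitRatio_self_sq_le {k : ℕ} (hk : 1 ≤ k) : orbitRatio k k ^ 2 ≤ (k + 1) ^ 2 / 2 := by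
  have hd := Gamma_duplication_nat k
  have h1 : 0 < Real.Gamma (((k : ℝ) + 1) / 2) := Real.Gamma_pos_of_pos (by positivity)
  have h2 : 0 < Real.Gamma ((k : ℝ) + 1) := Real.Gamma_pos_of_pos (by positivity)
  have b1 := Gamma_add_half_sq_le (by positivity : 0 < ((k : ℝ) + 1) / 2)
  have b2 := Gamma_add_half_sq_le (by positivity : 0 < (k : ℝ) + 1)
  rw [show ((k : ℝ) + 1) / 2 + 1 / 2 = (k + 2) / 2 by ring] at b1
  rw [show (k : ℝ) + 1 + 1 / 2 = (k + k + 3) / 2 by ring] at b2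
  have hR : orbitRatio k k = Real.Gamma ((k + 2) / 2) * Real.Gamma ((k + k + 3) / 2) /
      (Real.Gamma ((k + 1) / 2) * Real.Gamma (k + 1)) := by
    rw [orbitRatio, slope_self hk, one_pow, one_pow, (two_mul k).symm, pow_mul,
      Real.sq_sqrt (by norm_num), show (1 : ℝ) + 1 = 2 by norm_num]
    field_simp
    linear_combination (-1 : ℝ) * hd
  rw [hR, div_pow, mul_pow, mul_pow, div_le_iff₀ (by positivity)]
  calc _ ≤ (((k : ℝ) + 1) / 2 * Real.Gamma ((k + 1) / 2) ^ 2) *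
        ((k + 1) * Real.Gamma (k + 1) ^ 2) := by gcongr
    _ = _ := by ring

/-- The exact value in dimension four, where the bound `orbitRatio_self_sq_le` is too weak. -/
theorem orbitRatio_one_one : orbitRatio 1 1 = 3 / 8 * Real.pi := by
  have h3 : Real.Gamma ((1 + 1 + 3) / 2) = 3 / 4 * Real.sqrt Real.pi := by
    rw [show ((1 : ℝ) + 1 + 3) / 2 = 1 / 2 + 1 + 1 by norm_num, Real.Gamma_add_one (by norm_num),
      Real.Gamma_add_one (by norm_num), Real.Gamma_one_half_eq]
    ring
  rw [orbitRatio, slope_self le_rfl]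
  have h2 : Real.sqrt 2 ^ 2 = 2 := Real.sq_sqrt (by norm_num)
  norm_num [h2]
  rw [show (5 : ℝ) / 2 = (1 + 1 + 3) / 2 by norm_num, h3]
  linear_combination 3 / 8 * Real.mul_self_sqrt Real.pi_pos.le

/-- By the duplication formula the Gamma factors cancel up to `(m + 1) 2^m`. -/
theorem orbitRatio_succ_sq_le (m : ℕ) :
    orbitRatio m (m + 1) ^ 2 ≤ ((m : ℝ) + 1) ^ 3 / (2 * m + 1) := by
  have hd := Gamma_duplication_nat m
  have h1 : 0 < Real.Gamma (((m : ℝ) + 1) / 2) := Real.Gamma_pos_of_pos (by positivity)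
  have h2 : 0 < Real.Gamma (((m : ℝ) + 2) / 2) := Real.Gamma_pos_of_pos (by positivity)
  have h3 : 0 < Real.Gamma ((m : ℝ) + 1) := Real.Gamma_pos_of_pos (by positivity)
  have hp : 0 < Real.sqrt Real.pi := Real.sqrt_pos.2 Real.pi_pos
  have hs : slope m (m + 1) ^ 2 = m / (m + 1) := by rw [slope_sq]; push_cast; rfl
  have hσ : 1 + (m : ℝ) / (m + 1) = (2 * m + 1) / (m + 1) := by
    field_simp
    ring
  have hΓ : Real.sqrt Real.pi * Real.Gamma ((m + (m + 1 : ℕ) + 3) / 2) /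
      (Real.Gamma ((m + 1) / 2) * Real.Gamma (((m + 1 : ℕ) + 1) / 2)) = (m + 1) * 2 ^ m := by
    rw [show ((m : ℝ) + (m + 1 : ℕ) + 3) / 2 = m + 1 + 1 by push_cast; ring,
      show ((m + 1 : ℕ) + 1 : ℝ) / 2 = (m + 2) / 2 by push_cast; ring,
      Real.Gamma_add_one (by positivity), div_eq_iff (by positivity)]
    linear_combination (-((m : ℝ) + 1)) * hd
  have hq : 4 * ((m : ℝ) / (m + 1)) / (((2 * m + 1) / (m + 1)) ^ 2) ≤ 1 := by
    rw [div_le_one (by positivity), div_pow, ← mul_div_assoc,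
      div_le_div_iff₀ (by positivity) (by positivity)]
    have : (0 : ℝ) ≤ m := by positivity
    nlinarith
  have hR : orbitRatio m (m + 1) ^ 2 = (m + 1) ^ 3 / (2 * m + 1) *
      (4 * ((m : ℝ) / (m + 1)) / (((2 * m + 1) / (m + 1)) ^ 2)) ^ m := by
    rw [orbitRatio, hΓ, mul_pow, div_pow, ← pow_mul (slope _ _), mul_comm m 2, pow_mul (slope _ _),
      hs, ← pow_mul (Real.sqrt _), mul_comm (m + (m + 1)) 2, pow_mul (Real.sqrt _),
      Real.sq_sqrt (by positivity), hσ, ← add_assoc, pow_succ _ (m + m), ← two_mul,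
      pow_mul _ 2 m, mul_pow, ← pow_mul (2 : ℝ), mul_comm m 2, pow_mul (2 : ℝ), div_pow (4 * _),
      mul_pow (4 : ℝ)]
    norm_num
    field_simp
  rw [hR]
  exact mul_le_of_le_one_right (by positivity) (pow_le_one₀ (by positivity) hq)

theorem orbitRatio_add_two_sq_le {m : ℕ} (hm : 2 ≤ m) :
    orbitRatio m (m + 2) ^ 2 ≤ 6 / 11 * ((m : ℝ) + 2) ^ 2 := by
  have hd := Gamma_duplication_nat m
  have hm' : (2 : ℝ) ≤ m := by exact_mod_cast hm
  have h1 : 0 < Real.Gamma (((m : ℝ) + 1) / 2) := Real.Gamma_pos_of_pos (by positivity)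
  have h2 : 0 < Real.Gamma (((m : ℝ) + 2) / 2) := Real.Gamma_pos_of_pos (by positivity)
  have h3 : 0 < Real.Gamma ((m : ℝ) + 1) := Real.Gamma_pos_of_pos (by positivity)
  have hp : 0 < Real.sqrt Real.pi := Real.sqrt_pos.2 Real.pi_pos
  have hs : slope m (m + 2) ^ 2 = m / (m + 2) := by rw [slope_sq]; push_cast; rfl
  have hσ : 1 + (m : ℝ) / (m + 2) = 2 * (m + 1) / (m + 2) := by
    field_simp
    ring
  have b1 := Gamma_add_half_sq_le (by positivity : 0 < ((m : ℝ) + 1) / 2)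
  have b2 := Gamma_add_half_sq_le (by positivity : 0 < (m : ℝ) + 1 + 1)
  rw [show ((m : ℝ) + 1) / 2 + 1 / 2 = (m + 2) / 2 by ring] at b1
  rw [Real.Gamma_add_one (by positivity : (m : ℝ) + 1 ≠ 0)] at b2
  have hΓ : (Real.sqrt Real.pi * Real.Gamma ((m + (m + 2 : ℕ) + 3) / 2) /
      (Real.Gamma ((m + 1) / 2) * Real.Gamma (((m + 2 : ℕ) + 1) / 2))) ^ 2 ≤
      2 * (m + 1) * (m + 2) * 4 ^ m := by
    have e : Real.sqrt Real.pi * Real.Gamma ((m + (m + 2 : ℕ) + 3) / 2) /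
        (Real.Gamma ((m + 1) / 2) * Real.Gamma (((m + 2 : ℕ) + 1) / 2)) =
        2 ^ m * (Real.Gamma ((m + 2) / 2) * Real.Gamma (m + 1 + 1 + 1 / 2)) /
          (Real.Gamma (m + 1) * ((m + 1) / 2 * Real.Gamma ((m + 1) / 2))) := by
      rw [show ((m : ℝ) + (m + 2 : ℕ) + 3) / 2 = m + 1 + 1 + 1 / 2 by push_cast; ring,
        show ((m + 2 : ℕ) + 1 : ℝ) / 2 = (m + 1) / 2 + 1 by push_cast; ring,
        Real.Gamma_add_one (by positivity), div_eq_div_iff (by positivity) (by positivity)]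
      linear_combination (-Real.Gamma (m + 1 + 1 + 1 / 2) * ((m + 1) / 2) *
        Real.Gamma ((m + 1) / 2)) * hd
    rw [e, div_pow, mul_pow, mul_pow (Real.Gamma _), div_le_iff₀ (by positivity), ← pow_mul,
      mul_comm m 2, pow_mul]
    norm_num only [show (2 : ℝ) ^ 2 = 4 by norm_num]
    calc _ ≤ 4 ^ m * ((((m : ℝ) + 1) / 2 * Real.Gamma ((m + 1) / 2) ^ 2) *
          ((m + 1 + 1) * (((m : ℝ) + 1) * Real.Gamma (m + 1)) ^ 2)) := by gcongr
      _ = _ := by ring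
  obtain ⟨u, hu⟩ : ∃ u : ℝ, u = 1 / (m + 1) ^ 2 := ⟨_, rfl⟩
  have hu0 : 0 < u := by rw [hu]; positivity
  have hu1 : u ≤ 1 := by
    rw [hu, div_le_one (by positivity)]
    nlinarith
  have hq : 4 * ((m : ℝ) / (m + 2)) / ((2 * (m + 1) / (m + 2)) ^ 2) = 1 - u := by
    rw [hu]
    field_simp
    ring
  have hbern : (1 - u) ^ m * (1 + m * u) ≤ 1 := by
    have h5 := one_add_mul_le_pow (by linarith : -2 ≤ u) m
    calc _ ≤ (1 - u) ^ m * (1 + u) ^ m := by gcongr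
      _ = (1 - u ^ 2) ^ m := by rw [← mul_pow]; ring
      _ ≤ 1 := pow_le_one₀ (by nlinarith) (by nlinarith)
  calc orbitRatio m (m + 2) ^ 2 ≤ 2 * (m + 1) * (m + 2) * 4 ^ m *
        (slope m (m + 2) ^ m / Real.sqrt (1 + slope m (m + 2) ^ 2) ^ (m + (m + 2))) ^ 2 := by
        rw [orbitRatio, mul_pow]
        gcongr
    _ = ((m : ℝ) + 2) ^ 3 / (2 * (m + 1)) * (1 - u) ^ m := by
      rw [← hq, div_pow, ← pow_mul (slope _ _), mul_comm m 2, pow_mul (slope _ _),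
        hs, ← pow_mul (Real.sqrt _), mul_comm (m + (m + 2)) 2, pow_mul (Real.sqrt _),
        Real.sq_sqrt (by positivity), hσ, ← add_assoc, pow_add _ (m + m), ← two_mul m,
        pow_mul _ 2 m, div_pow (4 * _), mul_pow (4 : ℝ)]
      field_simp
    _ ≤ 6 / 11 * ((m : ℝ) + 2) ^ 2 := by
      have h5 : (m + 2) / (m + 1) ≤ 12 / 11 * (1 + m * u) := by
        rw [hu, div_le_iff₀ (by positivity)]
        have : 12 / 11 * (1 + (m : ℝ) * (1 / (m + 1) ^ 2)) * (m + 1) =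
            12 / 11 * ((m + 1) ^ 2 + m) / (m + 1) := by
          field_simp
        rw [this, le_div_iff₀ (by positivity)]
        nlinarith
      have h6 : 0 ≤ (1 - u) ^ m := pow_nonneg (by linarith) _
      calc _ = (m + 2) / (m + 1) * (((m : ℝ) + 2) ^ 2 / 2 * (1 - u) ^ m) := by
            field_simp
        _ ≤ 12 / 11 * (1 + m * u) * (((m : ℝ) + 2) ^ 2 / 2 * (1 - u) ^ m) := by gcongr
        _ = 6 / 11 * ((m : ℝ) + 2) ^ 2 * ((1 - u) ^ m * (1 + m * u)) := by ring
        _ ≤ _ := mul_le_of_le_one_right (by positivity) hbern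

end LensLawson

namespace LensLawson

open Filter Topology

/-! ### The comparison -/

/-- The right side is slightly above `exp (-2/3)`. -/
theorem one_sub_pow_le {n : ℕ} (hn : 1 ≤ n) :
    (1 - 2 / (3 * n) : ℝ) ^ n ≤ 1027 / 2000 := by
  have hn' : (1 : ℝ) ≤ n := by exact_mod_cast hn
  have h0 : (0 : ℝ) ≤ 1 - 2 / (3 * n) := by
    rw [sub_nonneg, div_le_one (by positivity)]
    linarith
  have h1 : (1 - 2 / (3 * n) : ℝ) ^ n ≤ Real.exp (-(2 / 3)) := by
    calc _ ≤ Real.exp (-(2 / (3 * n))) ^ n := by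
          gcongr
          exact Real.one_sub_le_exp_neg _
      _ = _ := by
          rw [← Real.exp_nat_mul]
          congr 1
          field_simp
  refine h1.trans (le_of_pow_le_pow_left₀ (n := 3) (by norm_num) (by norm_num) ?_)
  have h2 : Real.exp (-(2 / 3)) ^ 3 = Real.exp (-1) ^ 2 := by
    rw [← Real.exp_nat_mul, ← Real.exp_nat_mul]
    norm_num
  rw [h2]
  calc Real.exp (-1) ^ 2 ≤ (3679 / 10000) ^ 2 := by
        gcongr
        have := Real.exp_neg_one_lt_d9
        linarith
    _ ≤ _ := by norm_num

variable {k l : ℕ}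

theorem isBalanced_slope (hk : 1 ≤ k) (hl : 1 ≤ l) (h1 : k ≤ 2 * l) (h2 : l ≤ 2 * k)
    (hc : l = k ∨ l = k + 1 ∨ l = k + 2) : IsBalanced k l (Real.sqrt 3 / slope k l) := by
  have hk' : (1 : ℝ) ≤ k := by exact_mod_cast hk
  have hl' : (1 : ℝ) ≤ l := by exact_mod_cast hl
  have hs : 0 < slope k l := Real.sqrt_pos.2 (by positivity)
  refine ⟨hk', hl', by exact_mod_cast h1, by exact_mod_cast h2, by positivity, ?_, ?_⟩
  · rw [div_pow, slope_sq, Real.sq_sqrt (by norm_num)]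
    field_simp
  · rcases hc with h | h | h
    · left
      rw [h, sub_self]
    · right; left
      rw [h]
      push_cast
      ring
    · right; right; left
      rw [h]
      push_cast
      ring

/-- The comparison, given a bound for `orbitRatio` that is linear in the dimension. The cases below
have `r` slightly above `1 / √8`. -/
theorem lawsonEnergy_lt_of_orbitRatio_le (HB : IsBalanced k l (Real.sqrt 3 / slope k l))
    (H : IsWideSlope (slope k l)) {r : ℝ} (hr0 : 0 ≤ r)
    (hr : orbitRatio k l ^ 2 ≤ r ^ 2 * (k + l + 2) ^ 2)
    (hn : r * (4 * 1027 / 2000) * ((k + l + 2) * (k + l + 3) * (k + l + 8)) <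
      ((k + l + 1) * (k + l + 4) * (k + l + 5) : ℝ)) :
    lawsonEnergy k l < (planeEnergy (k + l + 2) : EReal) := by
  refine HB.lawsonEnergy_lt H (lt_of_le_of_lt ?_ hn)
  have hR : orbitRatio k l ≤ r * (k + l + 2) := by
    refine le_of_sq_le_sq (hr.trans_eq (by ring)) (by positivity)
  have hx := one_sub_pow_le (n := k + l + 2) (by omega)
  push_cast at hx
  have hR0 := orbitRatio_nonneg k l
  calc _ ≤ 1027 / 2000 * (r * (k + l + 2)) * (4 * (k + l + 3) * (k + l + 8) : ℝ) := by gcongr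
    _ = _ := by ring

theorem lawsonEnergy_self_lt (hk : 1 ≤ k) :
    lawsonEnergy k k < (planeEnergy (k + k + 2) : EReal) := by
  have HB := isBalanced_slope hk hk (by omega) (by omega) (Or.inl rfl)
  have H : IsWideSlope (slope k k) := isWideSlope_slope (by omega) (by omega)
  have hR := orbitRatio_self_sq_le hk
  have hR0 := orbitRatio_nonneg k k
  -- In dimensions four and six, the bound `exp (-2 / 3)` for the power is too weak.
  rcases (by omega : k = 1 ∨ k = 2 ∨ 3 ≤ k) with rfl | rfl | h3
  · refine HB.lawsonEnergy_lt H ?_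
    rw [orbitRatio_one_one]
    have := Real.pi_lt_d2
    norm_num
    linarith
  · refine HB.lawsonEnergy_lt H ?_
    have : orbitRatio 2 2 ≤ 2122 / 1000 := by
      refine le_of_sq_le_sq (hR.trans ?_) (by norm_num)
      norm_num
    norm_num
    linarith
  · have h3' : (3 : ℝ) ≤ k := by exact_mod_cast h3
    refine lawsonEnergy_lt_of_orbitRatio_le HB H (r := 8839 / 25000) (by norm_num) ?_ ?_
    · nlinarith
    · have : 0 ≤ ((k : ℝ) - 3) ^ 2 * (k - 3) := by
        have : 0 ≤ (k : ℝ) - 3 := by linarith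
        positivity
      nlinarith [sq_nonneg ((k : ℝ) - 3)]

theorem lawsonEnergy_succ_lt {m : ℕ} (hm : 1 ≤ m) :
    lawsonEnergy m (m + 1) < (planeEnergy (m + (m + 1) + 2) : EReal) := by
  have HB := isBalanced_slope hm (by omega : 1 ≤ m + 1) (by omega) (by omega) (Or.inr (Or.inl rfl))
  have H : IsWideSlope (slope m (m + 1)) := isWideSlope_slope (by omega) (by omega)
  have hR := orbitRatio_succ_sq_le m
  have hR0 := orbitRatio_nonneg m (m + 1)
  -- In dimension five, the bound `exp (-2 / 3)` for the power is too weak.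
  rcases (by omega : m = 1 ∨ 2 ≤ m) with rfl | h2
  · refine HB.lawsonEnergy_lt H ?_
    have : orbitRatio 1 (1 + 1) ≤ 1633 / 1000 := by
      refine le_of_sq_le_sq (hR.trans ?_) (by norm_num)
      norm_num
    norm_num at this ⊢
    linarith
  · have h2' : (2 : ℝ) ≤ m := by exact_mod_cast h2
    refine lawsonEnergy_lt_of_orbitRatio_le HB H (r := 8839 / 25000) (by norm_num) ?_ ?_
    · refine hR.trans ?_
      rw [div_le_iff₀ (by positivity)]
      push_cast
      have : 0 ≤ (m : ℝ) ^ 3 := by positivity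
      nlinarith
    · push_cast
      have : 0 ≤ ((m : ℝ) - 2) ^ 2 * (m - 2) := by
        have : 0 ≤ (m : ℝ) - 2 := by linarith
        positivity
      nlinarith [sq_nonneg ((m : ℝ) - 2)]

theorem lawsonEnergy_add_two_lt {m : ℕ} (hm : 2 ≤ m) :
    lawsonEnergy m (m + 2) < (planeEnergy (m + (m + 2) + 2) : EReal) := by
  have HB := isBalanced_slope (by omega : 1 ≤ m) (by omega : 1 ≤ m + 2) (by omega) (by omega)
    (Or.inr (Or.inr rfl))
  have H : IsWideSlope (slope m (m + 2)) := isWideSlope_slope (by omega) (by omega)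
  have hR := orbitRatio_add_two_sq_le hm
  have h2' : (2 : ℝ) ≤ m := by exact_mod_cast hm
  refine lawsonEnergy_lt_of_orbitRatio_le HB H (r := 3693 / 10000) (by norm_num) ?_ ?_
  · refine hR.trans ?_
    push_cast
    nlinarith
  · push_cast
    have : 0 ≤ ((m : ℝ) - 2) ^ 2 * (m - 2) := by
      have : 0 ≤ (m : ℝ) - 2 := by linarith
      positivity
    nlinarith [sq_nonneg ((m : ℝ) - 2)]

end LensLawson

theorem proposition7p1 :
    (∀ n k : ℕ, 4 ≤ n → n ≤ 2700 → Even n → k = n / 2 - 1 →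
      LensLawson.lawsonEnergy k k < (LensLawson.planeEnergy n : EReal) ∧
      (8 ≤ n → LensLawson.lawsonEnergy (k - 1) (k + 1) < (LensLawson.planeEnergy n : EReal))) ∧
    (∀ n k : ℕ, 5 ≤ n → n ≤ 2700 → Odd n → k = (n - 1) / 2 →
      LensLawson.lawsonEnergy (k - 1) k < (LensLawson.planeEnergy n : EReal)) := by
  refine ⟨fun n k hn _ he hk => ⟨?_, fun h8 => ?_⟩, fun n k hn _ ho hk => ?_⟩
  · obtain ⟨j, rfl⟩ := he
    obtain rfl : j = k + 1 := by omega
    rw [show k + 1 + (k + 1) = k + k + 2 by ring]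
    exact LensLawson.lawsonEnergy_self_lt (by omega)
  · obtain ⟨j, rfl⟩ := he
    obtain ⟨m, rfl⟩ : ∃ m, k = m + 1 := ⟨k - 1, by omega⟩
    obtain rfl : j = m + 2 := by omega
    rw [show m + 2 + (m + 2) = m + (m + 2) + 2 by ring, Nat.add_sub_cancel]
    exact LensLawson.lawsonEnergy_add_two_lt (by omega)
  · obtain ⟨j, rfl⟩ := ho
    obtain ⟨m, rfl⟩ : ∃ m, k = m + 1 := ⟨k - 1, by omega⟩
    obtain rfl : j = m + 1 := by omega
    rw [show 2 * (m + 1) + 1 = m + (m + 1) + 2 by ring, Nat.add_sub_cancel]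
    exact LensLawson.lawsonEnergy_succ_lt (by omega)
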